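/- Let $k$ be a field, $n\ge 0$, and let $S=k[x_0,\dots,x_n]$ be $\mathbb Z$-graded by $\deg x_i=w_i$ with positive integers $w_i$. Let $B=(x_0,\dots,x_n)$ and let $\mathcal X=[(\operatorname{Spec}S\smallsetminus V(B))/\mathbb G_m]$ be the weighted projective stack with weights $w_0,\dots,w_n$. Let $E=\Lambda_k(e_0,\dots,e_n)$, graded by $\mathbb Z\oplus\mathbb Z$ with $\deg e_i=(-w_i;-1)$, let $\mathfrak m=\langle e_0,\dots,e_n\rangle$, and let $\omega_E=\operatorname{Hom}_k(E,k)$. All $E$-modules are right modules; a graded right module is also a left module via $em=(-1)^{\operatorname{aux}(e)\operatorname{aux}(m)}me$, where $\operatorname{aux}$ is the second degree. A *differential $E$-module* is a $\mathbb Z\oplus\mathbb Z$-graded $E$-module $D$ with an $E$-linear endomorphism $\partial$ of degree $(0;-1)$ and $\partial^2=0$; its homology is $\ker\partial/\operatorname{im}\partial$, and it is exact if this vanishes. Morphisms are $E$-linear maps of degree $0$ commuting with $\partial$, and quasi-isomorphisms are morphisms inducing isomorphisms on homology. The cone of $f:D\to D'$ is $D'\oplus D(0;-1)$ with differential $(x,y)\mapsto(\partial'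 x+f(y),-\partial y)$. $D$ is *free* if it has an $E$-basis of homogeneous elements, and *minimal* if $\partial(D)\subseteq D\mathfrak m$. A *free flag* is a differential module of the form $D=\bigoplus_{l\ge0}D_l$ with $D_l$ graded free and $\partial(D_l)\subseteq\bigoplus_{l'<l}D_{l'}$. A *free resolution* of $D$ is a quasi-isomorphism $G\to D$ that factors as $G\to P\to D$, where $G\to P$ is a split injection of differential modules, $P$ is a free flag and $P\to D$ is a quasi-isomorphism; it is a *minimal free resolution* if $G$ is minimal. For a graded $S$-module $M$, $\mathbf R(M)$ is the differential $E$-module $\bigoplus_a M_a\otimes_k\omega_E(-a;0)$ with differential $m\otimes f\mapsto\sum_i x_im\otimes e_if$. Let $\mathcal F$ be a coherent sheaf on $\mathcal X$. Consider the following properties of a differential $E$-module $T$: 1. $T$ is minimal and free. 2. $H^j(\mathcal X,\mathcal F(a))\cong\underline{\operatorname{Hom}}_E(k,T)_{(a;-j)}$ for all $a,j\in\mathbb Z$. 3. For every graded $S$-module $M$ with $\widetilde M=\mathcal F$ and $H^0_B(M)=0$, the injection $M\hookrightarrow\bigoplus_aH^0(\mathcal X,\mathcal F(a))$, composed with the isomorphisms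 in (2) for $j=0$, is the restriction of an injective morphism $\mathbf R(M)\hookrightarrow T$ of differential $E$-modules to $M=\bigoplus_a\underline{\operatorname{Hom}}_E(k,\mathbf R(M))_{(a;0)}$. (The isomorphisms in (2) do not depend on $M$.) 4. For every $I\subseteq\{0,\dots,n\}$ with $B\subseteq(x_i:i\in I)$, $T\otimes_EE_I$ is exact, where $E_I=E/\langle e_i:i\notin I\rangle$. Then: (i) There is a finitely generated graded $S$-module $M$ with $\widetilde M\cong\mathcal F$ and $H^0_B(M)=0$. (ii) If $T$ has properties (1)–(4), and $M$ is any module as in (i), then $\mathbf R(M)$ has a minimal free resolution, and for every minimal free resolution $\varepsilon:G\to\mathbf R(M)$ there is an isomorphism $T\cong\operatorname{cone}(\varepsilon)$ of differential $E$-modules. (iii) Any two differential $E$-modules with properties (1)–(4) (for the same $\mathcal F$) are isomorphic. That is, properties (1)–(4) determine the Tate resolution of $\mathcal F$ up to isomorphism. -/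

import Mathlib

open scoped TensorProduct

universe u

noncomputable section

namespace WeightedTate

/-! ## Internal gradings -/

section Internal

variable {k V ι : Type*} [Field k] [AddCommGroup V] [Module k V] [DecidableEq ι]

theorem exists_coaction {A : ι → Submodule k V} (h : DirectSum.IsInternal A) :
    ∃ δ : V →ₗ[k] (ι →₀ V), ∀ i, ∀ v ∈ A i, δ v = Finsupp.single i v := by
  refine ⟨(DirectSum.toModule k ι (ι →₀ V) fun i => Finsupp.lsingle i ∘ₗ (A i).subtype) ∘ₗ
    (LinearEquiv.ofBijective (DirectSum.coeLinearMap A) h).symm.toLinearMap, ?_⟩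
  intro i v hv
  have : (LinearEquiv.ofBijective (DirectSum.coeLinearMap A) h).symm v
      = DirectSum.lof k ι (fun i => A i) i ⟨v, hv⟩ := by
    apply (LinearEquiv.symm_apply_eq _).2
    exact (DirectSum.coeLinearMap_lof A i ⟨v, hv⟩).symm
  rw [LinearMap.comp_apply, LinearEquiv.coe_coe, this, DirectSum.toModule_lof]
  rfl

theorem isInternal_of_coaction {A : ι → Submodule k V} (δ : V →ₗ[k] (ι →₀ V))
    (hδ : ∀ i, ∀ v ∈ A i, δ v = Finsupp.single i v) (ht : iSup A = ⊤) :
    DirectSum.IsInternal A := by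
  refine DirectSum.isInternal_submodule_of_iSupIndep_of_iSup_eq_top ?_ ht
  rw [iSupIndep_def]
  intro i
  rw [Submodule.disjoint_def]
  intro v hv hv'
  have h1 : (δ v) i = v := by simp [hδ i v hv]
  have h2 : (⨆ j, ⨆ (_ : j ≠ i), A j) ≤ LinearMap.ker (Finsupp.lapply i ∘ₗ δ) := by
    refine iSup_le fun j => iSup_le fun hj => ?_
    intro y hy
    simp [hδ j y hy, hj]
  have h3 := h2 hv'
  simp only [LinearMap.mem_ker, LinearMap.comp_apply, Finsupp.lapply_apply] at h3
  rw [← h1, h3]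

end Internal

/-! ## The polynomial ring, graded modules, the irrelevant ideal -/

/-- The Cox ring `S = k[x_0, …, x_n]`.  It is `ℤ`-graded by `deg x_i = w_i` for given positive
weights `w`. -/
abbrev Cox (k : Type u) [Field k] (n : ℕ) : Type u := MvPolynomial (Fin (n + 1)) k

/-- A `ℤ`-graded module over the Cox ring with weights `w`. -/
structure GrMod (k : Type u) [Field k] {n : ℕ} (w : Fin (n + 1) → ℕ) where
  carrier : Type u
  [addCommGroup : AddCommGroup carrier]
  [module : Module (Cox k n) carrier]
  [moduleBase : Module k carrier]
  [isScalarTower : IsScalarTower k (Cox k n) carrier]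
  grading : ℤ → Submodule k carrier
  isInternal : DirectSum.IsInternal grading
  smul_mem : ∀ (a : ℤ) (b : ℕ) (p : Cox k n) (m : carrier),
    p ∈ MvPolynomial.weightedHomogeneousSubmodule k w b → m ∈ grading a →
      p • m ∈ grading (a + b)

attribute [instance] GrMod.addCommGroup GrMod.module GrMod.moduleBase GrMod.isScalarTower

/-- The irrelevant ideal `B = (x_0, …, x_n)` of a weighted projective stack. -/
def irrelevantIdeal (k : Type u) [Field k] (n : ℕ) : Ideal (Cox k n) :=
  Ideal.span (Set.range MvPolynomial.X)

/-- The monomial prime `P_I = (x_i : i ∈ I)`. -/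
def monomialPrime (k : Type u) [Field k] {n : ℕ} (I : Finset (Fin (n + 1))) : Ideal (Cox k n) :=
  Ideal.span (MvPolynomial.X '' (I : Set (Fin (n + 1))))

/-- `I` is irrelevant if `P_I` contains the irrelevant ideal. -/
def IsIrrelevant (k : Type u) [Field k] {n : ℕ} (I : Finset (Fin (n + 1))) : Prop :=
  irrelevantIdeal k n ≤ monomialPrime k I

/-- `H^0_B(M) = 0`: no nonzero element of `M` is killed by a power of the irrelevant ideal. -/
def GrMod.NoTorsion {k : Type u} [Field k] {n : ℕ} {w : Fin (n + 1) → ℕ} (M : GrMod k w) : Prop :=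
  ∀ m : M.carrier, (∃ r : ℕ, ∀ b ∈ irrelevantIdeal k n ^ r, b • m = 0) → m = 0

/-! ## Coherent sheaves on the weighted projective stack and their cohomology

The stack is `[Z / G]` with `Z = Spec S ∖ V(B)` and `G` the multiplicative group acting with weights
`w`.  The sets `D(x_I)`, where `x_I = ∏_{i ∈ I} x_i` and `I` is a nonempty subset of `{0, …, n}`,
are a `G`-invariant affine open cover of `Z` that is closed under intersection
(`D(x_I) ∩ D(x_J) = D(x_{I ∪ J})`).  A quasi-coherent sheaf on the stack is a `G`-equivariant
quasi-coherent module on `Z`, which is the same as the collection of its `ℤ`-graded modules of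
sections over these opens, together with the restriction maps, which have to be localizations. -/

/-- Nonempty subsets `I` of `{0, …, n}`, standing for the opens `D(x_I)`;
`I ≤ J` gives `D(x_J) ⊆ D(x_I)`. -/
abbrev Chart (n : ℕ) : Type := {I : Finset (Fin (n + 1)) // I.Nonempty}

/-- `x_I = ∏_{i ∈ I} x_i`. -/
def chartFn (k : Type u) [Field k] {n : ℕ} (I : Chart n) : Cox k n :=
  ∏ i ∈ I.1, MvPolynomial.X i

/-- The chart `D(x_i)`. -/
def pt {n : ℕ} (i : Fin (n + 1)) : Chart n := ⟨{i}, Finset.singleton_nonempty i⟩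

/-- A coherent sheaf on the weighted projective stack with weights `w`. -/
structure CoherentSheaf (k : Type u) [Field k] {n : ℕ} (w : Fin (n + 1) → ℕ) where
  /-- sections over `D(x_I)`, graded by the characters of `G` -/
  sec : Chart n → GrMod k w
  res : ∀ {I J : Chart n}, I ≤ J → (sec I).carrier →ₗ[Cox k n] (sec J).carrier
  res_mem : ∀ {I J : Chart n} (h : I ≤ J) (a : ℤ) (s : (sec I).carrier),
    s ∈ (sec I).grading a → res h s ∈ (sec J).grading a
  res_self : ∀ (I : Chart n) (s : (sec I).carrier), res (le_refl I) s = s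
  res_res : ∀ {I J K : Chart n} (h : I ≤ J) (h' : J ≤ K) (s : (sec I).carrier),
    res h' (res h s) = res (h.trans h') s
  /-- the restriction maps are localizations (for `I = J`: `x_I` is invertible on `D(x_I)`) -/
  isLocalizedModule : ∀ {I J : Chart n} (h : I ≤ J),
    IsLocalizedModule (Submonoid.powers (chartFn k J)) (res h)
  /-- the sections over `D(x_I)` are finitely generated over `S[1/x_I]` -/
  finite : ∀ I : Chart n, ∃ t : Finset (sec I).carrier, ∀ s : (sec I).carrier, ∃ r : ℕ,
    chartFn k I ^ r • s ∈ Submodule.span (Cox k n) (t : Set (sec I).carrier)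

section Cech

variable {k : Type u} [Field k] {n : ℕ} {w : Fin (n + 1) → ℕ} (F : CoherentSheaf k w)

/-- All Čech cochains of the cover `D(x_0), …, D(x_n)`, of all cohomological and internal degrees:
the component at `I` lives on the intersection `D(x_I)` of the `D(x_i)`, `i ∈ I`. -/
abbrev CoherentSheaf.Cochain : Type u := ∀ I : Chart n, (F.sec I).carrier

/-- The position of `i` in `I`, i.e. the number of elements of `I` below `i`. -/
def position {n : ℕ} (I : Chart n) (i : Fin (n + 1)) : ℕ := (I.1.filter (· < i)).card

/-- The Čech differential `(d c)_I = ∑_{i ∈ I} ± c_{I ∖ i}|_{D(x_I)}`, the sign being `(-1)` to the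
position of `i` in `I`. -/
def CoherentSheaf.cechD : F.Cochain →ₗ[k] F.Cochain :=
  LinearMap.pi fun I => ∑ i ∈ I.1,
    if h : (I.1.erase i).Nonempty then
      ((-1 : k) ^ position I i) •
        ((F.res (I := ⟨I.1.erase i, h⟩) (J := I) (Finset.erase_subset i I.1)).restrictScalars k ∘ₗ
          LinearMap.proj (R := k) (φ := fun I => (F.sec I).carrier) ⟨I.1.erase i, h⟩)
    else 0

/-- The Čech `p`-cochains of internal degree `a` (these are the `G`-invariant Čech cochains of the
twist `F(a)`). -/
def CoherentSheaf.cochains (a p : ℤ) : Submodule k F.Cochain where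
  carrier := {c | ∀ I, c I ∈ (F.sec I).grading a ∧ ((I.1.card : ℤ) ≠ p + 1 → c I = 0)}
  add_mem' {c c'} hc hc' I :=
    ⟨add_mem (hc I).1 (hc' I).1, fun h => by simp [(hc I).2 h, (hc' I).2 h]⟩
  zero_mem' I := ⟨zero_mem _, fun _ => rfl⟩
  smul_mem' r c hc I := ⟨Submodule.smul_mem _ r (hc I).1, fun h => by simp [(hc I).2 h]⟩

/-- The Čech `p`-cocycles of the twist `F(a)`. -/
def CoherentSheaf.cocycles (a p : ℤ) : Submodule k F.Cochain :=
  F.cochains a p ⊓ LinearMap.ker F.cechD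

/-- The Čech `p`-coboundaries of the twist `F(a)`. -/
def CoherentSheaf.coboundaries (a p : ℤ) : Submodule k F.Cochain :=
  (F.cochains a (p - 1)).map F.cechD

/-- The sheaf cohomology `H^p(F(a))` of the twist `F(a)`, for `p : ℤ` (zero for `p < 0`). -/
abbrev CoherentSheaf.H (a p : ℤ) : Type u :=
  F.cocycles a p ⧸ (F.coboundaries a p).submoduleOf (F.cocycles a p)

/-- An identification `M^~ = F` of the sheaf associated to a graded module `M` with `F`: compatible
degree preserving maps `M → Γ(D(x_I), F)` exhibiting `Γ(D(x_I), F)` as `M[1/x_I]`. -/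
structure SheafIso (M : GrMod k w) (F : CoherentSheaf k w) where
  toSec : ∀ I : Chart n, M.carrier →ₗ[Cox k n] (F.sec I).carrier
  toSec_mem : ∀ (I : Chart n) (a : ℤ) (m : M.carrier),
    m ∈ M.grading a → toSec I m ∈ (F.sec I).grading a
  res_toSec : ∀ {I J : Chart n} (h : I ≤ J) (m : M.carrier), F.res h (toSec I m) = toSec J m
  isLocalizedModule : ∀ I : Chart n,
    IsLocalizedModule (Submonoid.powers (chartFn k I)) (toSec I)

variable {F} {M : GrMod k w}

/-- The `0`-cochain `(m|_{D(x_i)})_i` of an element `m` of `M`. -/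
def SheafIso.cochain (s : SheafIso M F) (m : M.carrier) : F.Cochain :=
  fun I => if I.1.card = 1 then s.toSec I m else 0

theorem SheafIso.cochain_mem (s : SheafIso M F) {a : ℤ} {m : M.carrier} (hm : m ∈ M.grading a) :
    s.cochain m ∈ F.cocycles a 0 := by
  refine ⟨fun I => ⟨?_, ?_⟩, ?_⟩
  · unfold SheafIso.cochain
    split_ifs
    · exact s.toSec_mem I a m hm
    · exact zero_mem _
  · intro h
    have : I.1.card ≠ 1 := by intro h'; apply h; simp [h']
    simp [SheafIso.cochain, this]
  · refine LinearMap.mem_ker.2 ?_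
    funext I
    simp only [CoherentSheaf.cechD, LinearMap.pi_apply, Pi.zero_apply]
    by_cases hc : I.1.card = 2
    · obtain ⟨i, j, hij, hI⟩ := Finset.card_eq_two.1 hc
      wlog hlt : i < j generalizing i j
      · exact this j i hij.symm (by rw [hI, Finset.pair_comm])
          (lt_of_le_of_ne (not_lt.1 hlt) hij.symm)
      obtain ⟨I, hne⟩ := I
      simp only at hI
      subst hI
      have e1 : ({i, j} : Finset (Fin (n + 1))).erase i = {j} := by
        rw [Finset.erase_insert]; simpa using hij
      have e2 : ({i, j} : Finset (Fin (n + 1))).erase j = {i} := by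
        rw [Finset.pair_comm, Finset.erase_insert]; simpa using hij.symm
      have p1 : position ⟨{i, j}, hne⟩ i = 0 := by
        simp [position, Finset.filter_insert, Finset.filter_singleton, not_lt.2 hlt.le]
      have p2 : position ⟨{i, j}, hne⟩ j = 1 := by
        simp [position, Finset.filter_insert, Finset.filter_singleton, hlt]
      rw [Finset.sum_pair hij, LinearMap.add_apply]
      rw [dif_pos (by rw [e1]; simp), dif_pos (by rw [e2]; simp)]
      simp [p1, p2, SheafIso.cochain, e1, e2, s.res_toSec]
    · rw [LinearMap.sum_apply]
      refine Finset.sum_eq_zero fun i hi => ?_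
      split_ifs with h
      · have : (I.1.erase i).card ≠ 1 := by
          rw [Finset.card_erase_of_mem hi]
          intro h'
          have := Finset.card_pos.2 I.2
          omega
        simp [SheafIso.cochain, this]
      · rfl

/-- The canonical map `M_a → H^0(F(a))`. -/
def SheafIso.toH0 (s : SheafIso M F) (a : ℤ) (m : M.grading a) : F.H a 0 :=
  Submodule.Quotient.mk ⟨s.cochain m, s.cochain_mem m.2⟩

end Cech

/-! ## The exterior algebra and differential modules -/

/-- The exterior algebra `E = Λ_k(e_0, …, e_n)`. -/
abbrev Ext (k : Type u) [Field k] (n : ℕ) : Type u := ExteriorAlgebra k (Fin (n + 1) → k)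

/-- The generator `e_i` of `E`. -/
def extGen (k : Type u) [Field k] {n : ℕ} (i : Fin (n + 1)) : Ext k n :=
  ExteriorAlgebra.ι k (Pi.single i 1)

/-- The basis of `E` given by the monomials `e_J = e_{j_1} ⋯ e_{j_r}`, `J = {j_1 < … < j_r}`. -/
def extBasis (k : Type u) [Field k] (n : ℕ) : Module.Basis (Finset (Fin (n + 1))) k (Ext k n) :=
  (Pi.basisFun k (Fin (n + 1))).ExteriorAlgebra

/-- The degree of `e_J` if `deg e_i = (-w_i; -1)`. -/
def monDeg {n : ℕ} (w : Fin (n + 1) → ℕ) (J : Finset (Fin (n + 1))) : ℤ × ℤ :=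
  (-∑ i ∈ J, (w i : ℤ), -(J.card : ℤ))

/-- The `ℤ ⊕ ℤ`-grading of `E` with `deg e_i = (-w_i; -1)`. -/
def extGrading (k : Type u) [Field k] {n : ℕ} (w : Fin (n + 1) → ℕ) (d : ℤ × ℤ) :
    Submodule k (Ext k n) :=
  Submodule.span k {x | ∃ J, monDeg w J = d ∧ x = extBasis k n J}

/-- A differential `E`-module: a `ℤ ⊕ ℤ`-graded right `E`-module (right modules are modules over the
opposite algebra) with an `E`-linear endomorphism of degree `(0; -1)` and square zero. -/
structure DiffMod (k : Type u) [Field k] {n : ℕ} (w : Fin (n + 1) → ℕ) where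
  carrier : Type u
  [addCommGroup : AddCommGroup carrier]
  [moduleBase : Module k carrier]
  [module : Module (Ext k n)ᵐᵒᵖ carrier]
  [isScalarTower : IsScalarTower k (Ext k n)ᵐᵒᵖ carrier]
  grading : ℤ × ℤ → Submodule k carrier
  isInternal : DirectSum.IsInternal grading
  smul_mem : ∀ (d d' : ℤ × ℤ) (x : Ext k n) (t : carrier), x ∈ extGrading k w d' →
    t ∈ grading d → MulOpposite.op x • t ∈ grading (d + d')
  diff : carrier →ₗ[(Ext k n)ᵐᵒᵖ] carrier
  diff_mem : ∀ (a j : ℤ) (t : carrier), t ∈ grading (a, j) → diff t ∈ grading (a, j - 1)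
  diff_diff : ∀ t, diff (diff t) = 0

attribute [instance] DiffMod.addCommGroup DiffMod.moduleBase DiffMod.module DiffMod.isScalarTower

namespace DiffMod

variable {k : Type u} [Field k] {n : ℕ} {w : Fin (n + 1) → ℕ}

/-- Morphisms of differential modules: degree `0` maps of `E`-modules commuting with the
differentials. -/
structure Hom (D D' : DiffMod k w) where
  toFun : D.carrier →ₗ[(Ext k n)ᵐᵒᵖ] D'.carrier
  map_mem : ∀ (d : ℤ × ℤ) (t : D.carrier), t ∈ D.grading d → toFun t ∈ D'.grading d
  map_diff : ∀ t, toFun (D.diff t) = D'.diff (toFun t)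

/-- Isomorphism of differential modules. -/
def IsIsomorphic (D D' : DiffMod k w) : Prop :=
  ∃ (f : Hom D D') (g : Hom D' D),
    (∀ t, g.toFun (f.toFun t) = t) ∧ ∀ t, f.toFun (g.toFun t) = t

/-- The homology `ker ∂ / im ∂`. -/
abbrev homology (D : DiffMod k w) : Type u :=
  LinearMap.ker D.diff ⧸ (LinearMap.range D.diff).submoduleOf (LinearMap.ker D.diff)

/-- The map induced on homology. -/
def Hom.onHomology {D D' : DiffMod k w} (f : Hom D D') :
    D.homology →ₗ[(Ext k n)ᵐᵒᵖ] D'.homology :=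
  Submodule.mapQ _ _
    (f.toFun.restrict (p := LinearMap.ker D.diff) (q := LinearMap.ker D'.diff) (fun t ht => by
      rw [LinearMap.mem_ker] at ht ⊢
      rw [← f.map_diff, ht, map_zero]))
    (by
      rintro ⟨t, ht⟩ ⟨s, hs⟩
      exact ⟨f.toFun s, by rw [← f.map_diff, hs]; rfl⟩)

def Hom.IsQuasiIso {D D' : DiffMod k w} (f : Hom D D') : Prop :=
  Function.Bijective f.onHomology

/-- The submodule `D · ⟨e_i : i ∈ J⟩` of `D`. -/
def mulVars (D : DiffMod k w) (J : Finset (Fin (n + 1))) : Submodule (Ext k n)ᵐᵒᵖ D.carrier :=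
  Submodule.span _ {t | ∃ i ∈ J, ∃ s : D.carrier, t = MulOpposite.op (extGen k i) • s}

theorem diff_mulVars (D : DiffMod k w) (J : Finset (Fin (n + 1))) :
    D.mulVars J ≤ (D.mulVars J).comap D.diff := by
  refine Submodule.span_le.2 ?_
  rintro _ ⟨i, hi, s, rfl⟩
  exact Submodule.subset_span ⟨i, hi, D.diff s, by rw [map_smul]⟩

/-- `D ⊗_E E_I` is exact, where `E_I = E / ⟨e_i : i ∉ I⟩`; here `D ⊗_E E_I` is the quotient
`D / D · ⟨e_i : i ∉ I⟩` with the induced differential, and a differential module is exact if its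
homology vanishes. -/
def ExactOn (D : DiffMod k w) (I : Finset (Fin (n + 1))) : Prop :=
  Function.Exact (Submodule.mapQ _ _ D.diff (D.diff_mulVars Iᶜ))
    (Submodule.mapQ _ _ D.diff (D.diff_mulVars Iᶜ))

/-- `∂(D) ⊆ D · 𝔪` with `𝔪 = ⟨e_0, …, e_n⟩`. -/
def IsMinimal (D : DiffMod k w) : Prop := LinearMap.range D.diff ≤ D.mulVars Finset.univ

/-- Free as a graded `E`-module: there is a basis consisting of homogeneous elements. -/
def IsFree (D : DiffMod k w) : Prop :=
  ∃ (ι : Type u) (b : Module.Basis ι (Ext k n)ᵐᵒᵖ D.carrier), ∀ i, ∃ d, b i ∈ D.grading d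

/-- Free flags: `D = ⨁_{l ≥ 0} D_l` with graded free `D_l` and `∂(D_l) ⊆ ⨁_{l' < l} D_{l'}`. Here
`D_l` is the span of the members of level `l` of a homogeneous basis. -/
def IsFreeFlag (D : DiffMod k w) : Prop :=
  ∃ (ι : Type u) (b : Module.Basis ι (Ext k n)ᵐᵒᵖ D.carrier) (level : ι → ℕ),
    (∀ i, ∃ d, b i ∈ D.grading d) ∧
    ∀ i, D.diff (b i) ∈ Submodule.span (Ext k n)ᵐᵒᵖ (b '' {i' | level i' < level i})

/-- `ε : G → D` is a free resolution: a quasi-isomorphism that factors as `G → P → D` with `G → P` a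
split injection of differential modules, `P` a free flag and `P → D` a quasi-isomorphism. -/
def Hom.IsFreeResolution {G D : DiffMod k w} (ε : Hom G D) : Prop :=
  ε.IsQuasiIso ∧ ∃ (P : DiffMod k w) (s : Hom G P) (r : Hom P G) (p : Hom P D),
    P.IsFreeFlag ∧ p.IsQuasiIso ∧ (∀ t, r.toFun (s.toFun t) = t) ∧
    ∀ t, p.toFun (s.toFun t) = ε.toFun t

/-- A minimal free resolution. -/
def Hom.IsMinimalFreeResolution {G D : DiffMod k w} (ε : Hom G D) : Prop :=
  ε.IsFreeResolution ∧ G.IsMinimal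

/-- The degree `d` part of `Hom_E(k, D)`: a homomorphism `k → D` of degree `d` is the choice of an
element of degree `d` (the image of `1`) that is killed by all `e_i`. -/
def socle (D : DiffMod k w) (d : ℤ × ℤ) : Submodule k D.carrier where
  carrier := {t | t ∈ D.grading d ∧ ∀ i, MulOpposite.op (extGen k i) • t = 0}
  add_mem' hs ht := ⟨add_mem hs.1 ht.1, fun i => by rw [smul_add, hs.2, ht.2, add_zero]⟩
  zero_mem' := ⟨zero_mem _, fun i => smul_zero (MulOpposite.op (extGen k i : Ext k n))⟩
  smul_mem' c t ht := ⟨Submodule.smul_mem _ c ht.1, fun i => by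
    rw [← algebraMap_smul (Ext k n)ᵐᵒᵖ c t, ← mul_smul, ← Algebra.commutes, mul_smul, ht.2,
      smul_zero]⟩

/-! ### Mapping cones -/

/-- The grading of `D' ⊕ D(0; -1)`. -/
def coneGrading (D D' : DiffMod k w) (d : ℤ × ℤ) : Submodule k (D'.carrier × D.carrier) :=
  (D'.grading d).prod (D.grading (d.1, d.2 - 1))

theorem coneGrading_isInternal (D D' : DiffMod k w) :
    DirectSum.IsInternal (coneGrading D D') := by
  obtain ⟨δ, hδ⟩ := exists_coaction D.isInternal
  obtain ⟨δ', hδ'⟩ := exists_coaction D'.isInternal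
  have inl_mem : ∀ d, ∀ x ∈ D'.grading d, ((x, 0) : D'.carrier × D.carrier) ∈
      coneGrading D D' d := fun d x hx => ⟨hx, zero_mem _⟩
  have inr_mem : ∀ d, ∀ y ∈ D.grading d, ((0, y) : D'.carrier × D.carrier) ∈
      coneGrading D D' (d.1, d.2 + 1) := fun d y hy => ⟨zero_mem _, by simpa using hy⟩
  refine isInternal_of_coaction
    ((Finsupp.mapRange.linearMap (LinearMap.inl k D'.carrier D.carrier) ∘ₗ δ').coprod
      (Finsupp.lmapDomain _ k (fun d : ℤ × ℤ => (d.1, d.2 + 1)) ∘ₗ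
        Finsupp.mapRange.linearMap (LinearMap.inr k D'.carrier D.carrier) ∘ₗ δ)) ?_ ?_
  · rintro d ⟨x, y⟩ ⟨hx, hy⟩
    simp only at hx hy
    simp [hδ' _ _ hx, hδ _ _ hy, Finsupp.mapDomain_single, ← Finsupp.single_add]
  · rw [eq_top_iff]
    rintro ⟨x, y⟩ -
    have hx : x ∈ (⨆ d, D'.grading d) := by
      rw [D'.isInternal.submodule_iSup_eq_top]; trivial
    have hy : y ∈ (⨆ d, D.grading d) := by
      rw [D.isInternal.submodule_iSup_eq_top]; trivial
    have h1 : (⨆ d, D'.grading d) ≤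
        (iSup (coneGrading D D')).comap (LinearMap.inl k D'.carrier D.carrier) :=
      iSup_le fun d x hx => Submodule.mem_iSup_of_mem d (inl_mem d x hx)
    have h2 : (⨆ d, D.grading d) ≤
        (iSup (coneGrading D D')).comap (LinearMap.inr k D'.carrier D.carrier) :=
      iSup_le fun d y hy => Submodule.mem_iSup_of_mem (d.1, d.2 + 1) (inr_mem d y hy)
    have h3 : ((x, 0) : D'.carrier × D.carrier) + (0, y) ∈ iSup (coneGrading D D') :=
      add_mem (h1 hx) (h2 hy)
    simpa using h3

/-- The mapping cone of `f : D → D'`: the module `D' ⊕ D(0; -1)` with the differential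
`(x, y) ↦ (∂' x + f y, -∂ y)`. -/
def cone {D D' : DiffMod k w} (f : Hom D D') : DiffMod k w where
  carrier := D'.carrier × D.carrier
  grading := coneGrading D D'
  isInternal := coneGrading_isInternal D D'
  smul_mem d d' x t hx ht := by
    refine ⟨D'.smul_mem d d' x _ hx ht.1, ?_⟩
    have := D.smul_mem _ d' x _ hx ht.2
    have e : ((d.1, d.2 - 1) + d' : ℤ × ℤ) = ((d + d').1, (d + d').2 - 1) := by
      ext
      · rfl
      · simp only [Prod.snd_add]; ring
    rwa [e] at this
  diff := (D'.diff ∘ₗ LinearMap.fst _ _ _ + f.toFun ∘ₗ LinearMap.snd _ _ _).prod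
    (-(D.diff ∘ₗ LinearMap.snd _ _ _))
  diff_mem a j t ht := by
    refine ⟨add_mem (D'.diff_mem a j _ ht.1) (f.map_mem _ _ ht.2), ?_⟩
    exact neg_mem (D.diff_mem a (j - 1) _ ht.2)
  diff_diff t := by
    ext
    · simp [D'.diff_diff, f.map_diff]
    · simp [D.diff_diff]

end DiffMod

/-! ## The functor `R` on graded modules -/

section RR

variable {k : Type u} [Field k] {n : ℕ} {w : Fin (n + 1) → ℕ}

/-- `ω_E = Hom_k(E, k)`. -/
def Omega (k : Type u) [Field k] (n : ℕ) : Type u := Module.Dual k (Ext k n)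

instance : AddCommGroup (Omega k n) := inferInstanceAs (AddCommGroup (Module.Dual k (Ext k n)))
instance : Module k (Omega k n) := inferInstanceAs (Module k (Module.Dual k (Ext k n)))

/-- The value of an element of `ω_E` as a functional. -/
def Omega.toDual : Omega k n ≃ₗ[k] Module.Dual k (Ext k n) := LinearEquiv.refl k _

/-- Right multiplication by `x` on `ω_E`: `(f x)(y) = f (x y)`. -/
def Omega.mulRight (x : Ext k n) : Omega k n →ₗ[k] Omega k n :=
  (LinearMap.mulLeft k x).dualMap

/-- Left multiplication by `e_i` on `ω_E`.  A right module is a left module through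
`e f = (-1)^(aux e * aux f) f e`, where `aux` is the auxiliary degree; on `ω_E` and for `e = e_i`
this is `(e_i f)(y) = - f (y e_i)`, as `Omega.genMul_eq` checks. -/
def Omega.genMul (i : Fin (n + 1)) : Omega k n →ₗ[k] Omega k n :=
  -(LinearMap.mulRight k (extGen k i)).dualMap

/-- `ω_E` lives in degree `d` on the functionals that vanish on `E_{d'}` for `d' ≠ -d`. -/
def omegaGrading (k : Type u) [Field k] {n : ℕ} (w : Fin (n + 1) → ℕ) (d : ℤ × ℤ) :
    Submodule k (Omega k n) where
  carrier := {f | ∀ d', d' ≠ -d → ∀ x ∈ extGrading k w d', f.toDual x = 0}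
  add_mem' hf hg d' h x hx := by simp [hf d' h x hx, hg d' h x hx]
  zero_mem' d' h x hx := by simp
  smul_mem' c f hf d' h x hx := by simp [hf d' h x hx]

/-- The functional `E → k` that is `1` at `1` and `0` on `𝔪`; it spans the socle of `ω_E`. -/
def omegaOne (k : Type u) [Field k] (n : ℕ) : Omega k n :=
  Omega.toDual.symm (ExteriorAlgebra.algebraMapInv (M := Fin (n + 1) → k)).toLinearMap


theorem extBasis_singleton (i : Fin (n + 1)) : extBasis k n {i} = extGen k i := by
  rw [extBasis, ExteriorAlgebra.basis_apply_ofCard (n := 1) _ (Finset.card_singleton i)]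
  have h0 : (Set.powersetCard.ofFinEmbEquiv.symm
      (Set.powersetCard.ofCard (Finset.card_singleton i))) 0 = i := by
    have := (Set.powersetCard.mem_range_ofFinEmbEquiv_symm_iff_mem (n := 1)
      (Set.powersetCard.ofCard (Finset.card_singleton i)) _).1 ⟨0, rfl⟩
    exact Finset.mem_singleton.1 this
  simp [ExteriorAlgebra.ιMulti_family, ExteriorAlgebra.ιMulti_apply, extGen, h0]

theorem extGen_mem (w : Fin (n + 1) → ℕ) (i : Fin (n + 1)) :
    extGen k i ∈ extGrading k w (-(w i : ℤ), -1) :=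
  Submodule.subset_span ⟨{i}, by simp [monDeg], (extBasis_singleton i).symm⟩

theorem extGrading_mul {d d' : ℤ × ℤ} {x y : Ext k n} (hx : x ∈ extGrading k w d)
    (hy : y ∈ extGrading k w d') : x * y ∈ extGrading k w (d + d') := by
  refine (Submodule.mul_le (P := extGrading k w (d + d'))).1 ?_ x hx y hy
  rw [extGrading, extGrading, Submodule.span_mul_span, Submodule.span_le]
  rintro _ ⟨_, ⟨I, rfl, rfl⟩, _, ⟨J, rfl, rfl⟩, rfl⟩
  simp only [SetLike.mem_coe, extBasis]
  have hI := ExteriorAlgebra.basis_mul_of_disjoint (Pi.basisFun k (Fin (n + 1)))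
    (Set.powersetCard.ofCard (rfl : I.card = I.card))
    (Set.powersetCard.ofCard (rfl : J.card = J.card))
  have hI' := ExteriorAlgebra.basis_mul_of_not_disjoint (Pi.basisFun k (Fin (n + 1)))
    (Set.powersetCard.ofCard (rfl : I.card = I.card))
    (Set.powersetCard.ofCard (rfl : J.card = J.card))
  by_cases hd : Disjoint I J
  · have h : extBasis k n I * extBasis k n J = _ := hI hd
    rw [extBasis] at h
    rw [h]
    have hu : ((Set.powersetCard.disjUnion (s := Set.powersetCard.ofCard (rfl : I.card = I.card))
        (t := Set.powersetCard.ofCard (rfl : J.card = J.card)) hd : Set.powersetCard _ _) :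
          Finset (Fin (n + 1))) = I ∪ J := by
      exact Finset.disjUnion_eq_union I J hd
    rw [hu]
    have hmem : (Pi.basisFun k (Fin (n + 1))).ExteriorAlgebra (I ∪ J)
        ∈ extGrading k w (monDeg w I + monDeg w J) := by
      refine Submodule.subset_span ⟨I ∪ J, ?_, rfl⟩
      simp only [monDeg, Finset.sum_union hd, Finset.card_union_of_disjoint hd]
      ext
      · simp only [Prod.fst_add]; ring
      · simp only [Prod.snd_add]; push_cast; ring
    rcases Int.units_eq_one_or (Equiv.Perm.sign (Set.powersetCard.permOfDisjoint
      (s := Set.powersetCard.ofCard (rfl : I.card = I.card))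
        (t := Set.powersetCard.ofCard (rfl : J.card = J.card)) hd)) with h1 | h1
    · rw [h1, one_smul]; exact hmem
    · rw [h1, Units.neg_smul, one_smul]; exact neg_mem hmem
  · have h : extBasis k n I * extBasis k n J = _ := hI' hd
    rw [extBasis] at h
    rw [h]
    exact zero_mem _

theorem extBasis_mul_extGen (J : Finset (Fin (n + 1))) (i : Fin (n + 1)) :
    extBasis k n J * extGen k i = (-1 : k) ^ J.card • (extGen k i * extBasis k n J) := by
  have key : ∀ l : List (Fin (n + 1) → k),
      (l.map (ExteriorAlgebra.ι k)).prod * extGen k i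
        = (-1 : k) ^ l.length • (extGen k i * (l.map (ExteriorAlgebra.ι k)).prod) := by
    intro l
    induction l with
    | nil => simp
    | cons v l ih =>
      have hv : ExteriorAlgebra.ι k v * extGen k i = -(extGen k i * ExteriorAlgebra.ι k v) :=
        eq_neg_of_add_eq_zero_left (ExteriorAlgebra.ι_add_mul_swap v (Pi.single i 1))
      rw [List.map_cons, List.prod_cons, mul_assoc, ih, mul_smul_comm, ← mul_assoc, hv,
        List.length_cons, pow_succ, mul_neg_one, neg_smul, neg_mul, smul_neg, mul_assoc]
  rw [extBasis, ExteriorAlgebra.basis_apply]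
  have := key (List.ofFn fun j => (Pi.basisFun k (Fin (n + 1)))
    (Set.powersetCard.ofFinEmbEquiv.symm (Set.powersetCard.prodEquiv.symm J).2 j))
  rw [List.map_ofFn, List.length_ofFn] at this
  exact this

/-- On `ω_E` in auxiliary degree `j`, left multiplication by `e_i` is `f ↦ (-1)^j f e_i`. -/
theorem Omega.genMul_eq (i : Fin (n + 1)) (a j : ℤ) (f : Omega k n)
    (hf : f ∈ omegaGrading k w (a, j)) :
    Omega.genMul i f = j.negOnePow • Omega.mulRight (extGen k i) f := by
  refine (extBasis k n).ext fun J => ?_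
  have h1 : Omega.toDual (Omega.genMul i f) (extBasis k n J)
      = -((-1 : k) ^ J.card * f.toDual (extGen k i * extBasis k n J)) := by
    change -(f.toDual (extBasis k n J * extGen k i)) = _
    rw [extBasis_mul_extGen, map_smul, smul_eq_mul]
  have h2 : Omega.toDual (j.negOnePow • Omega.mulRight (extGen k i) f) (extBasis k n J)
      = j.negOnePow • f.toDual (extGen k i * extBasis k n J) := rfl
  refine h1.trans (Eq.trans ?_ h2.symm)
  by_cases hJ : j = J.card + 1
  · subst hJ
    rw [Int.negOnePow_succ, Units.neg_smul]
    congr 1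
    rw [Units.smul_def, Int.coe_negOnePow_natCast, zsmul_eq_mul]
    simp
  · have : f.toDual (extGen k i * extBasis k n J) = 0 := by
      refine hf _ ?_ _ (extGrading_mul (extGen_mem w i)
        (Submodule.subset_span ⟨J, rfl, rfl⟩ : extBasis k n J ∈ extGrading k w (monDeg w J)))
      intro h
      have := congrArg Prod.snd h
      simp [monDeg] at this
      omega
    rw [this, mul_zero, neg_zero, smul_zero]

theorem omegaGrading_isInternal (w : Fin (n + 1) → ℕ) :
    DirectSum.IsInternal (omegaGrading k w) := by
  let dual : Finset (Fin (n + 1)) → Omega k n := fun J => Omega.toDual.symm ((extBasis k n).coord J)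
  have hdual : ∀ J, dual J ∈ omegaGrading k w (-monDeg w J) := by
    intro J d hd x hx
    refine Submodule.span_induction ?_ ?_ ?_ ?_ hx
    · rintro _ ⟨I, rfl, rfl⟩
      have : I ≠ J := by rintro rfl; simp at hd
      simp [dual, this]
    · simp
    · intro x y _ _ h1 h2
      rw [map_add, h1, h2, add_zero]
    · intro c x _ h
      rw [map_smul, h, smul_zero]
  have hsum : ∀ f : Omega k n, f = ∑ J, f.toDual (extBasis k n J) • dual J := by
    intro f
    apply Omega.toDual.injective
    rw [map_sum]
    refine (extBasis k n).ext fun I => ?_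
    simp [dual]
  refine isInternal_of_coaction
    (∑ J, (Finsupp.lsingle (-monDeg w J) ∘ₗ LinearMap.toSpanSingleton k (Omega k n) (dual J)) ∘ₗ
      (LinearMap.applyₗ (extBasis k n J) : Module.Dual k (Ext k n) →ₗ[k] k) ∘ₗ
        Omega.toDual.toLinearMap) ?_ ?_
  · intro d f hf
    conv_rhs => rw [hsum f]
    rw [Finsupp.single_finsetSum, LinearMap.sum_apply]
    refine Finset.sum_congr rfl fun J _ => ?_
    simp only [LinearMap.comp_apply, LinearEquiv.coe_coe, LinearMap.applyₗ_apply_apply,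
      LinearMap.toSpanSingleton_apply, Finsupp.lsingle_apply]
    by_cases hJ : monDeg w J = -d
    · rw [hJ, neg_neg]
    · rw [hf _ hJ _ (Submodule.subset_span ⟨J, rfl, rfl⟩)]
      simp
  · rw [eq_top_iff]
    intro f _
    rw [hsum f]
    exact Submodule.sum_mem _ fun J _ => Submodule.smul_mem _ _
      (Submodule.mem_iSup_of_mem _ (hdual J))

theorem mulRight_mem {d d' : ℤ × ℤ} {x : Ext k n} {f : Omega k n} (hx : x ∈ extGrading k w d')
    (hf : f ∈ omegaGrading k w d) : Omega.mulRight x f ∈ omegaGrading k w (d + d') := by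
  intro e he y hy
  refine hf (d' + e) ?_ (x * y) (extGrading_mul hx hy)
  intro h
  apply he
  rw [neg_add, ← h]
  abel

theorem genMul_mem {d : ℤ × ℤ} {f : Omega k n} (i : Fin (n + 1))
    (hf : f ∈ omegaGrading k w d) :
    Omega.genMul i f ∈ omegaGrading k w (d + (-(w i : ℤ), -1)) := by
  intro e he y hy
  have := hf (e + (-(w i : ℤ), -1)) ?_ (y * extGen k i) (extGrading_mul hy (extGen_mem w i))
  · change -(f.toDual (y * extGen k i)) = 0
    rw [this, neg_zero]
  · intro h
    apply he
    rw [neg_add, ← h]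
    abel

theorem genMul_mulRight (x : Ext k n) (i : Fin (n + 1)) (f : Omega k n) :
    Omega.genMul i (Omega.mulRight x f) = Omega.mulRight x (Omega.genMul i f) := by
  refine LinearMap.ext fun y => ?_
  change -(f.toDual (x * (y * extGen k i))) = -(f.toDual (x * y * extGen k i))
  rw [mul_assoc]

theorem genMul_genMul (i j : Fin (n + 1)) (f : Omega k n) :
    Omega.genMul i (Omega.genMul j f) = -Omega.genMul j (Omega.genMul i f) := by
  refine LinearMap.ext fun y => ?_
  change - -(f.toDual (y * extGen k i * extGen k j)) = - - -(f.toDual (y * extGen k j * extGen k i))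
  have h : extGen k i * extGen k j = -(extGen k j * extGen k i) :=
    eq_neg_of_add_eq_zero_left (ExteriorAlgebra.ι_add_mul_swap _ _)
  rw [mul_assoc, h, mul_neg, map_neg, mul_assoc]

theorem genMul_self (i : Fin (n + 1)) (f : Omega k n) :
    Omega.genMul i (Omega.genMul i f) = 0 := by
  refine LinearMap.ext fun y => ?_
  change - -(f.toDual (y * extGen k i * extGen k i)) = 0
  have h : extGen k i * extGen k i = 0 := ExteriorAlgebra.ι_sq_zero _
  rw [mul_assoc, h, mul_zero, map_zero, neg_zero, neg_zero]

variable (M : GrMod k w)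

/-- The underlying module of `R(M)`: `⨁_a M_a ⊗_k ω_E(-a; 0) = M ⊗_k ω_E`. -/
def RRCarrier (M : GrMod k w) : Type u := M.carrier ⊗[k] Omega k n

instance : AddCommGroup (RRCarrier M) :=
  inferInstanceAs (AddCommGroup (M.carrier ⊗[k] Omega k n))

instance : Module k (RRCarrier M) := inferInstanceAs (Module k (M.carrier ⊗[k] Omega k n))

/-- The right action of `E` on `M ⊗_k ω_E` through the second factor. -/
def rrAct : (Ext k n)ᵐᵒᵖ →+* Module.End k (RRCarrier M) where
  toFun x := (Omega.mulRight x.unop).lTensor M.carrier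
  map_one' := by
    refine TensorProduct.ext' fun m f => ?_
    change m ⊗ₜ[k] Omega.mulRight (1 : Ext k n) f = m ⊗ₜ[k] f
    congr 1
    refine LinearMap.ext fun y => ?_
    change f.toDual (1 * y) = f.toDual y
    rw [one_mul]
  map_mul' x y := by
    refine TensorProduct.ext' fun m f => ?_
    change m ⊗ₜ[k] Omega.mulRight (y.unop * x.unop) f
      = m ⊗ₜ[k] Omega.mulRight x.unop (Omega.mulRight y.unop f)
    congr 1
    refine LinearMap.ext fun z => ?_
    change f.toDual (y.unop * x.unop * z) = f.toDual (y.unop * (x.unop * z))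
    rw [mul_assoc]
  map_zero' := by
    refine TensorProduct.ext' fun m f => ?_
    change m ⊗ₜ[k] Omega.mulRight (0 : Ext k n) f = 0
    have : Omega.mulRight (0 : Ext k n) f = 0 := by
      refine LinearMap.ext fun z => ?_
      change f.toDual (0 * z) = 0
      rw [zero_mul, map_zero]
    rw [this, TensorProduct.tmul_zero]
  map_add' x y := by
    refine TensorProduct.ext' fun m f => ?_
    change m ⊗ₜ[k] Omega.mulRight (x.unop + y.unop) f
      = m ⊗ₜ[k] Omega.mulRight x.unop f + m ⊗ₜ[k] Omega.mulRight y.unop f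
    rw [← TensorProduct.tmul_add]
    congr 1
    refine LinearMap.ext fun z => ?_
    change f.toDual ((x.unop + y.unop) * z) = f.toDual (x.unop * z) + f.toDual (y.unop * z)
    rw [add_mul, map_add]

instance : Module (Ext k n)ᵐᵒᵖ (RRCarrier M) := Module.compHom (RRCarrier M) (rrAct M)

/-- The element `m ⊗ f` of `R(M)`. -/
def rrTmul {M : GrMod k w} (m : M.carrier) (f : Omega k n) : RRCarrier M := m ⊗ₜ[k] f

theorem op_smul_rrTmul {M : GrMod k w} (x : (Ext k n)ᵐᵒᵖ) (m : M.carrier) (f : Omega k n) :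
    x • rrTmul m f = rrTmul m (Omega.mulRight x.unop f) := rfl

theorem rrTmul_neg {M : GrMod k w} (m : M.carrier) (f : Omega k n) :
    rrTmul m (-f) = -rrTmul m f := TensorProduct.tmul_neg _ _

theorem rr_induction {M : GrMod k w} {P : RRCarrier M → Prop} (t : RRCarrier M) (h0 : P 0)
    (h1 : ∀ m f, P (rrTmul m f)) (h2 : ∀ s t, P s → P t → P (s + t)) : P t :=
  TensorProduct.induction_on t h0 h1 h2

theorem smul_rrTmul {M : GrMod k w} (c : k) (m : M.carrier) (f : Omega k n) :
    c • rrTmul m f = rrTmul m (c • f) := (TensorProduct.tmul_smul c m f).symm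

instance : IsScalarTower k (Ext k n)ᵐᵒᵖ (RRCarrier M) where
  smul_assoc c x t := by
    refine rr_induction (P := fun t => (c • x) • t = c • x • t) t ?_ ?_ ?_
    · simp
    · intro m f
      rw [op_smul_rrTmul, op_smul_rrTmul, smul_rrTmul]
      congr 1
      refine LinearMap.ext fun z => ?_
      change f.toDual ((c • x.unop) * z) = c • f.toDual (x.unop * z)
      rw [smul_mul_assoc, map_smul]
    · intro s t hs ht
      rw [smul_add, smul_add, smul_add, hs, ht]

/-- The summand `M_b ⊗_k ω_E(-b; 0)` has `M_b ⊗_k (ω_E)_{(a - b; j)}` in degree `(a; j)`. -/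
def rrGrading (d : ℤ × ℤ) : Submodule k (RRCarrier M) :=
  Submodule.span k {t | ∃ (b : ℤ) (m : M.carrier) (f : Omega k n), m ∈ M.grading b ∧
    f ∈ omegaGrading k w (d.1 - b, d.2) ∧ t = rrTmul m f}

theorem rrGrading_isInternal : DirectSum.IsInternal (rrGrading M) := by
  obtain ⟨δ, hδ⟩ := exists_coaction M.isInternal
  obtain ⟨δ', hδ'⟩ := exists_coaction (omegaGrading_isInternal (k := k) w)
  let Δ : M.carrier ⊗[k] Omega k n →ₗ[k] (ℤ × ℤ →₀ M.carrier ⊗[k] Omega k n) :=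
    Finsupp.lmapDomain _ k (fun p : ℤ × (ℤ × ℤ) => (p.1 + p.2.1, p.2.2)) ∘ₗ
      (finsuppTensorFinsupp k k M.carrier (Omega k n) ℤ (ℤ × ℤ)).toLinearMap ∘ₗ
        TensorProduct.map δ δ'
  have hΔ : ∀ (b : ℤ) (d : ℤ × ℤ) (m : M.carrier) (f : Omega k n), m ∈ M.grading b →
      f ∈ omegaGrading k w d → Δ (m ⊗ₜ f) = Finsupp.single (b + d.1, d.2) (m ⊗ₜ[k] f) := by
    intro b d m f hm hf
    simp [Δ, hδ b m hm, hδ' d f hf, Finsupp.mapDomain_single]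
  refine isInternal_of_coaction (V := RRCarrier M) Δ ?_ ?_
  · intro d v hv
    refine Submodule.span_induction
      (p := fun v _ => Δ v = Finsupp.single d (v : M.carrier ⊗[k] Omega k n)) ?_ ?_ ?_ ?_ hv
    · rintro _ ⟨b, m, f, hm, hf, rfl⟩
      refine (hΔ b _ m f hm hf).trans ?_
      congr 1
      ext <;> simp
    · exact (map_zero Δ).trans (Finsupp.single_zero _).symm
    · intro x y _ _ h1 h2
      exact (map_add Δ _ _).trans ((congrArg₂ _ h1 h2).trans (Finsupp.single_add _ _ _).symm)
    · intro c x _ h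
      exact (map_smul Δ c _).trans ((congrArg _ h).trans (Finsupp.smul_single _ _ _))
  · rw [eq_top_iff]
    intro t _
    refine rr_induction (P := fun t => t ∈ iSup (rrGrading M)) t (zero_mem _) ?_
      fun s t hs ht => add_mem hs ht
    intro m f
    have hm : m ∈ iSup M.grading := by
      rw [M.isInternal.submodule_iSup_eq_top]; trivial
    have hf : f ∈ iSup (omegaGrading k w) := by
      rw [(omegaGrading_isInternal (k := k) w).submodule_iSup_eq_top]; trivial
    refine Submodule.iSup_induction _ (motive := fun m => rrTmul m f ∈ iSup (rrGrading M)) hm ?_ ?_ ?_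
    · intro b m hm
      refine Submodule.iSup_induction _ (motive := fun f => rrTmul m f ∈ iSup (rrGrading M)) hf
        ?_ ?_ ?_
      · intro d f hf
        refine Submodule.mem_iSup_of_mem (b + d.1, d.2) (Submodule.subset_span ⟨b, m, f, hm, ?_, rfl⟩)
        simpa using hf
      · have : rrTmul m (0 : Omega k n) = 0 := TensorProduct.tmul_zero _ _
        rw [this]
        exact zero_mem _
      · intro f g hf hg
        have : rrTmul m (f + g) = rrTmul m f + rrTmul m g := TensorProduct.tmul_add _ _ _
        rw [this]
        exact add_mem hf hg
    · have : rrTmul (0 : M.carrier) f = 0 := TensorProduct.zero_tmul _ _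
      rw [this]
      exact zero_mem _
    · intro m m' hm hm'
      have : rrTmul (m + m') f = rrTmul m f + rrTmul m' f := TensorProduct.add_tmul _ _ _
      rw [this]
      exact add_mem hm hm'

/-- The map `m ⊗ f ↦ x_i m ⊗ e_i f`. -/
def rrTerm (i : Fin (n + 1)) : RRCarrier M →ₗ[k] RRCarrier M :=
  TensorProduct.map (Algebra.lsmul k k M.carrier (MvPolynomial.X i : Cox k n)) (Omega.genMul i)

/-- The differential `m ⊗ f ↦ ∑ x_i m ⊗ e_i f`. -/
def rrDiffBase : RRCarrier M →ₗ[k] RRCarrier M :=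
  ∑ i : Fin (n + 1), rrTerm M i

theorem rrDiffBase_tmul {M : GrMod k w} (m : M.carrier) (f : Omega k n) :
    rrDiffBase M (rrTmul m f) =
      ∑ i : Fin (n + 1), rrTmul ((MvPolynomial.X i : Cox k n) • m) (Omega.genMul i f) := by
  rw [rrDiffBase, LinearMap.sum_apply]
  rfl

/-- The differential `E`-module `R(M)` of a graded module `M` (placed in homological degree
`0`). -/
def RR : DiffMod k w where
  carrier := RRCarrier M
  grading := rrGrading M
  isInternal := rrGrading_isInternal M
  smul_mem d d' x t hx ht := by
    refine Submodule.span_induction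
      (p := fun t _ => MulOpposite.op x • t ∈ rrGrading M (d + d')) ?_ ?_ ?_ ?_ ht
    · rintro _ ⟨b, m, f, hm, hf, rfl⟩
      rw [op_smul_rrTmul]
      refine Submodule.subset_span ⟨b, m, _, hm, ?_, rfl⟩
      have := mulRight_mem hx hf
      have e : ((d.1 - b, d.2) + d' : ℤ × ℤ) = ((d + d').1 - b, (d + d').2) := by
        ext
        · simp only [Prod.fst_add]; ring
        · rfl
      rwa [e] at this
    · rw [smul_zero]
      exact zero_mem _
    · intro s t _ _ hs ht
      rw [smul_add]
      exact add_mem hs ht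
    · intro c t _ h
      rw [smul_comm]
      exact Submodule.smul_mem _ c h
  diff :=
    { toFun := rrDiffBase M
      map_add' := map_add _
      map_smul' := by
        intro x t
        refine rr_induction (P := fun t => rrDiffBase M (x • t) = x • rrDiffBase M t) t ?_ ?_ ?_
        · simp
        · intro m f
          rw [op_smul_rrTmul, rrDiffBase_tmul, rrDiffBase_tmul, Finset.smul_sum]
          refine Finset.sum_congr rfl fun i _ => ?_
          rw [op_smul_rrTmul, genMul_mulRight]
        · intro s t hs ht
          rw [smul_add, map_add, hs, ht, map_add, smul_add] }
  diff_mem a j t ht := by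
    refine Submodule.span_induction
      (p := fun t _ => rrDiffBase M t ∈ rrGrading M (a, j - 1)) ?_ ?_ ?_ ?_ ht
    · rintro _ ⟨b, m, f, hm, hf, rfl⟩
      rw [rrDiffBase_tmul]
      refine Submodule.sum_mem _ fun i _ => Submodule.subset_span ⟨b + w i, _, _,
        M.smul_mem b (w i) _ m (MvPolynomial.isWeightedHomogeneous_X k w i) hm, ?_, rfl⟩
      have := genMul_mem i hf
      have e : (((a, j).1 - b, (a, j).2) + (-(w i : ℤ), -1) : ℤ × ℤ) =
          ((a, j - 1).1 - (b + w i), (a, j - 1).2) := by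
        ext
        · simp only [Prod.fst_add]; ring
        · simp only [Prod.snd_add]; ring
      rwa [e] at this
    · rw [map_zero]
      exact zero_mem _
    · intro s t _ _ hs ht
      rw [map_add]
      exact add_mem hs ht
    · intro c t _ h
      rw [map_smul]
      exact Submodule.smul_mem _ c h
  diff_diff t := by
    change rrDiffBase M (rrDiffBase M t) = 0
    refine rr_induction (P := fun t => rrDiffBase M (rrDiffBase M t) = 0) t ?_ ?_ ?_
    · simp
    · intro m f
      rw [rrDiffBase_tmul, map_sum]
      simp only [rrDiffBase_tmul]
      rw [← Finset.sum_product']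
      refine Finset.sum_involution (fun p _ => (p.2, p.1)) ?_ ?_ ?_ ?_
      · rintro ⟨i, j⟩ -
        rw [genMul_genMul, smul_comm (MvPolynomial.X j : Cox k n), rrTmul_neg, neg_add_cancel]
      · rintro ⟨i, j⟩ - hne h
        apply hne
        obtain rfl : j = i := congrArg Prod.fst h
        rw [genMul_self]
        exact TensorProduct.tmul_zero _ _
      · intros
        exact Finset.mem_univ _
      · intros
        rfl
    · intro s t hs ht
      rw [map_add, map_add, hs, ht, add_zero]

end RR

/-! ## Tate resolutions -/

section Tate

variable {k : Type u} [Field k] {n : ℕ} {w : Fin (n + 1) → ℕ}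

/-- The four properties of a Tate resolution `T` of a coherent sheaf `F`. -/
structure IsTateResolution (F : CoherentSheaf k w) (T : DiffMod k w) : Prop where
  minimal : T.IsMinimal
  free : T.IsFree
  /-- `T` encodes the cohomology of the twists of `F`, `H^j(F(a)) = Hom_E(k, T)_{(a; -j)}`, and for
  every graded module `M` with `M^~ = F` and `H^0_B(M) = 0` the injection
  `M → ⨁_a H^0(F(a)) = ⨁_a Hom_E(k, T)_{(a; 0)}` extends to an embedding `R(M) → T` (where `M_a` is
  the socle of `M_a ⊗_k ω_E(-a; 0)`). -/
  cohomology : ∃ θ : ∀ a j : ℤ, F.H a j ≃ₗ[k] T.socle (a, -j),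
    ∀ (M : GrMod k w) (s : SheafIso M F), M.NoTorsion →
      ∃ ι : DiffMod.Hom (RR M) T, Function.Injective ι.toFun ∧
        ∀ (a : ℤ) (m : M.grading a),
          ι.toFun (rrTmul (m : M.carrier) (omegaOne k n)) = (θ a 0 (s.toH0 a m) : T.carrier)
  exactOn : ∀ I : Finset (Fin (n + 1)), IsIrrelevant k I → T.ExactOn I

end Tate

end WeightedTate

end

/-! Let M be a finitely generated graded module without torsion whose sheaf is F. Property (3)
embeds R(M) in T. The module R(M) = M ⊗ ω_E is coinduced from k, so a graded E-linear map into it is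
the same as a graded k-linear map into M, and the embedding splits over E
(`DiffMod.Hom.exists_retraction`). If C is a complement of R(M), the differential of T exhibits T as
the cone of a morphism ε : G → R(M) with G = C(0; 1). By property (4) for the full index set T is
exact, so ε is a quasi-isomorphism. As a graded summand of a minimal free module, G is minimal and
free.

What remains is to see that G is a free flag, and this is where cohomology enters. A generator of G
times e_0 ⋯ e_n is a nonzero socle element of T outside R(M). By property (2) it is a class in some
H^j(F(a)), and for j = 0 it does not come from M_a. Serre vanishing (`SheafIso.exists_bound`)
excludes this for large a, so the first degrees of the generators of G are bounded above. The
differential preserves the first degree and lands in G · 𝔪, and each e_i lowers that degree by w_i >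
0. Hence the boundary of a generator involves only generators of strictly larger first degree, and
counting down from the bound gives the levels of a flag (`DiffMod.IsMinimal.isFreeFlag`). So ε is a
minimal free resolution (`IsTateResolution.exists_cone`).

Minimal free resolutions are unique up to isomorphism (`DiffMod.isIsomorphic_cone`): maps out of
summands of flags lift through quasi-isomorphisms up to homotopy, homotopies between minimal modules
vanish modulo 𝔪, and an endomorphism that is the identity modulo the nilpotent ideal 𝔪 is bijective.
The homotopy also provides the isomorphism of cones. Since a module M always exists
(`CoherentSheaf.exists_grMod`), any two Tate resolutions are isomorphic to the same cone.

Serre vanishing is proved by hand. Čech cochains are fractions m_I / x_I^r, so Čech cohomology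
together with the augmentation by M is the limit over r of the Koszul cohomology of x_0^r, …, x_n^r.
Its vanishing in high degrees (`limVanishes`) is shown for all graded subquotients P / P' by
induction on the variables that do not yet annihilate the subquotient. Multiplication by x_i is
injective on the limit in high degrees by induction, and a power of x_i kills every class. -/

noncomputable section

namespace WeightedTate

/-! ## Homogeneous components -/

section Components

variable {k V W ι κ : Type*} [Field k] [AddCommGroup V] [Module k V] [AddCommGroup W] [Module k W]
  [DecidableEq ι] [DecidableEq κ] {A : ι → Submodule k V} {B : κ → Submodule k W}

/-- The map that decomposes an element into its homogeneous components. -/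
def coaction (h : DirectSum.IsInternal A) : V →ₗ[k] (ι →₀ V) := (exists_coaction h).choose

theorem coaction_of_mem (h : DirectSum.IsInternal A) {i : ι} {v : V} (hv : v ∈ A i) :
    coaction h v = Finsupp.single i v := (exists_coaction h).choose_spec i v hv

/-- The homogeneous component of degree `i`. -/
def component (h : DirectSum.IsInternal A) (i : ι) : V →ₗ[k] V :=
  Finsupp.lapply i ∘ₗ coaction h

theorem component_of_mem (h : DirectSum.IsInternal A) {i : ι} {v : V} (hv : v ∈ A i) :
    component h i v = v := by
  simp [component, coaction_of_mem h hv]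

theorem component_of_mem_ne (h : DirectSum.IsInternal A) {i j : ι} (hij : j ≠ i) {v : V}
    (hv : v ∈ A i) : component h j v = 0 := by
  simp [component, coaction_of_mem h hv, hij]

theorem internal_induction (h : DirectSum.IsInternal A) {P : V → Prop} (v : V) (h0 : P 0)
    (hmem : ∀ i, ∀ v ∈ A i, P v) (hadd : ∀ v v', P v → P v' → P (v + v')) : P v := by
  have hv : v ∈ iSup A := by rw [h.submodule_iSup_eq_top]; trivial
  exact Submodule.iSup_induction A (motive := P) hv hmem h0 hadd

theorem component_mem (h : DirectSum.IsInternal A) (i : ι) (v : V) : component h i v ∈ A i := by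
  refine internal_induction h (P := fun v => component h i v ∈ A i) v (by simp) ?_ ?_
  · intro j v hv
    by_cases hij : i = j
    · subst hij
      rwa [component_of_mem h hv]
    · rw [component_of_mem_ne h hij hv]
      exact zero_mem _
  · intro v v' hv hv'
    rw [map_add]
    exact add_mem hv hv'

theorem sum_coaction (h : DirectSum.IsInternal A) (v : V) :
    Finsupp.lsum k (fun _ : ι => (LinearMap.id : V →ₗ[k] V)) (coaction h v) = v := by
  refine internal_induction h
    (P := fun v => Finsupp.lsum k (fun _ : ι => (LinearMap.id : V →ₗ[k] V)) (coaction h v) = v)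
    v (by simp) ?_ ?_
  · intro j v hv
    rw [coaction_of_mem h hv]
    simp
  · intro v v' hv hv'
    rw [map_add, map_add, hv, hv']

theorem eq_zero_of_component (h : DirectSum.IsInternal A) {v : V}
    (hv : ∀ i, component h i v = 0) : v = 0 := by
  have h0 : coaction h v = 0 := Finsupp.ext hv
  rw [← sum_coaction h v, h0, map_zero]

theorem mem_of_component (h : DirectSum.IsInternal A) {v : V} {i : ι}
    (hv : ∀ j, j ≠ i → component h j v = 0) : v ∈ A i := by
  have : v - component h i v = 0 := by
    refine eq_zero_of_component h fun j => ?_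
    rw [map_sub]
    by_cases hj : j = i
    · subst hj
      rw [component_of_mem h (component_mem h j v), sub_self]
    · rw [hv j hj, component_of_mem_ne h hj (component_mem h i v), sub_self]
  rw [sub_eq_zero.1 this]
  exact component_mem h i v

/-- Stated for maps that change degrees by any injective rule, to cover morphisms, differentials and
multiplication by homogeneous elements at once. Injectivity of σ keeps the images of different
components apart. -/
theorem component_map (hA : DirectSum.IsInternal A) (hB : DirectSum.IsInternal B) (f : V →ₗ[k] W)
    (σ : ι → κ) (hσ : Function.Injective σ) (hf : ∀ i, ∀ v ∈ A i, f v ∈ B (σ i)) (i : ι) (v : V) :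
    component hB (σ i) (f v) = f (component hA i v) := by
  refine internal_induction hA
    (P := fun v => component hB (σ i) (f v) = f (component hA i v)) v (by simp) ?_ ?_
  · intro j v hv
    by_cases hij : i = j
    · subst hij
      rw [component_of_mem hA hv, component_of_mem hB (hf i v hv)]
    · rw [component_of_mem_ne hA hij hv, component_of_mem_ne hB (fun e => hij (hσ e)) (hf j v hv),
        map_zero]
  · intro v v' hv hv'
    simp only [map_add, hv, hv']

theorem exists_linearMap_of_internal (h : DirectSum.IsInternal A) (f : ι → V →ₗ[k] W) :
    ∃ g : V →ₗ[k] W, ∀ i, ∀ v ∈ A i, g v = f i v := by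
  refine ⟨Finsupp.lsum k f ∘ₗ coaction h, fun i v hv => ?_⟩
  simp [coaction_of_mem h hv]

/-- A subspace that contains the components of its elements is graded, and it may be regraded. -/
theorem isInternal_comap (hB : DirectSum.IsInternal B) (f : V →ₗ[k] W)
    (hf : Function.Injective f) (e : ι ≃ κ)
    (hs : ∀ v i, component hB i (f v) ∈ LinearMap.range f) :
    DirectSum.IsInternal (fun i => (B (e i)).comap f) := by
  -- A linear left inverse of f carries the decomposition of W back to V; the hypothesis `hs` makes
  -- it undo f on each component.
  obtain ⟨g, hg⟩ := LinearMap.exists_leftInverse_of_injective f (LinearMap.ker_eq_bot.2 hf)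
  have hg' : ∀ v, g (f v) = v := fun v => LinearMap.congr_fun hg v
  refine isInternal_of_coaction (Finsupp.lmapDomain _ k e.symm ∘ₗ
    Finsupp.mapRange.linearMap g ∘ₗ coaction hB ∘ₗ f) ?_ ?_
  · intro i v hv
    have hv : f v ∈ B (e i) := hv
    simp [coaction_of_mem hB hv, Finsupp.mapDomain_single, hg']
  · rw [eq_top_iff]
    intro v _
    rw [← hg' v, ← sum_coaction hB (f v), Finsupp.lsum_apply, Finsupp.sum, map_sum]
    refine Submodule.sum_mem _ fun i _ => ?_
    obtain ⟨u, hu⟩ := hs v i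
    refine Submodule.mem_iSup_of_mem (e.symm i) ?_
    have h1 := component_mem hB i (f v)
    rw [← hu] at h1
    change f (g (component hB i (f v))) ∈ B (e (e.symm i))
    rw [← hu, hg', Equiv.apply_symm_apply]
    exact h1

end Components

/-! ## Quasi-isomorphisms and cones -/

namespace DiffMod

variable {k : Type u} [Field k] {n : ℕ} {w : Fin (n + 1) → ℕ} {A B C : DiffMod k w}

/-- The identity. -/
def Hom.id (A : DiffMod k w) : Hom A A := ⟨LinearMap.id, fun _ _ h => h, fun _ => rfl⟩

/-- Composition of morphisms. -/
def Hom.comp (g : Hom B C) (f : Hom A B) : Hom A C :=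
  ⟨g.toFun ∘ₗ f.toFun, fun d t ht => g.map_mem d _ (f.map_mem d t ht), fun t => by
    simp [f.map_diff, g.map_diff]⟩

/-- The inverse is automatically of degree 0: f commutes with components, so the components of a
preimage in wrong degrees map to 0. -/
theorem isIsomorphic_of_bijective (f : Hom A B) (hf : Function.Bijective f.toFun) :
    IsIsomorphic A B := by
  let e := LinearEquiv.ofBijective f.toFun hf
  have he : ∀ t, e t = f.toFun t := fun _ => rfl
  have he' : ∀ t, f.toFun (e.symm t) = t := fun t => by rw [← he, e.apply_symm_apply]
  refine ⟨f, ⟨e.symm.toLinearMap, ?_, ?_⟩, fun t => e.symm_apply_apply t, he'⟩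
  · intro d t ht
    refine mem_of_component A.isInternal fun j hj => hf.1 ?_
    have := component_map A.isInternal B.isInternal (f.toFun.restrictScalars k) _root_.id
      (fun _ _ h => h) (fun i v hv => f.map_mem i v hv) j (e.symm t)
    refine Eq.trans this.symm ?_
    rw [map_zero]
    have h2 : (f.toFun.restrictScalars k) (e.symm t) = t := he' t
    rw [h2]
    exact component_of_mem_ne B.isInternal hj ht
  · intro t
    refine hf.1 ?_
    change f.toFun (e.symm _) = f.toFun (A.diff (e.symm t))
    rw [f.map_diff, he', he']

theorem IsIsomorphic.symm (h : IsIsomorphic A B) : IsIsomorphic B A := by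
  obtain ⟨f, g, h1, h2⟩ := h
  exact ⟨g, f, h2, h1⟩

theorem IsIsomorphic.trans (h : IsIsomorphic A B) (h' : IsIsomorphic B C) : IsIsomorphic A C := by
  obtain ⟨f, g, h1, h2⟩ := h
  obtain ⟨f', g', h1', h2'⟩ := h'
  exact ⟨f'.comp f, g.comp g', fun t => by simp [Hom.comp, h1, h1'],
    fun t => by simp [Hom.comp, h2, h2']⟩

/-- Injectivity and surjectivity on homology in terms of cycles and boundaries, so that later
arguments can chase elements. -/
theorem Hom.isQuasiIso_iff (f : Hom A B) : f.IsQuasiIso ↔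
    (∀ y, A.diff y = 0 → ∀ x, f.toFun y = B.diff x → ∃ z, y = A.diff z) ∧
    (∀ x, B.diff x = 0 → ∃ y, A.diff y = 0 ∧ ∃ z, x = f.toFun y + B.diff z) := by
  unfold Hom.IsQuasiIso Function.Bijective
  refine and_congr ?_ ?_
  · rw [injective_iff_map_eq_zero]
    constructor
    · intro h y hy x hx
      have := h (Submodule.Quotient.mk ⟨y, hy⟩) ((Submodule.Quotient.mk_eq_zero _).2 ⟨x, hx.symm⟩)
      obtain ⟨z, hz⟩ := (Submodule.Quotient.mk_eq_zero _).1 this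
      exact ⟨z, hz.symm⟩
    · intro h q
      induction q using Submodule.Quotient.induction_on with
      | H y =>
        intro hq
        obtain ⟨x, hx⟩ := (Submodule.Quotient.mk_eq_zero _).1 hq
        obtain ⟨z, hz⟩ := h y y.2 x hx.symm
        exact (Submodule.Quotient.mk_eq_zero _).2 ⟨z, hz.symm⟩
  · constructor
    · intro h x hx
      obtain ⟨q, hq⟩ := h (Submodule.Quotient.mk ⟨x, hx⟩)
      induction q using Submodule.Quotient.induction_on with
      | H y =>
        obtain ⟨z, hz⟩ := (Submodule.Quotient.eq _).1 hq
        refine ⟨y, y.2, -z, ?_⟩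
        have hz' : B.diff z = f.toFun y - x := hz
        rw [map_neg, hz']
        abel
    · intro h q
      induction q using Submodule.Quotient.induction_on with
      | H x =>
        obtain ⟨y, hy, z, hz⟩ := h x x.2
        refine ⟨Submodule.Quotient.mk ⟨y, hy⟩, (Submodule.Quotient.eq _).2 ⟨-z, ?_⟩⟩
        change B.diff (-z) = f.toFun y - x
        rw [hz, map_neg]
        abel

theorem cone_exact_iff (f : Hom A B) : Function.Exact (cone f).diff (cone f).diff ↔
    ∀ x y, B.diff x + f.toFun y = 0 → A.diff y = 0 →
      ∃ x' z, B.diff x' + f.toFun z = x ∧ -A.diff z = y := by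
  constructor
  · intro h x y hx hy
    obtain ⟨⟨x', z⟩, hz⟩ := (h (x, y)).1 (Prod.ext hx (neg_eq_zero.2 hy))
    exact ⟨x', z, congrArg Prod.fst hz, congrArg Prod.snd hz⟩
  · rintro h ⟨x, y⟩
    constructor
    · intro hxy
      obtain ⟨x', z, h1, h2⟩ := h x y (congrArg Prod.fst hxy)
        (neg_eq_zero.1 (congrArg Prod.snd hxy))
      exact ⟨(x', z), Prod.ext h1 h2⟩
    · rintro ⟨t, ht⟩
      rw [← ht, (cone f).diff_diff]

theorem Hom.isQuasiIso_iff_cone_exact (f : Hom A B) :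
    f.IsQuasiIso ↔ Function.Exact (cone f).diff (cone f).diff := by
  rw [cone_exact_iff, f.isQuasiIso_iff]
  constructor
  · rintro ⟨h1, h2⟩ x y hx hy
    -- For a cycle (x, y) of the cone, f y bounds -x, so y = ∂z. Then x + f z is a cycle of B, to
    -- which surjectivity applies.
    obtain ⟨z, rfl⟩ := h1 y hy (-x) (by rw [map_neg]; exact eq_neg_of_add_eq_zero_right hx)
    obtain ⟨z', hz', x', hx'⟩ := h2 (x + f.toFun z) (by rw [map_add, ← f.map_diff]; exact hx)
    refine ⟨x', z' - z, ?_, ?_⟩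
    · rw [map_sub, ← add_sub_assoc, add_comm (B.diff x'), ← hx', add_sub_cancel_right]
    · rw [map_sub, hz', zero_sub, neg_neg]
  · intro h
    refine ⟨fun y hy x hx => ?_, fun x hx => ?_⟩
    · obtain ⟨x', z, -, hz⟩ := h (-x) y (by rw [map_neg, hx, neg_add_cancel]) hy
      exact ⟨-z, by rw [map_neg, hz]⟩
    · obtain ⟨x', z, h1, h2⟩ := h x 0 (by rw [hx, map_zero, add_zero]) (map_zero _)
      exact ⟨z, neg_eq_zero.1 h2, x', by rw [← h1, add_comm]⟩

/-- `f` is a quasi-isomorphism if `g` and `k ≃ g f` are. -/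
theorem Hom.isQuasiIso_of_homotopy {f : Hom A B} {g : Hom B C} {l : Hom A C} (hg : g.IsQuasiIso)
    (hl : l.IsQuasiIso) (h : A.carrier →ₗ[(Ext k n)ᵐᵒᵖ] C.carrier)
    (hh : ∀ t, l.toFun t - g.toFun (f.toFun t) = C.diff (h t) + h (A.diff t)) :
    f.IsQuasiIso := by
  obtain ⟨g1, g2⟩ := g.isQuasiIso_iff.1 hg
  obtain ⟨l1, l2⟩ := l.isQuasiIso_iff.1 hl
  refine f.isQuasiIso_iff.2 ⟨fun y hy x hx => ?_, fun b hb => ?_⟩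
  · refine l1 y hy (g.toFun x + h y) ?_
    have := hh y
    rw [hy, map_zero, add_zero, hx, g.map_diff] at this
    rw [map_add, ← this]
    abel
  · obtain ⟨a, ha, c, hc⟩ := l2 (g.toFun b) (by rw [← g.map_diff, hb, map_zero])
    have := hh a
    rw [ha, map_zero, add_zero] at this
    -- g (b - f a) is the boundary of h a + c, and g is injective on homology, so b - f a is itself
    -- a boundary.
    obtain ⟨z, hz⟩ := g1 (b - f.toFun a) (by rw [map_sub, hb, ← f.map_diff, ha]; simp)
      (h a + c) (by rw [map_sub, hc, map_add, ← this]; abel)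
    exact ⟨a, ha, z, by rw [← hz]; abel⟩

theorem Hom.id_isQuasiIso (A : DiffMod k w) : (Hom.id A).IsQuasiIso := by
  refine (Hom.id A).isQuasiIso_iff.2 ⟨fun y _ x hx => ⟨x, hx⟩, fun x hx => ⟨x, hx, 0, ?_⟩⟩
  rw [map_zero, add_zero]
  rfl

end DiffMod

/-! ## Modules over the exterior algebra -/

section ExtBasis

variable {k : Type u} [Field k] {n : ℕ}

theorem extBasis_mul_of_disjoint {I J : Finset (Fin (n + 1))} (hd : Disjoint I J) :
    ∃ c : ℤˣ, extBasis k n I * extBasis k n J = c • extBasis k n (I ∪ J) := by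
  have h : extBasis k n I * extBasis k n J = _ :=
    ExteriorAlgebra.basis_mul_of_disjoint (Pi.basisFun k (Fin (n + 1)))
      (Set.powersetCard.ofCard (rfl : I.card = I.card))
      (Set.powersetCard.ofCard (rfl : J.card = J.card)) hd
  have hu : ((Set.powersetCard.disjUnion (s := Set.powersetCard.ofCard (rfl : I.card = I.card))
      (t := Set.powersetCard.ofCard (rfl : J.card = J.card)) hd : Set.powersetCard _ _) :
        Finset (Fin (n + 1))) = I ∪ J :=
    Finset.disjUnion_eq_union I J hd
  rw [hu] at h
  exact ⟨_, h⟩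

theorem extBasis_mul_of_not_disjoint {I J : Finset (Fin (n + 1))} (hd : ¬ Disjoint I J) :
    extBasis k n I * extBasis k n J = 0 :=
  ExteriorAlgebra.basis_mul_of_not_disjoint (Pi.basisFun k (Fin (n + 1)))
    (Set.powersetCard.ofCard (rfl : I.card = I.card))
    (Set.powersetCard.ofCard (rfl : J.card = J.card)) hd

theorem extBasis_empty : extBasis k n ∅ = 1 := by
  rw [extBasis, ExteriorAlgebra.basis_apply_ofCard (n := 0) _ Finset.card_empty]
  simp [ExteriorAlgebra.ιMulti_family]

theorem extBasis_mem (w : Fin (n + 1) → ℕ) (J : Finset (Fin (n + 1))) :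
    extBasis k n J ∈ extGrading k w (monDeg w J) :=
  Submodule.subset_span ⟨J, rfl, rfl⟩

theorem exists_extBasis_eq {J : Finset (Fin (n + 1))} {i : Fin (n + 1)} (hi : i ∈ J) :
    ∃ c : ℤˣ, extBasis k n J = extGen k i * (c • extBasis k n (J.erase i)) := by
  obtain ⟨c, hc⟩ := extBasis_mul_of_disjoint (k := k) (I := {i}) (J := J.erase i)
    (by simp)
  have hu : ({i} : Finset (Fin (n + 1))) ∪ J.erase i = J := by
    rw [← Finset.insert_eq, Finset.insert_erase hi]
  rw [hu, extBasis_singleton] at hc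
  refine ⟨c, ?_⟩
  rw [mul_smul_comm, hc, smul_smul, Int.units_mul_self, one_smul]

/-- The generator `e_0 ⋯ e_n` of the socle of `E`. -/
def extTop (k : Type u) [Field k] (n : ℕ) : Ext k n := extBasis k n Finset.univ

theorem extTop_mul_extGen (i : Fin (n + 1)) : extTop k n * extGen k i = 0 := by
  rw [← extBasis_singleton, extTop, extBasis_mul_of_not_disjoint (by simp)]

/-- A nonempty monomial shares a factor with e_0 ⋯ e_n, so only the constant term survives.
Multiplication by the top monomial therefore detects whether x lies in 𝔪. -/
theorem mul_extTop (x : Ext k n) :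
    x * extTop k n = (extBasis k n).repr x ∅ • extTop k n := by
  conv_lhs => rw [← (extBasis k n).sum_repr x, Finset.sum_mul]
  rw [Finset.sum_eq_single ∅]
  · rw [extBasis_empty, smul_mul_assoc, one_mul]
  · intro J _ hJ
    rw [smul_mul_assoc, extTop, extBasis_mul_of_not_disjoint (J := Finset.univ)
      (fun h => hJ (disjoint_top.1 h)), smul_zero]
  · simp

theorem extTop_ne_zero : extTop k n ≠ 0 := (extBasis k n).ne_zero _

/-- The span of the monomials of length at least `l`. -/
def extFiltration (k : Type u) [Field k] (n l : ℕ) : Submodule k (Ext k n) :=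
  Submodule.span k {z | ∃ J : Finset (Fin (n + 1)), l ≤ J.card ∧ z = extBasis k n J}

theorem mem_extFiltration_zero (x : Ext k n) : x ∈ extFiltration k n 0 := by
  rw [← (extBasis k n).sum_repr x]
  exact Submodule.sum_mem _ fun J _ =>
    Submodule.smul_mem _ _ (Submodule.subset_span ⟨J, Nat.zero_le _, rfl⟩)

theorem mul_mem_extFiltration {l m : ℕ} {x y : Ext k n} (hx : x ∈ extFiltration k n l)
    (hy : y ∈ extFiltration k n m) : x * y ∈ extFiltration k n (l + m) := by
  refine (Submodule.mul_le (P := extFiltration k n (l + m))).1 ?_ x hx y hy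
  rw [extFiltration, extFiltration, Submodule.span_mul_span, Submodule.span_le]
  rintro _ ⟨_, ⟨I, hI, rfl⟩, _, ⟨J, hJ, rfl⟩, rfl⟩
  by_cases hd : Disjoint I J
  · obtain ⟨c, hc⟩ := extBasis_mul_of_disjoint (k := k) hd
    have hm : extBasis k n (I ∪ J) ∈ extFiltration k n (l + m) :=
      Submodule.subset_span ⟨I ∪ J, by rw [Finset.card_union_of_disjoint hd]; omega, rfl⟩
    simp only [hc, SetLike.mem_coe]
    rcases Int.units_eq_one_or c with rfl | rfl
    · rwa [one_smul]
    · rw [Units.neg_smul, one_smul]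
      exact neg_mem hm
  · simp only [extBasis_mul_of_not_disjoint hd]
    exact zero_mem _

/-- Monomials in n + 1 generators have length at most n + 1. The Nakayama-type arguments below rest
on this nilpotence. -/
theorem extFiltration_eq_bot : extFiltration k n (n + 2) = ⊥ := by
  refine Submodule.span_eq_bot.2 ?_
  rintro _ ⟨J, hJ, rfl⟩
  have := J.card_le_univ
  rw [Fintype.card_fin] at this
  omega

end ExtBasis

/-! ### Free flags, lifting up to homotopy, uniqueness of minimal free resolutions -/

namespace DiffMod

variable {k : Type u} [Field k] {n : ℕ} {w : Fin (n + 1) → ℕ} {A B C D : DiffMod k w}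

/-- The `k`-basis `b_i e_J` of an `E`-module with basis `b_i`. -/
def monBasis {ι : Type*} (b : Module.Basis ι (Ext k n)ᵐᵒᵖ D.carrier) :
    Module.Basis (Finset (Fin (n + 1)) × ι) k D.carrier :=
  ((extBasis k n).map (MulOpposite.opLinearEquiv k)).smulTower b

theorem monBasis_apply {ι : Type*} (b : Module.Basis ι (Ext k n)ᵐᵒᵖ D.carrier)
    (J : Finset (Fin (n + 1))) (i : ι) :
    monBasis b (J, i) = MulOpposite.op (extBasis k n J) • b i := by
  simp [monBasis]

theorem monBasis_mem {ι : Type*} {b : Module.Basis ι (Ext k n)ᵐᵒᵖ D.carrier} {deg : ι → ℤ × ℤ}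
    (hb : ∀ i, b i ∈ D.grading (deg i)) (J : Finset (Fin (n + 1))) (i : ι) :
    monBasis b (J, i) ∈ D.grading (deg i + monDeg w J) := by
  rw [monBasis_apply]
  exact D.smul_mem _ _ _ _ (extBasis_mem w J) (hb i)

/-- Homogeneity of a map can be checked on a homogeneous basis. -/
theorem map_mem_of_basis {ι : Type*} {b : Module.Basis ι (Ext k n)ᵐᵒᵖ A.carrier}
    {deg : ι → ℤ × ℤ} (hb : ∀ i, b i ∈ A.grading (deg i))
    (f : A.carrier →ₗ[(Ext k n)ᵐᵒᵖ] B.carrier) (c : ℤ × ℤ)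
    (hf : ∀ i, f (b i) ∈ B.grading (deg i + c)) (d : ℤ × ℤ) (t : A.carrier)
    (ht : t ∈ A.grading d) : f t ∈ B.grading (d + c) := by
  -- Compatibility of f with components is a k-linear identity, so it suffices to check it on the
  -- k-basis b_i e_J.
  have key : component B.isInternal (d + c) ∘ₗ f.restrictScalars k
      = f.restrictScalars k ∘ₗ component A.isInternal d := by
    refine (monBasis b).ext fun ⟨J, i⟩ => ?_
    have h1 := monBasis_mem hb J i
    have h2 : f (monBasis b (J, i)) ∈ B.grading (deg i + monDeg w J + c) := by
      rw [monBasis_apply, map_smul, add_right_comm]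
      exact B.smul_mem _ _ _ _ (extBasis_mem w J) (hf i)
    simp only [LinearMap.comp_apply, LinearMap.restrictScalars_apply]
    by_cases hd : d = deg i + monDeg w J
    · rw [hd, component_of_mem _ h2, component_of_mem _ h1]
    · rw [component_of_mem_ne _ (fun e => hd (add_right_cancel e)) h2,
        component_of_mem_ne _ hd h1, map_zero]
  have := LinearMap.congr_fun key t
  simp only [LinearMap.comp_apply, LinearMap.restrictScalars_apply] at this
  rw [component_of_mem _ ht] at this
  rw [← this]
  exact component_mem _ _ _

/-- Maps from free flags to exact differential modules are null-homotopic. -/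
theorem IsFreeFlag.exists_homotopy {P X : DiffMod k w} (hP : P.IsFreeFlag)
    (hX : Function.Exact X.diff X.diff) (u : Hom P X) :
    ∃ s : P.carrier →ₗ[(Ext k n)ᵐᵒᵖ] X.carrier,
      (∀ d t, t ∈ P.grading d → s t ∈ X.grading (d + (0, 1))) ∧
      ∀ t, u.toFun t = X.diff (s t) + s (P.diff t) := by
  obtain ⟨ι, b, level, hb, hflag⟩ := hP
  choose deg hb using hb
  -- A homogeneous cycle of X bounds a homogeneous element: take the component of any primitive in
  -- the right degree.
  have hbound : ∀ d t, X.diff t = 0 → t ∈ X.grading d →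
      ∃ z ∈ X.grading (d + (0, 1)), X.diff z = t := by
    intro d t h0 ht
    obtain ⟨z, hz⟩ := (hX t).1 h0
    refine ⟨component X.isInternal (d + (0, 1)) z, component_mem _ _ _, ?_⟩
    have := component_map X.isInternal X.isInternal (X.diff.restrictScalars k)
      (fun d => (d.1, d.2 - 1)) (fun a b h => by
        simp only [Prod.mk.injEq, sub_left_inj] at h
        exact Prod.ext h.1 h.2) (fun i v hv => X.diff_mem i.1 i.2 v hv) (d + (0, 1)) z
    simp only [LinearMap.restrictScalars_apply, hz] at this
    rw [← this]
    have e : ((d + (0, 1) : ℤ × ℤ).1, (d + (0, 1) : ℤ × ℤ).2 - 1) = d := by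
      ext <;> simp
    rw [e]
    exact component_of_mem _ ht
  -- Stage l of the construction: s has the right degree on all basis elements and is a
  -- null-homotopy on those of level below l.
  let Good : ℕ → (P.carrier →ₗ[(Ext k n)ᵐᵒᵖ] X.carrier) → Prop := fun l s =>
    (∀ i, s (b i) ∈ X.grading (deg i + (0, 1))) ∧
    ∀ i, level i < l → u.toFun (b i) = X.diff (s (b i)) + s (P.diff (b i))
  have hlow : ∀ l (s s' : P.carrier →ₗ[(Ext k n)ᵐᵒᵖ] X.carrier),
      (∀ i, level i < l → s' (b i) = s (b i)) →
      ∀ i, level i ≤ l → s' (P.diff (b i)) = s (P.diff (b i)) := by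
    intro l s s' h i hi
    refine LinearMap.eqOn_span (s := b '' {i' | level i' < level i}) ?_ (hflag i)
    rintro _ ⟨i', hi', rfl⟩
    exact h i' (lt_of_lt_of_le hi' hi)
  have step : ∀ l s, Good l s → ∃ s', Good (l + 1) s' ∧
      ∀ i, level i < l → s' (b i) = s (b i) := by
    intro l s hs
    have hsdeg := map_mem_of_basis hb s (0, 1) hs.1
    have hz : ∀ i, ∃ z ∈ X.grading (deg i + (0, 1)), level i = l →
        X.diff z = u.toFun (b i) - s (P.diff (b i)) := by
      intro i
      by_cases hi : level i = l
      · have hcyc : ∀ t ∈ Submodule.span (Ext k n)ᵐᵒᵖ (b '' {i' | level i' < level i}),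
            u.toFun t = X.diff (s t) + s (P.diff t) := by
          intro t ht
          refine LinearMap.eqOn_span (f := u.toFun) (g := X.diff ∘ₗ s + s ∘ₗ P.diff) ?_ ht
          rintro _ ⟨i', hi', rfl⟩
          exact hs.2 i' (hi ▸ hi')
        -- The boundary of b_i lies in lower levels, where the homotopy identity holds already.
        -- Hence u b_i - s ∂b_i is a cycle, and a primitive of it is the required value on b_i.
        have h1 := hcyc _ (hflag i)
        rw [P.diff_diff, map_zero, add_zero, u.map_diff] at h1
        have h2 := hsdeg _ _ (P.diff_mem _ _ _ (hb i))
        have e : ((deg i).1, (deg i).2 - 1) + (0, 1) = deg i := by ext <;> simp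
        rw [e] at h2
        obtain ⟨z, hz, hz'⟩ := hbound (deg i) (u.toFun (b i) - s (P.diff (b i)))
          (by rw [map_sub, h1, sub_self]) (sub_mem (u.map_mem _ _ (hb i)) h2)
        exact ⟨z, hz, fun _ => hz'⟩
      · exact ⟨0, zero_mem _, fun h => (hi h).elim⟩
    choose z hz hz' using hz
    let s' := b.constr ℕ fun i => if level i < l then s (b i) else z i
    have hs' : ∀ i, s' (b i) = if level i < l then s (b i) else z i := fun i => by
      simp [s', Module.Basis.constr_basis]
    have hs'' : ∀ i, level i < l → s' (b i) = s (b i) := fun i hi => by rw [hs', if_pos hi]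
    refine ⟨s', ⟨fun i => ?_, fun i hi => ?_⟩, hs''⟩
    · rw [hs']
      split_ifs
      · exact hs.1 i
      · exact hz i
    · rw [hlow l s s' hs'' i (Nat.lt_succ_iff.1 hi)]
      by_cases h : level i < l
      · rw [hs'' i h]
        exact hs.2 i h
      · rw [hs', if_neg h, hz' i (by omega), sub_add_cancel]
  have h0 : Good 0 0 := ⟨fun i => zero_mem _, fun i hi => (Nat.not_lt_zero _ hi).elim⟩
  choose next hnext hnext' using step
  let seq : ∀ l, {s // Good l s} :=
    fun l => Nat.rec ⟨0, h0⟩ (fun l s => ⟨next l s.1 s.2, hnext l s.1 s.2⟩) l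
  have hseq : ∀ l i, level i < l → (seq (l + 1)).1 (b i) = (seq l).1 (b i) :=
    fun l i hi => hnext' l (seq l).1 (seq l).2 i hi
  -- The value on b_i no longer changes after stage `level i + 1`, so the stages have a limit.
  have hstab : ∀ l i, level i < l → (seq l).1 (b i) = (seq (level i + 1)).1 (b i) := by
    intro l i hi
    induction l, (Nat.succ_le_iff.2 hi) using Nat.le_induction with
    | base => rfl
    | succ l hl ih => rw [hseq l i hl, ih hl]
  let s := b.constr ℕ fun i => (seq (level i + 1)).1 (b i)
  have hs : ∀ i, s (b i) = (seq (level i + 1)).1 (b i) := fun i => by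
    simp [s, Module.Basis.constr_basis]
  refine ⟨s, map_mem_of_basis hb s (0, 1) fun i => ?_, fun t => ?_⟩
  · rw [hs]
    exact (seq _).2.1 i
  · suffices u.toFun = X.diff ∘ₗ s + s ∘ₗ P.diff from LinearMap.congr_fun this t
    refine b.ext fun i => ?_
    have h1 := (seq (level i + 1)).2.2 i (Nat.lt_succ_self _)
    have h2 := hlow (level i) (seq (level i + 1)).1 s (fun i' hi' => by
      rw [hs, hstab (level i + 1) i' (by omega)]) i le_rfl
    rw [LinearMap.add_apply, LinearMap.comp_apply, LinearMap.comp_apply, hs, h2]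
    exact h1

/-- Morphisms from free flags lift through quasi-isomorphisms up to homotopy. -/
theorem IsFreeFlag.exists_lift {P : DiffMod k w} (hP : P.IsFreeFlag) {f : Hom A B}
    (hf : f.IsQuasiIso) (g : Hom P B) :
    ∃ (φ : Hom P A) (h : P.carrier →ₗ[(Ext k n)ᵐᵒᵖ] B.carrier),
      (∀ d t, t ∈ P.grading d → h t ∈ B.grading (d + (0, 1))) ∧
      ∀ t, g.toFun t - f.toFun (φ.toFun t) = B.diff (h t) + h (P.diff t) := by
  -- View g as a map into the first summand of the cone. The cone is exact, so this map is
  -- null-homotopic; the second component of the null-homotopy is the lift, the first is the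
  -- homotopy.
  let u : Hom P (cone f) := ⟨LinearMap.inl _ B.carrier A.carrier ∘ₗ g.toFun,
    fun d t ht => ⟨g.map_mem d t ht, zero_mem _⟩, fun t => Prod.ext (by
      change g.toFun (P.diff t) = B.diff (g.toFun t) + f.toFun 0
      rw [g.map_diff, map_zero, add_zero]) (by
      change (0 : A.carrier) = -A.diff 0
      rw [map_zero, neg_zero])⟩
  obtain ⟨s, hs, hu⟩ := hP.exists_homotopy (f.isQuasiIso_iff_cone_exact.1 hf) u
  have h1 : ∀ t, g.toFun t
      = B.diff (s t).1 + f.toFun (s t).2 + (s (P.diff t)).1 := fun t => congrArg Prod.fst (hu t)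
  have h2 : ∀ t, (0 : A.carrier) = -A.diff (s t).2 + (s (P.diff t)).2 :=
    fun t => congrArg Prod.snd (hu t)
  refine ⟨⟨LinearMap.snd _ B.carrier A.carrier ∘ₗ s, fun d t ht => ?_, fun t => ?_⟩,
    LinearMap.fst _ B.carrier A.carrier ∘ₗ s, fun d t ht => (hs d t ht).1, fun t => ?_⟩
  · have h3 : (s t).2 ∈ A.grading (d.1 + 0, d.2 + 1 - 1) := (hs d t ht).2
    rwa [add_zero, add_sub_cancel_right] at h3
  · change (s (P.diff t)).2 = A.diff (s t).2
    exact (neg_add_eq_zero.1 (h2 t).symm).symm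
  · change g.toFun t - f.toFun (s t).2 = B.diff (s t).1 + (s (P.diff t)).1
    rw [h1]
    abel

theorem map_mulVars (f : A.carrier →ₗ[(Ext k n)ᵐᵒᵖ] B.carrier) (J : Finset (Fin (n + 1)))
    {t : A.carrier} (ht : t ∈ A.mulVars J) : f t ∈ B.mulVars J := by
  have : A.mulVars J ≤ (B.mulVars J).comap f := by
    refine Submodule.span_le.2 ?_
    rintro _ ⟨i, hi, s, rfl⟩
    exact Submodule.subset_span ⟨i, hi, f s, map_smul _ _ _⟩
  exact this ht

/-- The filtration of `D` by the powers of `𝔪`. -/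
def radFiltration (D : DiffMod k w) (l : ℕ) : Submodule k D.carrier :=
  Submodule.span _ {t | ∃ y ∈ extFiltration k n l, ∃ s, t = MulOpposite.op y • s}

theorem smul_mem_radFiltration {l : ℕ} {y : Ext k n} (hy : y ∈ extFiltration k n l)
    {s : D.carrier} (hs : s ∈ D.mulVars Finset.univ) :
    MulOpposite.op y • s ∈ D.radFiltration (l + 1) := by
  -- Additively, D · 𝔪 is generated by elements s e_i x with x in E. Acting by y from the right
  -- gives s times e_i x y, whose monomials have length at least l + 1.
  refine Submodule.closure_induction
    (p := fun s _ => MulOpposite.op y • s ∈ D.radFiltration (l + 1)) ?_ ?_ ?_ hs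
  · rw [smul_zero]; exact zero_mem _
  · intro x x' _ _ hx hx'
    rw [smul_add]
    exact add_mem hx hx'
  · rintro x _ ⟨i, -, s, rfl⟩
    rw [← mul_smul, ← mul_smul]
    refine Submodule.subset_span ⟨extGen k i * x.unop * y, ?_, s, ?_⟩
    · have h1 : extGen k i ∈ extFiltration k n 1 :=
        Submodule.subset_span ⟨{i}, by simp, (extBasis_singleton i).symm⟩
      have := mul_mem_extFiltration (mul_mem_extFiltration h1 (mem_extFiltration_zero x.unop)) hy
      rwa [add_zero, add_comm 1 l] at this
    · congr 1
      simp [mul_assoc]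

theorem mulVars_le_radFiltration {s : D.carrier} (hs : s ∈ D.mulVars Finset.univ) :
    s ∈ D.radFiltration 1 := by
  have := smul_mem_radFiltration (mem_extFiltration_zero (1 : Ext k n)) hs
  rwa [MulOpposite.op_one, one_smul] at this

/-- An endomorphism that is the identity modulo `D · 𝔪` is bijective. -/
theorem bijective_of_sub_mem (f : D.carrier →ₗ[(Ext k n)ᵐᵒᵖ] D.carrier)
    (hf : ∀ t, f t - t ∈ D.mulVars Finset.univ) : Function.Bijective f := by
  -- N = f - 1 raises the 𝔪-filtration by one, hence is nilpotent, and f = 1 + N is invertible.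
  let N : Module.End (Ext k n)ᵐᵒᵖ D.carrier := f - 1
  have hN : ∀ l, ∀ t ∈ D.radFiltration l, N t ∈ D.radFiltration (l + 1) := by
    intro l t ht
    refine Submodule.span_induction (p := fun t _ => N t ∈ D.radFiltration (l + 1)) ?_ ?_ ?_ ?_ ht
    · rintro _ ⟨y, hy, s, rfl⟩
      rw [map_smul]
      exact smul_mem_radFiltration hy (hf s)
    · rw [map_zero]; exact zero_mem _
    · intro x y _ _ hx hy
      rw [map_add]
      exact add_mem hx hy
    · intro c x _ hx
      have : N (c • x) = c • N x := (N.restrictScalars k).map_smul c x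
      rw [this]
      exact Submodule.smul_mem _ _ hx
  have hpow : ∀ l t, (N ^ l) t ∈ D.radFiltration l := by
    intro l
    induction l with
    | zero =>
      intro t
      exact Submodule.subset_span ⟨1, mem_extFiltration_zero _, t, by simp⟩
    | succ l ih =>
      intro t
      rw [pow_succ']
      exact hN l _ (ih t)
  have hnil : IsNilpotent N := by
    refine ⟨n + 2, LinearMap.ext fun t => ?_⟩
    have : D.radFiltration (n + 2) = ⊥ := by
      refine Submodule.span_eq_bot.2 ?_
      rintro _ ⟨y, hy, s, rfl⟩
      rw [extFiltration_eq_bot, Submodule.mem_bot] at hy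
      rw [hy, MulOpposite.op_zero, zero_smul]
    have h := hpow (n + 2) t
    rw [this] at h
    exact h
  have hu := hnil.isUnit_one_add
  have he : (1 + N : Module.End (Ext k n)ᵐᵒᵖ D.carrier) = f := add_sub_cancel _ _
  rw [he] at hu
  exact (Module.End.isUnit_iff f).1 hu

/-- A homotopy between minimal differential modules takes values in `D · 𝔪`. -/
theorem IsMinimal.homotopy_mem (hA : A.IsMinimal) (hB : B.IsMinimal)
    (h : A.carrier →ₗ[(Ext k n)ᵐᵒᵖ] B.carrier) (t : A.carrier) :
    B.diff (h t) + h (A.diff t) ∈ B.mulVars Finset.univ :=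
  add_mem (hB ⟨_, rfl⟩) (map_mulVars h _ (hA ⟨_, rfl⟩))

/-- Minimal free resolutions are unique if one of them is a free flag. -/
theorem isIsomorphic_cone {G G' : DiffMod k w} {ε : Hom G D} (hG : G.IsFreeFlag)
    (hmin : G.IsMinimal) (hε : ε.IsQuasiIso) {ε' : Hom G' D} (hε' : ε'.IsMinimalFreeResolution) :
    IsIsomorphic (cone ε') (cone ε) := by
  obtain ⟨⟨hq', P, s, r, p, hP, hp, hrs, hps⟩, hmin'⟩ := hε'
  -- G' is a summand of the flag P, so it inherits lifting up to homotopy by restriction along s.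
  have lift : ∀ {A B : DiffMod k w} (f : Hom A B), f.IsQuasiIso → ∀ g : Hom P B,
      ∃ (φ : Hom G' A) (h : G'.carrier →ₗ[(Ext k n)ᵐᵒᵖ] B.carrier),
      (∀ d t, t ∈ G'.grading d → h t ∈ B.grading (d + (0, 1))) ∧
      ∀ t, (g.comp s).toFun t - f.toFun (φ.toFun t) = B.diff (h t) + h (G'.diff t) := by
    intro A B f hf g
    obtain ⟨φ, h, hd, hh⟩ := hP.exists_lift hf g
    refine ⟨φ.comp s, h ∘ₗ s.toFun, fun d t ht => hd d _ (s.map_mem d t ht), fun t => ?_⟩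
    have := hh (s.toFun t)
    rw [← s.map_diff] at this
    exact this
  obtain ⟨φ, h, hd, hh⟩ := lift ε hε p
  replace hh : ∀ t, ε'.toFun t - ε.toFun (φ.toFun t) = D.diff (h t) + h (G'.diff t) := by
    intro t
    rw [← hh t, ← hps t]
    rfl
  have hφ : φ.IsQuasiIso := Hom.isQuasiIso_of_homotopy hε hq' h hh
  -- ψ is a right inverse of φ, and χ below a right inverse of ψ, up to homotopy. By minimality φψ
  -- and ψχ are the identity modulo 𝔪, hence bijective; so ψ is injective and surjective, and then φ
  -- is bijective too.
  obtain ⟨ψ, h1, -, hh1⟩ := hG.exists_lift hφ (Hom.id G)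
  have hψ : ψ.IsQuasiIso := Hom.isQuasiIso_of_homotopy hφ (Hom.id_isQuasiIso G) h1 hh1
  obtain ⟨χ, h2, -, hh2⟩ := lift ψ hψ r
  have b1 : Function.Bijective (φ.toFun ∘ₗ ψ.toFun) := by
    refine bijective_of_sub_mem _ fun t => ?_
    rw [← neg_sub]
    have e : t - (φ.toFun ∘ₗ ψ.toFun) t = G.diff (h1 t) + h1 (G.diff t) := hh1 t
    rw [e]
    exact neg_mem (hmin.homotopy_mem hmin h1 t)
  have b2 : Function.Bijective (ψ.toFun ∘ₗ χ.toFun) := by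
    refine bijective_of_sub_mem _ fun t => ?_
    rw [← neg_sub]
    have e : t - (ψ.toFun ∘ₗ χ.toFun) t = G'.diff (h2 t) + h2 (G'.diff t) := by
      rw [← hh2 t]
      congr 1
      exact (hrs t).symm
    rw [e]
    exact neg_mem (hmin'.homotopy_mem hmin' h2 t)
  rw [LinearMap.coe_comp] at b1 b2
  have bψ : Function.Bijective ψ.toFun := ⟨b1.1.of_comp, b2.2.of_comp⟩
  have bφ : Function.Bijective φ.toFun := (Function.Bijective.of_comp_iff _ bψ).1 b1
  -- ε' and εφ agree only up to the homotopy h, which appears as the off-diagonal entry of the map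
  -- of cones.
  let u : D.carrier × G'.carrier →ₗ[(Ext k n)ᵐᵒᵖ] D.carrier × G.carrier :=
    (LinearMap.fst _ _ _ + h ∘ₗ LinearMap.snd _ _ _).prod (φ.toFun ∘ₗ LinearMap.snd _ _ _)
  have hu : ∀ x y, u (x, y) = (x + h y, φ.toFun y) := fun _ _ => rfl
  refine isIsomorphic_of_bijective (A := cone ε') (B := cone ε) ⟨u, ?_, ?_⟩ ⟨?_, ?_⟩
  · rintro d ⟨x, y⟩ ⟨hx, hy⟩
    refine ⟨add_mem hx ?_, φ.map_mem _ _ hy⟩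
    have h3 : h y ∈ D.grading (d.1 + 0, d.2 - 1 + 1) := hd _ _ hy
    rwa [add_zero, sub_add_cancel] at h3
  · rintro ⟨x, y⟩
    refine Prod.ext ?_ ?_
    · change D.diff x + ε'.toFun y + h (-G'.diff y) = D.diff (x + h y) + ε.toFun (φ.toFun y)
      rw [eq_add_of_sub_eq (hh y), map_neg, map_add]
      abel
    · change φ.toFun (-G'.diff y) = -G.diff (φ.toFun y)
      rw [map_neg, φ.map_diff]
  · rintro ⟨x, y⟩ ⟨x', y'⟩ hxy
    have e1 : x + h y = x' + h y' := congrArg Prod.fst hxy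
    have e2 : φ.toFun y = φ.toFun y' := congrArg Prod.snd hxy
    have e3 := bφ.1 e2
    subst e3
    exact Prod.ext (add_right_cancel e1) rfl
  · rintro ⟨x, y⟩
    obtain ⟨y', rfl⟩ := bφ.2 y
    exact ⟨(x - h y', y'), Prod.ext (sub_add_cancel _ _) rfl⟩

end DiffMod

/-! ## Vanishing of the limit of the Koszul cohomology in high degrees -/

section Koszul

open MvPolynomial

variable {k : Type u} [Field k] {n : ℕ} {w : Fin (n + 1) → ℕ} {M : Type u} [AddCommGroup M]

section

variable [Module (Cox k n) M]

/-- The sign of `i` in `I`. -/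
def koszulSign (k : Type u) [Field k] {n : ℕ} (I : Finset (Fin (n + 1))) (i : Fin (n + 1)) :
    Cox k n := (-1) ^ (I.filter (· < i)).card

theorem koszulSign_mul_self (I : Finset (Fin (n + 1))) (i : Fin (n + 1)) :
    koszulSign k I i * koszulSign k I i = 1 := by
  rw [koszulSign, ← mul_pow, neg_one_mul, neg_neg, one_pow]

/-- Removing the smaller of two indices moves the larger one down by one place, while removing the
larger leaves the smaller in place. This is the sign behind ∂² = 0. -/
theorem koszulSign_mul_erase {I : Finset (Fin (n + 1))} {i j : Fin (n + 1)} (hi : i ∈ I)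
    (hj : j ∈ I) (hij : i ≠ j) :
    koszulSign k I i * koszulSign k (I.erase i) j
      = -(koszulSign k I j * koszulSign k (I.erase j) i) := by
  wlog h : i < j generalizing i j
  · rw [this hj hi hij.symm (lt_of_le_of_ne (not_lt.1 h) hij.symm), neg_neg]
  have e1 : (I.erase i).filter (· < j) = (I.filter (· < j)).erase i := by
    ext l; simp only [Finset.mem_filter, Finset.mem_erase]; tauto
  have e2 : (I.erase j).filter (· < i) = I.filter (· < i) := by
    ext l
    simp only [Finset.mem_filter, Finset.mem_erase]
    constructor
    · tauto
    · rintro ⟨h1, h2⟩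
      exact ⟨⟨(h2.trans h).ne, h1⟩, h2⟩
  have hm : i ∈ I.filter (· < j) := Finset.mem_filter.2 ⟨hi, h⟩
  have e3 := Finset.card_erase_add_one hm
  rw [koszulSign, koszulSign, koszulSign, koszulSign, e1, e2, ← e3]
  ring

/-- The previous sign rule, rearranged using that signs square to 1. It is the form needed for the
contracting homotopy. -/
theorem koszulSign_mul_koszulSign {I : Finset (Fin (n + 1))} {i j : Fin (n + 1)} (hi : i ∈ I)
    (hj : j ∈ I) (hij : i ≠ j) :
    koszulSign k I i * koszulSign k I j
      = -(koszulSign k (I.erase i) j * koszulSign k (I.erase j) i) := by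
  linear_combination (koszulSign k (I.erase i) j * koszulSign k I j)
    * koszulSign_mul_erase (k := k) hi hj hij
    - koszulSign k I i * koszulSign k I j * koszulSign_mul_self (k := k) (I.erase i) j
    - koszulSign k (I.erase i) j * koszulSign k (I.erase j) i * koszulSign_mul_self (k := k) I j

/-- The differential of the Koszul complex of `x_0 ^ r, …, x_n ^ r`. -/
def koszul (k : Type u) [Field k] {n : ℕ} (M : Type u) [AddCommGroup M] [Module (Cox k n) M]
    (r : ℕ) : (Finset (Fin (n + 1)) → M) →ₗ[Cox k n] (Finset (Fin (n + 1)) → M) :=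
  LinearMap.pi fun I => ∑ i ∈ I, (koszulSign k I i * X i ^ r) • LinearMap.proj (I.erase i)

/-- The transition maps between Koszul complexes. -/
def koszulScale (k : Type u) [Field k] {n : ℕ} (M : Type u) [AddCommGroup M] [Module (Cox k n) M]
    (s : ℕ) : (Finset (Fin (n + 1)) → M) →ₗ[Cox k n] (Finset (Fin (n + 1)) → M) :=
  LinearMap.pi fun I => (∏ i ∈ I, (X i : Cox k n)) ^ s • LinearMap.proj I

/-- The contraction by `i`. -/
def koszulContract (k : Type u) [Field k] {n : ℕ} (M : Type u) [AddCommGroup M]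
    [Module (Cox k n) M] (i : Fin (n + 1)) :
    (Finset (Fin (n + 1)) → M) →ₗ[Cox k n] (Finset (Fin (n + 1)) → M) :=
  LinearMap.pi fun I => if i ∈ I then 0 else
    koszulSign k (insert i I) i • LinearMap.proj (insert i I)

theorem koszul_apply (r : ℕ) (m : Finset (Fin (n + 1)) → M) (I : Finset (Fin (n + 1))) :
    koszul k M r m I = ∑ i ∈ I, (koszulSign k I i * X i ^ r : Cox k n) • m (I.erase i) := by
  simp [koszul]

theorem koszulScale_apply (s : ℕ) (m : Finset (Fin (n + 1)) → M) (I : Finset (Fin (n + 1))) :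
    koszulScale k M s m I = (∏ i ∈ I, (X i : Cox k n)) ^ s • m I := rfl

theorem koszulContract_apply_of_mem {i : Fin (n + 1)} {I : Finset (Fin (n + 1))} (hi : i ∈ I)
    (m : Finset (Fin (n + 1)) → M) : koszulContract k M i m I = 0 := by
  simp [koszulContract, hi]

theorem koszulContract_apply_of_notMem {i : Fin (n + 1)} {I : Finset (Fin (n + 1))} (hi : i ∉ I)
    (m : Finset (Fin (n + 1)) → M) :
    koszulContract k M i m I = koszulSign k (insert i I) i • m (insert i I) := by
  simp [koszulContract, hi]

/-- At level r, the entry m_I stands for the fraction m_I / x_I^r. Scaling by x_I^s rewrites it with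
denominator x_I^(r+s), which does not affect the differential. -/
theorem koszul_scale (r s : ℕ) (m : Finset (Fin (n + 1)) → M) :
    koszul k M (r + s) (koszulScale k M s m) = koszulScale k M s (koszul k M r m) := by
  funext I
  rw [koszulScale_apply, koszul_apply, koszul_apply, Finset.smul_sum]
  refine Finset.sum_congr rfl fun i hi => ?_
  rw [koszulScale_apply, smul_smul, smul_smul, ← Finset.mul_prod_erase I _ hi]
  congr 1
  ring

theorem koszulScale_scale (r s : ℕ) (m : Finset (Fin (n + 1)) → M) :
    koszulScale k M s (koszulScale k M r m) = koszulScale k M (r + s) m := by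
  funext I
  rw [koszulScale_apply, koszulScale_apply, koszulScale_apply, smul_smul, pow_add, mul_comm]

theorem koszulScale_zero (m : Finset (Fin (n + 1)) → M) : koszulScale k M 0 m = m := by
  funext I
  rw [koszulScale_apply, pow_zero, one_smul]

theorem koszul_koszul (r : ℕ) (m : Finset (Fin (n + 1)) → M) :
    koszul k M r (koszul k M r m) = 0 := by
  funext I
  rw [koszul_apply, Pi.zero_apply]
  simp only [koszul_apply, Finset.smul_sum, smul_smul]
  rw [Finset.sum_sigma']
  refine Finset.sum_involution (fun p _ => ⟨p.2, p.1⟩) ?_ ?_ ?_ ?_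
  · rintro ⟨i, j⟩ hp
    simp only [Finset.mem_sigma, Finset.mem_erase] at hp
    have h := koszulSign_mul_erase (k := k) hp.1 hp.2.2 hp.2.1.symm
    dsimp only
    rw [Finset.erase_right_comm, ← add_smul]
    convert zero_smul (Cox k n) _
    linear_combination (X i : Cox k n) ^ r * X j ^ r * h
  · rintro ⟨i, j⟩ hp _ h
    simp only [Finset.mem_sigma, Finset.mem_erase] at hp
    exact hp.2.1 (congrArg Sigma.fst h)
  · rintro ⟨i, j⟩ hp
    simp only [Finset.mem_sigma, Finset.mem_erase] at hp ⊢
    exact ⟨hp.2.2, hp.2.1.symm, hp.1⟩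
  · intros
    rfl

/-- The usual contraction of the Koszul complex: x_i^r acts null-homotopically on the complex of the
r-th powers. If i lies in I, only the term of i survives; otherwise the mixed terms cancel by the
sign rule. -/
theorem koszul_contract (r : ℕ) (i : Fin (n + 1)) (m : Finset (Fin (n + 1)) → M) :
    koszul k M r (koszulContract k M i m) + koszulContract k M i (koszul k M r m)
      = (X i ^ r : Cox k n) • m := by
  funext I
  rw [Pi.add_apply, koszul_apply, Pi.smul_apply]
  by_cases hi : i ∈ I
  · rw [koszulContract_apply_of_mem hi, add_zero, Finset.sum_eq_single i]
    · rw [koszulContract_apply_of_notMem (Finset.notMem_erase i I), Finset.insert_erase hi,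
        smul_smul]
      congr 1
      linear_combination (X i : Cox k n) ^ r * koszulSign_mul_self (k := k) I i
    · intro j _ hj
      rw [koszulContract_apply_of_mem (Finset.mem_erase.2 ⟨hj.symm, hi⟩), smul_zero]
    · exact fun h => (h hi).elim
  · rw [koszulContract_apply_of_notMem hi, koszul_apply, Finset.sum_insert hi, smul_add,
      Finset.erase_insert hi, add_left_comm, Finset.smul_sum, ← Finset.sum_add_distrib,
      Finset.sum_eq_zero, add_zero, smul_smul]
    · congr 1
      linear_combination (X i : Cox k n) ^ r * koszulSign_mul_self (k := k) (insert i I) i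
    · intro j hj
      have hij : i ≠ j := fun h => hi (h ▸ hj)
      have h1 : i ∉ I.erase j := fun h => hi (Finset.mem_of_mem_erase h)
      have h2 : (insert i I).erase j = insert i (I.erase j) :=
        Finset.erase_insert_of_ne hij
      have h := koszulSign_mul_koszulSign (k := k) (Finset.mem_insert_self i I)
        (Finset.mem_insert_of_mem hj) hij
      rw [Finset.erase_insert hi] at h
      rw [koszulContract_apply_of_notMem h1, h2, smul_smul, smul_smul, ← add_smul]
      convert zero_smul (Cox k n) _
      rw [h2] at h
      linear_combination (X j : Cox k n) ^ r * h

end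

variable (w) in
/-- The degree of `x_I`. -/
def weight (I : Finset (Fin (n + 1))) : ℤ := ∑ i ∈ I, (w i : ℤ)

variable [Module k M]

variable (w) in
/-- The Koszul cochains of degree `a` with values in `P`. -/
def koszulCochains (P : ℤ → Submodule k M) (a : ℤ) (r : ℕ) :
    Submodule k (Finset (Fin (n + 1)) → M) :=
  Submodule.pi Set.univ fun I => P (a + r * weight w I)

/-- The shift by r times the degree of x_I is the one for which m_I / x_I^r has degree a. -/
theorem mem_koszulCochains {P : ℤ → Submodule k M} {a : ℤ} {r : ℕ}
    {m : Finset (Fin (n + 1)) → M} :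
    m ∈ koszulCochains w P a r ↔ ∀ I, m I ∈ P (a + r * weight w I) := by
  simp [koszulCochains, Submodule.mem_pi]

theorem koszulCochains_mono {P P' : ℤ → Submodule k M} (h : ∀ a, P a ≤ P' a) (a : ℤ) (r : ℕ) :
    koszulCochains w P a r ≤ koszulCochains w P' a r := fun _ hm =>
  mem_koszulCochains.2 fun I => h _ (mem_koszulCochains.1 hm I)

variable [Module (Cox k n) M]

variable (w) in
/-- A family of subspaces that is closed under multiplication by the variables. -/
def IsStable (P : ℤ → Submodule k M) : Prop :=
  ∀ i a, ∀ m ∈ P a, (X i : Cox k n) • m ∈ P (a + w i)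

theorem sign_smul_mem (P : Submodule k M) (I : Finset (Fin (n + 1))) (i : Fin (n + 1)) {m : M}
    (hm : m ∈ P) : koszulSign k I i • m ∈ P := by
  rcases neg_one_pow_eq_or (Cox k n) (I.filter (· < i)).card with h | h
  · rwa [koszulSign, h, one_smul]
  · rw [koszulSign, h, neg_smul, one_smul]
    exact neg_mem hm

namespace IsStable

variable {P P' : ℤ → Submodule k M}

theorem pow_smul_mem (hP : IsStable w P) (i : Fin (n + 1)) (r : ℕ) {a : ℤ} {m : M} (hm : m ∈ P a) :
    (X i ^ r : Cox k n) • m ∈ P (a + r * w i) := by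
  induction r with
  | zero => simpa using hm
  | succ r ih =>
    have := hP i _ _ ih
    rw [smul_smul, ← pow_succ'] at this
    convert this using 2
    push_cast
    ring

theorem prod_smul_mem (hP : IsStable w P) (I : Finset (Fin (n + 1))) {a : ℤ} {m : M} (hm : m ∈ P a) :
    (∏ i ∈ I, (X i : Cox k n)) • m ∈ P (a + weight w I) := by
  induction I using Finset.induction_on with
  | empty => simpa [weight] using hm
  | insert i I hi ih =>
    have := hP i _ _ ih
    rw [smul_smul, ← Finset.prod_insert hi] at this
    convert this using 2
    rw [weight, weight, Finset.sum_insert hi]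
    ring

theorem prod_pow_smul_mem (hP : IsStable w P) (I : Finset (Fin (n + 1))) (s : ℕ) {a : ℤ}
    {m : M} (hm : m ∈ P a) :
    (∏ i ∈ I, (X i : Cox k n)) ^ s • m ∈ P (a + s * weight w I) := by
  induction s with
  | zero => simpa using hm
  | succ s ih =>
    have := hP.prod_smul_mem I ih
    rw [smul_smul, ← pow_succ'] at this
    convert this using 2
    push_cast
    ring

theorem koszul_mem (hP : IsStable w P) {a : ℤ} {r : ℕ} {m : Finset (Fin (n + 1)) → M}
    (hm : m ∈ koszulCochains w P a r) : koszul k M r m ∈ koszulCochains w P a r := by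
  rw [mem_koszulCochains] at hm ⊢
  intro I
  rw [koszul_apply]
  refine Submodule.sum_mem _ fun i hi => ?_
  rw [mul_smul]
  refine sign_smul_mem _ _ _ ?_
  have := hP.pow_smul_mem i r (hm (I.erase i))
  convert this using 2
  rw [weight, weight, ← Finset.add_sum_erase I _ hi]
  ring

theorem scale_mem (hP : IsStable w P) {a : ℤ} {r : ℕ} (s : ℕ) {m : Finset (Fin (n + 1)) → M}
    (hm : m ∈ koszulCochains w P a r) : koszulScale k M s m ∈ koszulCochains w P a (r + s) := by
  rw [mem_koszulCochains] at hm ⊢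
  intro I
  have := hP.prod_pow_smul_mem I s (hm I)
  rw [koszulScale_apply]
  convert this using 2
  push_cast
  ring

theorem smul_mem (hP : IsStable w P) {a : ℤ} {r : ℕ} (i : Fin (n + 1))
    {m : Finset (Fin (n + 1)) → M}
    (hm : m ∈ koszulCochains w P a r) :
    (X i : Cox k n) • m ∈ koszulCochains w P (a + w i) r := by
  rw [mem_koszulCochains] at hm ⊢
  intro I
  have := hP i _ _ (hm I)
  rw [Pi.smul_apply]
  convert this using 2
  ring

theorem contract_mem {a : ℤ} {r : ℕ} (i : Fin (n + 1)) {m : Finset (Fin (n + 1)) → M}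
    (hm : m ∈ koszulCochains w P a r) :
    koszulContract k M i m ∈ koszulCochains w P (a + r * w i) r := by
  rw [mem_koszulCochains] at hm ⊢
  intro I
  by_cases hi : i ∈ I
  · rw [koszulContract_apply_of_mem hi]
    exact zero_mem _
  · rw [koszulContract_apply_of_notMem hi]
    refine sign_smul_mem _ _ _ ?_
    convert hm (insert i I) using 2
    rw [weight, weight, Finset.sum_insert hi]
    ring

end IsStable
end Koszul

/-! ### Dévissage: high-degree vanishing of limit Koszul cohomology for subquotients P / P' -/

section Vanishing

open MvPolynomial

variable {k : Type u} [Field k] {n : ℕ} {w : Fin (n + 1) → ℕ} {M : Type u} [AddCommGroup M]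
  [Module k M] [Module (Cox k n) M]

variable (w) in
/-- The cochain `m` with values in `P` becomes a coboundary modulo `P'` in the limit. -/
def IsLimCoboundary (P P' : ℤ → Submodule k M) (a : ℤ) (r : ℕ) (m : Finset (Fin (n + 1)) → M) :
    Prop :=
  ∃ s, ∃ b ∈ koszulCochains w P a (r + s),
    koszulScale k M s m - koszul k M (r + s) b ∈ koszulCochains w P' a (r + s)

variable (w) in
/-- The limit of the Koszul cohomology of `P / P'` vanishes in high degrees. -/
def LimVanishes (P P' : ℤ → Submodule k M) : Prop :=
  ∃ N : ℤ, ∀ a, N < a → ∀ r, ∀ m ∈ koszulCochains w P a r,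
    koszul k M r m ∈ koszulCochains w P' a r → IsLimCoboundary w P P' a r m

variable {P P' : ℤ → Submodule k M}

theorem IsLimCoboundary.of_scale {a : ℤ} {r s : ℕ} {m : Finset (Fin (n + 1)) → M}
    (h : IsLimCoboundary w P P' a (r + s) (koszulScale k M s m)) :
    IsLimCoboundary w P P' a r m := by
  obtain ⟨s', b, hb, h⟩ := h
  rw [koszulScale_scale] at h
  rw [add_assoc] at hb h
  exact ⟨s + s', b, hb, h⟩

variable [IsScalarTower k (Cox k n) M]

/-- The elements of `P` that `x_i` multiplies into `P'`. -/
def colonVar (w : Fin (n + 1) → ℕ) (P P' : ℤ → Submodule k M) (i : Fin (n + 1)) (a : ℤ) :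
    Submodule k M :=
  P a ⊓ (P' (a + w i)).comap (Algebra.lsmul k k M (X i : Cox k n))

/-- `P' + x_i P`. -/
def supVar (w : Fin (n + 1) → ℕ) (P P' : ℤ → Submodule k M) (i : Fin (n + 1)) (a : ℤ) :
    Submodule k M :=
  P' a ⊔ (P (a - w i)).map (Algebra.lsmul k k M (X i : Cox k n))

theorem mem_colonVar {i : Fin (n + 1)} {a : ℤ} {m : M} :
    m ∈ colonVar w P P' i a ↔ m ∈ P a ∧ (X i : Cox k n) • m ∈ P' (a + w i) := Iff.rfl

theorem mem_supVar {i : Fin (n + 1)} {a : ℤ} {m : M} : m ∈ supVar w P P' i a ↔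
    ∃ p ∈ P' a, ∃ q ∈ P (a - w i), m = p + (X i : Cox k n) • q := by
  rw [supVar, Submodule.mem_sup]
  constructor
  · rintro ⟨p, hp, _, ⟨q, hq, rfl⟩, rfl⟩
    exact ⟨p, hp, q, hq, rfl⟩
  · rintro ⟨p, hp, q, hq, rfl⟩
    exact ⟨p, hp, _, ⟨q, hq, rfl⟩, rfl⟩

theorem isStable_colonVar (hP : IsStable w P) (hP' : IsStable w P') (i : Fin (n + 1)) :
    IsStable w (colonVar w P P' i) := by
  intro j a m hm
  rw [mem_colonVar] at hm ⊢
  refine ⟨hP j a m hm.1, ?_⟩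
  rw [smul_comm, add_right_comm]
  exact hP' j _ _ hm.2

theorem isStable_supVar (hP : IsStable w P) (hP' : IsStable w P') (i : Fin (n + 1)) :
    IsStable w (supVar w P P' i) := by
  intro j a m hm
  rw [mem_supVar] at hm ⊢
  obtain ⟨p, hp, q, hq, rfl⟩ := hm
  refine ⟨_, hP' j _ _ hp, (X j : Cox k n) • q, ?_, ?_⟩
  · have := hP j _ _ hq
    convert this using 2
    ring
  · rw [smul_add, smul_comm]

/-- Multiplication by `x_i` is injective on the limit of the Koszul cohomology in high degrees. -/
theorem IsLimCoboundary.of_smul (hP : IsStable w P) (hP' : IsStable w P')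
    {i : Fin (n + 1)} {N : ℤ}
    (h1 : ∀ a, N < a → ∀ r, ∀ m ∈ koszulCochains w (colonVar w P P' i) a r,
      koszul k M r m ∈ koszulCochains w P' a r →
        IsLimCoboundary w (colonVar w P P' i) P' a r m)
    (h2 : ∀ a, N < a → ∀ r, ∀ m ∈ koszulCochains w P a r,
      koszul k M r m ∈ koszulCochains w (supVar w P P' i) a r →
        IsLimCoboundary w P (supVar w P P' i) a r m)
    {a : ℤ} (ha : N < a) {r : ℕ} {m : Finset (Fin (n + 1)) → M} (hm : m ∈ koszulCochains w P a r)
    (hdm : koszul k M r m ∈ koszulCochains w P' a r)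
    (hx : IsLimCoboundary w P P' (a + w i) r ((X i : Cox k n) • m)) :
    IsLimCoboundary w P P' a r m := by
  obtain ⟨s, b, hb, hxb⟩ := hx
  refine IsLimCoboundary.of_scale (s := s) ?_
  replace hm := hP.scale_mem s hm
  replace hdm := hP'.scale_mem s hdm
  rw [← koszul_scale] at hdm
  rw [map_smul] at hxb
  -- The statement concerns the limit only, so the stage reached may be renamed to r.
  generalize koszulScale k M s m = m at hm hdm hxb ⊢
  generalize r + s = r at hb hm hdm hxb ⊢
  -- Modulo P' the differential of b is x_i m, so b is a cocycle modulo P' + x_i P and the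
  -- hypothesis `h2` applies to it.
  have hdb : koszul k M r b ∈ koszulCochains w (supVar w P P' i) (a + w i) r := by
    rw [mem_koszulCochains] at hm hxb ⊢
    intro I
    refine mem_supVar.2 ⟨_, neg_mem (hxb I), m I, ?_, ?_⟩
    · convert hm I using 2
      ring
    · simp
  obtain ⟨s, e, he, hbe⟩ := h2 (a + w i) (by omega) r b hb hdb
  rw [mem_koszulCochains] at hbe
  choose p hp b' hb' hbe using fun I => mem_supVar.1 (hbe I)
  have hp : p ∈ koszulCochains w P' (a + w i) (r + s) := mem_koszulCochains.2 hp
  have hb' : b' ∈ koszulCochains w P a (r + s) := by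
    refine mem_koszulCochains.2 fun I => ?_
    convert hb' I using 2
    ring
  have hbe : koszulScale k M s b - koszul k M (r + s) e = p + (X i : Cox k n) • b' := funext hbe
  refine IsLimCoboundary.of_scale (s := s) ?_
  -- Up to scaling, b = p + x_i b' plus a coboundary, with p in P'. Hence c, which is m corrected by
  -- the coboundary of b', is killed by x_i modulo P'. It is a cocycle with values in the colon, and
  -- `h1` makes it a coboundary there.
  set c := koszulScale k M s m - koszul k M (r + s) b' with hc
  have hcP : c ∈ koszulCochains w P a (r + s) := sub_mem (hP.scale_mem s hm) (hP.koszul_mem hb')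
  have hxc : (X i : Cox k n) • c ∈ koszulCochains w P' (a + w i) (r + s) := by
    have e1 : (X i : Cox k n) • c
        = koszulScale k M s ((X i : Cox k n) • m - koszul k M r b) + koszul k M (r + s) p := by
      rw [eq_sub_of_add_eq hbe.symm, map_sub, map_sub, map_sub, koszul_koszul, koszul_scale, hc,
        smul_sub, map_smul, map_smul]
      abel
    rw [e1]
    exact add_mem (hP'.scale_mem s hxb) (hP'.koszul_mem hp)
  have hcK : c ∈ koszulCochains w (colonVar w P P' i) a (r + s) := by
    refine mem_koszulCochains.2 fun I => mem_colonVar.2 ⟨mem_koszulCochains.1 hcP I, ?_⟩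
    have := mem_koszulCochains.1 hxc I
    rw [Pi.smul_apply] at this
    convert this using 2
    ring
  have hdc : koszul k M (r + s) c ∈ koszulCochains w P' a (r + s) := by
    rw [hc, map_sub, koszul_koszul, sub_zero, koszul_scale]
    exact hP'.scale_mem s hdm
  obtain ⟨s', f, hf, hcf⟩ := h1 a ha (r + s) c hcK hdc
  refine ⟨s', koszulScale k M s' b' + f, add_mem (hP.scale_mem s' hb')
    (koszulCochains_mono (fun _ => inf_le_left) _ _ hf), ?_⟩
  rw [hc, map_sub, ← koszul_scale] at hcf
  rwa [map_add, ← sub_sub]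

/-- In high degrees multiplication by x_i is injective on the limit, by the two hypotheses and
`IsLimCoboundary.of_smul`. On the other hand a class represented at level r is killed by x_i^r, so
it is zero. -/
theorem LimVanishes.of_var (hP : IsStable w P) (hP' : IsStable w P')
    {i : Fin (n + 1)} (h1 : LimVanishes w (colonVar w P P' i) P')
    (h2 : LimVanishes w P (supVar w P P' i)) : LimVanishes w P P' := by
  obtain ⟨N₁, h1⟩ := h1
  obtain ⟨N₂, h2⟩ := h2
  have key : ∀ l : ℕ, ∀ a, max N₁ N₂ < a → ∀ r, ∀ m ∈ koszulCochains w P a r,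
      koszul k M r m ∈ koszulCochains w P' a r →
      IsLimCoboundary w P P' (a + l * w i) r ((X i ^ l : Cox k n) • m) →
        IsLimCoboundary w P P' a r m := by
    intro l
    induction l with
    | zero =>
      intro a _ r m _ _ h
      simpa using h
    | succ l ih =>
      intro a ha r m hm hdm h
      refine IsLimCoboundary.of_smul hP hP' (i := i) (N := max N₁ N₂)
        (fun a ha => h1 a ((le_max_left _ _).trans_lt ha))
        (fun a ha => h2 a ((le_max_right _ _).trans_lt ha)) ha hm hdm ?_
      refine ih (a + w i) (by omega) r _ (hP.smul_mem i hm) ?_ ?_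
      · rw [map_smul]
        exact hP'.smul_mem i hdm
      · rw [smul_smul, ← pow_succ]
        convert h using 1
        push_cast
        ring
  -- The number of multiplications by x_i is the level r of the cocycle: its contraction is a
  -- cochain with differential x_i^r m modulo P'.
  refine ⟨max N₁ N₂, fun a ha r m hm hdm => key r a ha r m hm hdm ?_⟩
  refine ⟨0, koszulContract k M i m, IsStable.contract_mem i hm, ?_⟩
  rw [koszulScale_zero, ← koszul_contract, add_zero, add_sub_cancel_left]
  exact IsStable.contract_mem i hdm

variable {A : ℤ → Submodule k M}

/-- A stable family in a noetherian graded module is generated in bounded degrees. -/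
theorem IsStable.exists_generated [IsNoetherian (Cox k n) M] (hA : DirectSum.IsInternal A)
    (hX : IsStable w A) (hP : IsStable w P) (hPA : ∀ a, P a ≤ A a) :
    ∃ N : ℤ, ∀ a, N < a → ∀ m ∈ P a,
      m ∈ ⨆ i, (P (a - w i)).map (Algebra.lsmul k k M (X i : Cox k n)) := by
  -- The submodules generated by the pieces of P in degrees at most N stabilize.
  let U : ℕ →o Submodule (Cox k n) M :=
    ⟨fun N => Submodule.span _ {m | ∃ a : ℤ, a ≤ N ∧ m ∈ P a}, fun N N' h =>
      Submodule.span_mono fun m ⟨a, ha, hm⟩ => ⟨a, ha.trans (by exact_mod_cast h), hm⟩⟩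
  obtain ⟨N, hN⟩ := monotone_stabilizes_iff_noetherian.2 ‹_› U
  refine ⟨N, fun a ha m hm => ?_⟩
  have hmU : m ∈ U N := by
    rw [hN (max N a.toNat) (le_max_left _ _)]
    exact Submodule.subset_span ⟨a, by push_cast; omega, hm⟩
  let Q : ℤ → Submodule k M := fun a =>
    ⨆ i, (P (a - w i)).map (Algebra.lsmul k k M (X i : Cox k n))
  have hQP : ∀ a, Q a ≤ P a := fun a => iSup_le fun i => by
    rintro _ ⟨m, hm, rfl⟩
    have := hP i _ _ hm
    rwa [sub_add_cancel] at this
  -- Elements whose components lie in P, and in ∑ x_i P in degrees above N. Multiplication by a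
  -- variable sends every component into ∑ x_i P, so this is a submodule, and it contains the
  -- generators of U N.
  let V : Submodule (Cox k n) M :=
    { carrier := {z | ∀ a, component hA a z ∈ P a ∧ (N < a → component hA a z ∈ Q a)}
      add_mem' := fun {x y} hx hy a => by
        rw [map_add]
        exact ⟨add_mem (hx a).1 (hy a).1, fun h => add_mem ((hx a).2 h) ((hy a).2 h)⟩
      zero_mem' := fun a => by
        rw [map_zero]
        exact ⟨zero_mem _, fun _ => zero_mem _⟩
      smul_mem' := fun p => by
        induction p using MvPolynomial.induction_on with
        | C c =>
          intro z hz a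
          rw [← MvPolynomial.algebraMap_eq, algebraMap_smul, map_smul]
          exact ⟨Submodule.smul_mem _ _ (hz a).1, fun h => Submodule.smul_mem _ _ ((hz a).2 h)⟩
        | add p q hp hq =>
          intro z hz a
          rw [add_smul, map_add]
          exact ⟨add_mem (hp hz a).1 (hq hz a).1,
            fun h => add_mem ((hp hz a).2 h) ((hq hz a).2 h)⟩
        | mul_X p i hp =>
          intro z hz
          rw [mul_smul]
          refine hp fun a => ?_
          have h := component_map hA hA (Algebra.lsmul k k M (X i : Cox k n)) (fun b => b + w i)
            (add_left_injective _) (hX i) (a - w i) z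
          simp only [sub_add_cancel, Algebra.lsmul_coe] at h
          have hQ : component hA a ((X i : Cox k n) • z) ∈ Q a := by
            rw [h]
            exact Submodule.mem_iSup_of_mem i ⟨_, (hz (a - w i)).1, rfl⟩
          exact ⟨hQP a hQ, fun _ => hQ⟩ }
  have hUV : U N ≤ V := by
    refine Submodule.span_le.2 ?_
    rintro z ⟨b, hb, hz⟩ a
    by_cases hab : a = b
    · subst hab
      rw [component_of_mem hA (hPA a hz)]
      exact ⟨hz, fun h => (not_lt.2 hb h).elim⟩
    · rw [component_of_mem_ne hA hab (hPA b hz)]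
      exact ⟨zero_mem _, fun _ => zero_mem _⟩
  have := (hUV hmU a).2 ha
  rwa [component_of_mem hA (hPA a hm)] at this

/-- Serre vanishing, in terms of Koszul complexes. -/
theorem limVanishes [IsNoetherian (Cox k n) M] (hA : DirectSum.IsInternal A)
    (hX : IsStable w A) (hP : IsStable w P) (hP' : IsStable w P') (hPA : ∀ a, P a ≤ A a)
    (hle : ∀ a, P' a ≤ P a) : LimVanishes w P P' := by
  -- J contains the variables not yet known to annihilate P / P'. All pairs are needed in the
  -- induction, because P and P' are replaced by a colon and a sum.
  suffices ∀ (J : Finset (Fin (n + 1))) (P P' : ℤ → Submodule k M), IsStable w P → IsStable w P' →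
      (∀ a, P a ≤ A a) → (∀ a, P' a ≤ P a) →
      (∀ i, i ∉ J → ∀ a, ∀ m ∈ P a, (X i : Cox k n) • m ∈ P' (a + w i)) → LimVanishes w P P' from
    this Finset.univ P P' hP hP' hPA hle fun i hi => (hi (Finset.mem_univ i)).elim
  intro J
  induction J using Finset.induction_on with
  | empty =>
    intro P P' hP hP' hPA hle hann
    obtain ⟨N, hN⟩ := IsStable.exists_generated hA hX hP hPA
    -- When every variable annihilates P / P', generation of P in bounded degrees gives P_a = ∑ x_i
    -- P_(a - w_i) ⊆ P'_a for large a.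
    have hPP' : ∀ a, N < a → P a ≤ P' a := by
      intro a ha m hm
      refine (iSup_le fun i => ?_ : (⨆ i, (P (a - w i)).map
        (Algebra.lsmul k k M (X i : Cox k n))) ≤ P' a) (hN a ha m hm)
      rintro _ ⟨m, hm, rfl⟩
      have := hann i (Finset.notMem_empty i) _ _ hm
      rwa [sub_add_cancel] at this
    refine ⟨N, fun a ha r m hm _ => ⟨0, 0, zero_mem _, ?_⟩⟩
    rw [map_zero, sub_zero, koszulScale_zero, add_zero]
    rw [mem_koszulCochains] at hm ⊢
    intro I
    refine hPP' _ ?_ (hm I)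
    -- All entries of a cochain of degree a lie in degrees at least a, so one bound serves for every
    -- r and I.
    have : 0 ≤ weight w I := Finset.sum_nonneg fun i _ => by positivity
    have : 0 ≤ r * weight w I := by positivity
    omega
  | insert i J hi ih =>
    intro P P' hP hP' hPA hle hann
    -- Both subquotients, (P' : x_i) / P' and P / (P' + x_i P), are annihilated by x_i as well, so
    -- the induction hypothesis for J applies to them.
    refine LimVanishes.of_var hP hP' (i := i) (ih _ _ (isStable_colonVar hP hP' i) hP'
      (fun a => inf_le_left.trans (hPA a)) ?_ ?_) (ih _ _ hP (isStable_supVar hP hP' i) hPA ?_ ?_)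
    · intro a m hm
      exact mem_colonVar.2 ⟨hle a hm, hP' i a m hm⟩
    · intro j hj a m hm
      rw [mem_colonVar] at hm
      by_cases hji : j = i
      · subst hji
        exact hm.2
      · exact hann j (by simp [hji, hj]) a m hm.1
    · intro a m hm
      obtain ⟨p, hp, q, hq, rfl⟩ := mem_supVar.1 hm
      refine add_mem (hle a hp) ?_
      have := hP i _ _ hq
      rwa [sub_add_cancel] at this
    · intro j hj a m hm
      by_cases hji : j = i
      · subst hji
        exact mem_supVar.2 ⟨0, zero_mem _, m, by rwa [add_sub_cancel_right], by rw [zero_add]⟩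
      · exact mem_supVar.2 ⟨_, hann j (by simp [hji, hj]) a m hm, 0, zero_mem _, by simp⟩

end Vanishing

/-! ### Čech cohomology as a limit of Koszul cohomology; Serre vanishing -/

section Serre

open MvPolynomial

variable {k : Type u} [Field k] {n : ℕ} {w : Fin (n + 1) → ℕ}

theorem GrMod.isStable (M : GrMod k w) : IsStable w M.grading := fun i a m hm =>
  M.smul_mem a (w i) _ m (isWeightedHomogeneous_X k w i) hm

theorem GrMod.chartFn_pow_smul_mem (M : GrMod k w) (I : Chart n) (r : ℕ) {a : ℤ} {m : M.carrier}
    (hm : m ∈ M.grading a) : chartFn k I ^ r • m ∈ M.grading (a + r * weight w I.1) :=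
  M.isStable.prod_pow_smul_mem I.1 r hm

variable {F : CoherentSheaf k w} {M : GrMod k w}

theorem CoherentSheaf.chartFn_pow_bijective (F : CoherentSheaf k w) (I : Chart n) (r : ℕ) :
    Function.Bijective fun z : (F.sec I).carrier => chartFn k I ^ r • z := by
  have := F.isLocalizedModule (le_refl I)
  exact (Module.End.isUnit_iff _).1 (IsLocalizedModule.map_units (F.res (le_refl I))
    (⟨chartFn k I ^ r, r, rfl⟩ : Submonoid.powers (chartFn k I)))

theorem CoherentSheaf.exists_chartFn_pow_smul_eq (F : CoherentSheaf k w) (I : Chart n) (r : ℕ)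
    {a : ℤ} {y : (F.sec I).carrier} (hy : y ∈ (F.sec I).grading (a + r * weight w I.1)) :
    ∃ z ∈ (F.sec I).grading a, chartFn k I ^ r • z = y := by
  obtain ⟨z, hz⟩ := (F.chartFn_pow_bijective I r).2 y
  have h := component_map (F.sec I).isInternal (F.sec I).isInternal
    (Algebra.lsmul k k (F.sec I).carrier (chartFn k I ^ r)) (fun b => b + r * weight w I.1)
    (add_left_injective _) (fun b v hv => (F.sec I).chartFn_pow_smul_mem I r hv) a z
  simp only [Algebra.lsmul_coe] at h hz
  rw [hz, component_of_mem _ hy] at h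
  exact ⟨_, component_mem _ _ _, h.symm⟩

/-- Denominators can be cleared homogeneously: replace any numerator by its component in the
expected degree. -/
theorem SheafIso.exists_toSec_eq (s : SheafIso M F) (I : Chart n) {a : ℤ}
    {y : (F.sec I).carrier} (hy : y ∈ (F.sec I).grading a) :
    ∃ r : ℕ, ∃ m ∈ M.grading (a + r * weight w I.1), s.toSec I m = chartFn k I ^ r • y := by
  have := s.isLocalizedModule I
  obtain ⟨⟨m, ⟨_, r, rfl⟩⟩, hm⟩ := IsLocalizedModule.surj (Submonoid.powers (chartFn k I))
    (s.toSec I) y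
  have hm : chartFn k I ^ r • y = s.toSec I m := hm
  refine ⟨r, _, component_mem M.isInternal _ m, ?_⟩
  have h := component_map M.isInternal (F.sec I).isInternal ((s.toSec I).restrictScalars k) id
    (fun _ _ h => h) (fun b v hv => s.toSec_mem I b v hv) (a + r * weight w I.1) m
  simp only [LinearMap.restrictScalars_apply, id] at h
  rw [← h, ← hm]
  exact component_of_mem _ ((F.sec I).chartFn_pow_smul_mem I r hy)

theorem SheafIso.exists_chartFn_pow_smul_eq_zero (s : SheafIso M F) (I : Chart n) {m : M.carrier}
    (hm : s.toSec I m = 0) : ∃ r : ℕ, chartFn k I ^ r • m = 0 := by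
  have := s.isLocalizedModule I
  obtain ⟨⟨_, r, rfl⟩, h⟩ := (IsLocalizedModule.eq_zero_iff (Submonoid.powers (chartFn k I))
    (s.toSec I)).1 hm
  exact ⟨r, h⟩

theorem CoherentSheaf.cechD_apply (c : F.Cochain) (I : Chart n) :
    F.cechD c I = ∑ i ∈ I.1, if h : (I.1.erase i).Nonempty then
      ((-1 : k) ^ position I i) •
        F.res (I := ⟨I.1.erase i, h⟩) (J := I) (Finset.erase_subset i I.1) (c ⟨I.1.erase i, h⟩)
      else 0 := by
  rw [CoherentSheaf.cechD, LinearMap.pi_apply, LinearMap.sum_apply]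
  refine Finset.sum_congr rfl fun i _ => ?_
  split_ifs <;> rfl

/-- The Koszul differential on numerators induces the Čech differential. -/
theorem SheafIso.toSec_koszul (s : SheafIso M F) (r : ℕ) (m : Finset (Fin (n + 1)) → M.carrier)
    (c : F.Cochain) (I : Chart n)
    (hm : ∀ i ∈ I.1, ∀ h : (I.1.erase i).Nonempty,
      s.toSec ⟨I.1.erase i, h⟩ (m (I.1.erase i)) = chartFn k ⟨I.1.erase i, h⟩ ^ r •
        c ⟨I.1.erase i, h⟩)
    (h0 : ∀ i ∈ I.1, ¬ (I.1.erase i).Nonempty → m (I.1.erase i) = 0) :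
    s.toSec I (koszul k M.carrier r m I.1) = chartFn k I ^ r • F.cechD c I := by
  rw [koszul_apply, CoherentSheaf.cechD_apply, map_sum, Finset.smul_sum]
  refine Finset.sum_congr rfl fun i hi => ?_
  split_ifs with h
  · rw [map_smul, ← s.res_toSec (I := ⟨I.1.erase i, h⟩) (J := I) (Finset.erase_subset i I.1),
      hm i hi h, map_smul, ← algebraMap_smul (Cox k n) ((-1 : k) ^ position I i), smul_smul,
      smul_smul]
    congr 1
    rw [chartFn, chartFn, ← Finset.mul_prod_erase I.1 _ hi, koszulSign, map_pow, map_neg, map_one,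
      position]
    ring
  · rw [h0 i hi h, smul_zero, map_zero, smul_zero]

/-- There are finitely many charts, so a cocycle has numerators over a common power. These satisfy
the cocycle equation only after localization, and a further common power makes it hold in M. -/
theorem SheafIso.exists_koszul_cocycle (s : SheafIso M F) {a p : ℤ} {c : F.Cochain}
    (hc : c ∈ F.cocycles a p) :
    ∃ (r : ℕ) (m : Finset (Fin (n + 1)) → M.carrier), m ∈ koszulCochains w M.grading a r ∧
      koszul k M.carrier r m = 0 ∧ ∀ I : Chart n, s.toSec I (m I.1) = chartFn k I ^ r • c I := by
  choose r m hm hrm using fun I => s.exists_toSec_eq I (hc.1 I).1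
  let R := Finset.univ.sup r
  have hR : ∀ I, r I ≤ R := fun I => Finset.le_sup (Finset.mem_univ I)
  -- The Koszul complex has an extra entry at the empty set, which has no chart; it is the
  -- augmentation by M and is set to 0 here.
  let m' : Finset (Fin (n + 1)) → M.carrier := fun I =>
    if h : I.Nonempty then chartFn k ⟨I, h⟩ ^ (R - r ⟨I, h⟩) • m ⟨I, h⟩ else 0
  have hm' : ∀ I : Chart n, m' I.1 = chartFn k I ^ (R - r I) • m I := fun I => by
    simp only [m', dif_pos I.2]
  have hm'R : m' ∈ koszulCochains w M.grading a R := by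
    refine mem_koszulCochains.2 fun I => ?_
    by_cases h : I.Nonempty
    · rw [hm' ⟨I, h⟩]
      have := M.chartFn_pow_smul_mem ⟨I, h⟩ (R - r ⟨I, h⟩) (hm ⟨I, h⟩)
      convert this using 2
      rw [Nat.cast_sub (hR _)]
      ring
    · simp only [m', dif_neg h]
      exact zero_mem _
  have hsec : ∀ I : Chart n, s.toSec I (m' I.1) = chartFn k I ^ R • c I := by
    intro I
    rw [hm', map_smul, hrm, smul_smul, ← pow_add, Nat.sub_add_cancel (hR I)]
  have hz : ∀ I : Chart n, ∃ t : ℕ, chartFn k I ^ t • koszul k M.carrier R m' I.1 = 0 := by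
    intro I
    refine s.exists_chartFn_pow_smul_eq_zero I ?_
    rw [s.toSec_koszul R m' c I (fun i _ h => hsec ⟨_, h⟩) fun i _ h => by simp only [m', dif_neg h]]
    have : F.cechD c = 0 := hc.2
    rw [this, Pi.zero_apply, smul_zero]
  choose t ht using hz
  let T := Finset.univ.sup t
  refine ⟨R + T, koszulScale k M.carrier T m', M.isStable.scale_mem T hm'R, ?_, fun I => ?_⟩
  · rw [koszul_scale]
    funext I
    by_cases h : I.Nonempty
    · have hT : t ⟨I, h⟩ ≤ T := Finset.le_sup (Finset.mem_univ _)
      rw [koszulScale_apply, ← Nat.sub_add_cancel hT, pow_add, mul_smul, Pi.zero_apply]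
      exact (congrArg _ (ht ⟨I, h⟩)).trans (smul_zero _)
    · rw [Finset.not_nonempty_iff_eq_empty.1 h, koszulScale_apply, koszul_apply, Finset.sum_empty,
        smul_zero, Pi.zero_apply]
  · rw [koszulScale_apply, map_smul, hsec, smul_smul, pow_add, mul_comm]
    rfl

/-- Serre vanishing on the weighted projective stack. -/
theorem SheafIso.exists_bound (s : SheafIso M F) (hM : Module.Finite (Cox k n) M.carrier) :
    ∃ N : ℤ, ∀ a, N < a → (∀ p, p ≠ 0 → ∀ h : F.H a p, h = 0) ∧
      Function.Surjective (s.toH0 a) := by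
  have : IsNoetherian (Cox k n) M.carrier := isNoetherian_of_isNoetherianRing_of_finite _ _
  -- With P' = 0 one bound N works for the whole augmented complex, hence for all p at once and for
  -- the surjectivity of M_a → H^0.
  obtain ⟨N, hN⟩ := limVanishes (w := w) (P := M.grading) (P' := fun _ => ⊥) M.isInternal M.isStable
    M.isStable (fun i a m hm => by
      rw [Submodule.mem_bot] at hm
      rw [hm, smul_zero]
      exact zero_mem _) (fun _ => le_rfl) (fun _ => bot_le)
  have key : ∀ a, N < a → ∀ p, ∀ c ∈ F.cocycles a p, ∃ (r t : ℕ),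
      ∃ b ∈ koszulCochains w M.grading a (r + t), ∀ I : Chart n,
        s.toSec I (koszul k M.carrier (r + t) b I.1) = chartFn k I ^ (r + t) • c I := by
    intro a ha p c hc
    obtain ⟨r, m, hm, hdm, hmc⟩ := s.exists_koszul_cocycle hc
    obtain ⟨t, b, hb, h⟩ := hN a ha r m hm (by rw [hdm]; exact zero_mem _)
    refine ⟨r, t, b, hb, fun I => ?_⟩
    have h1 := mem_koszulCochains.1 h I.1
    rw [Submodule.mem_bot, Pi.sub_apply, sub_eq_zero] at h1
    rw [← h1, koszulScale_apply, map_smul, hmc, smul_smul, pow_add, mul_comm]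
    rfl
  refine ⟨N, fun a ha => ⟨fun p hp h => ?_, fun h => ?_⟩⟩
  · induction h using Submodule.Quotient.induction_on with
    | H c =>
      obtain ⟨c, hc⟩ := c
      obtain ⟨r, t, b, hb, hbc⟩ := key a ha p c hc
      choose e he heb using fun I : Chart n => F.exists_chartFn_pow_smul_eq I (r + t)
        (s.toSec_mem I _ _ (mem_koszulCochains.1 hb I.1))
      -- The bounding cochain is b_I / x_I^(r+t) on the charts with p elements, which are those of
      -- Čech degree p - 1. Because p ≠ 0, the empty entry of b plays no part.
      refine (Submodule.Quotient.mk_eq_zero _).2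
        ⟨fun I => if (I.1.card : ℤ) = p then e I else 0, fun I => ⟨?_, ?_⟩, ?_⟩
      · dsimp only
        split_ifs
        · exact he I
        · exact zero_mem _
      · intro h
        exact if_neg (by omega)
      · funext I
        change F.cechD _ I = c I
        by_cases hI : (I.1.card : ℤ) = p + 1
        · have hcard : ∀ i ∈ I.1, ((I.1.erase i).card : ℤ) = p := by
            intro i hi
            have := Finset.card_erase_add_one hi
            omega
          refine (F.chartFn_pow_bijective I (r + t)).1 ?_
          change chartFn k I ^ (r + t) • _ = chartFn k I ^ (r + t) • _
          rw [← hbc I]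
          refine (s.toSec_koszul (r + t) b _ I (fun i hi h => ?_) fun i hi h => ?_).symm
          · rw [if_pos (hcard i hi), heb]
          · have := hcard i hi
            rw [Finset.not_nonempty_iff_eq_empty.1 h, Finset.card_empty] at this
            exact (hp this.symm).elim
        · rw [(hc.1 I).2 hI, CoherentSheaf.cechD_apply]
          refine Finset.sum_eq_zero fun i hi => ?_
          have := Finset.card_erase_add_one hi
          split_ifs with h1 h2
          · dsimp only at h2
            omega
          · rw [map_zero, smul_zero]
          · rfl
  · induction h using Submodule.Quotient.induction_on with
    | H c =>
      obtain ⟨c, hc⟩ := c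
      obtain ⟨r, t, b, hb, hbc⟩ := key a ha 0 c hc
      -- For p = 0 the preimage is the empty entry of b: at {i} the Koszul differential of b is
      -- x_i^(r+t) b_∅, so c is the restriction of b_∅.
      have hb0 : b ∅ ∈ M.grading a := by simpa [weight] using mem_koszulCochains.1 hb ∅
      refine ⟨⟨b ∅, hb0⟩, ?_⟩
      rw [SheafIso.toH0]
      congr 1
      refine Subtype.ext (funext fun I => ?_)
      change (if I.1.card = 1 then s.toSec I (b ∅) else 0) = c I
      split_ifs with hI
      · obtain ⟨i, hi⟩ := Finset.card_eq_one.1 hI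
        refine (F.chartFn_pow_bijective I (r + t)).1 ?_
        change chartFn k I ^ (r + t) • _ = chartFn k I ^ (r + t) • _
        rw [← hbc I, ← map_smul, koszul_apply, hi, Finset.sum_singleton, Finset.erase_singleton,
          chartFn, hi, Finset.prod_singleton, koszulSign]
        simp [Finset.filter_singleton]
      · exact ((hc.1 I).2 (by omega)).symm

end Serre

/-! ### Coherent sheaves come from finitely generated graded modules without torsion -/

section Generation

open MvPolynomial

variable {k : Type u} [Field k] {n : ℕ} {w : Fin (n + 1) → ℕ}

section Span

variable {V : Type u} [AddCommGroup V] [Module k V] [Module (Cox k n) V]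
  {A : ℤ → Submodule k V}

theorem exists_homogeneous_span (hA : DirectSum.IsInternal A) (T : Finset V) :
    ∃ T' : Finset V, (∀ v ∈ T', ∃ u ∈ T, ∃ a, v = component hA a u) ∧
      ∀ v ∈ T, v ∈ Submodule.span (Cox k n) (T' : Set V) := by
  classical
  refine ⟨T.biUnion fun u => (coaction hA u).support.image fun a => component hA a u, ?_, ?_⟩
  · intro v hv
    obtain ⟨u, hu, hv⟩ := Finset.mem_biUnion.1 hv
    obtain ⟨a, -, rfl⟩ := Finset.mem_image.1 hv
    exact ⟨u, hu, a, rfl⟩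
  · intro v hv
    rw [← sum_coaction hA v, Finsupp.lsum_apply, Finsupp.sum]
    exact Submodule.sum_mem _ fun a ha => Submodule.subset_span
      (Finset.mem_biUnion.2 ⟨v, hv, Finset.mem_image.2 ⟨a, ha, rfl⟩⟩)

variable [IsScalarTower k (Cox k n) V]

/-- Submodules generated by homogeneous elements are homogeneous. -/
theorem component_mem_span (hA : DirectSum.IsInternal A) (hX : IsStable w A) {T : Set V}
    (hT : ∀ v ∈ T, ∃ a, v ∈ A a) {v : V} (hv : v ∈ Submodule.span (Cox k n) T) (a : ℤ) :
    component hA a v ∈ Submodule.span (Cox k n) T := by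
  let P := Submodule.span (Cox k n) T
  -- The elements with all components in P form an S-submodule, since variables only shift
  -- components; it contains the generators of P.
  let Q : Submodule (Cox k n) V :=
    { carrier := {z | ∀ a, component hA a z ∈ P}
      add_mem' := fun {x y} hx hy a => by
        rw [map_add]
        exact add_mem (hx a) (hy a)
      zero_mem' := fun a => by
        rw [map_zero]
        exact zero_mem _
      smul_mem' := fun p => by
        induction p using MvPolynomial.induction_on with
        | C c =>
          intro z hz a
          rw [← MvPolynomial.algebraMap_eq, algebraMap_smul, map_smul,
            ← algebraMap_smul (Cox k n)]
          exact Submodule.smul_mem _ _ (hz a)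
        | add p q hp hq =>
          intro z hz a
          rw [add_smul, map_add]
          exact add_mem (hp hz a) (hq hz a)
        | mul_X p i hp =>
          intro z hz
          rw [mul_smul]
          refine hp fun a => ?_
          have h := component_map hA hA (Algebra.lsmul k k V (X i : Cox k n)) (fun b => b + w i)
            (add_left_injective _) (hX i) (a - w i) z
          simp only [sub_add_cancel, Algebra.lsmul_coe] at h
          rw [h]
          exact Submodule.smul_mem _ _ (hz _) }
  have hPQ : P ≤ Q := by
    refine Submodule.span_le.2 fun z hz b => ?_
    obtain ⟨c, hc⟩ := hT z hz
    by_cases hbc : b = c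
    · subst hbc
      rw [component_of_mem hA hc]
      exact Submodule.subset_span hz
    · rw [component_of_mem_ne hA hbc hc]
      exact zero_mem _
  exact hPQ hv a

/-- A homogeneous submodule of a graded module. -/
def GrMod.ofSubmodule (hA : DirectSum.IsInternal A)
    (hS : ∀ (a : ℤ) (b : ℕ) (p : Cox k n) (m : V), p ∈ weightedHomogeneousSubmodule k w b →
      m ∈ A a → p • m ∈ A (a + b)) (P : Submodule (Cox k n) V)
    (hP : ∀ v ∈ P, ∀ a, component hA a v ∈ P) : GrMod k w where
  carrier := P
  grading a := (A a).comap (P.subtype.restrictScalars k)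
  isInternal := isInternal_comap hA (P.subtype.restrictScalars k) P.injective_subtype
    (Equiv.refl ℤ) fun v a => ⟨⟨_, hP v v.2 a⟩, rfl⟩
  smul_mem a b p m hp hm := hS a b p m hp hm

end Span

namespace CoherentSheaf

variable (F : CoherentSheaf k w)

/-- The grading of the Čech cochains. -/
def cochainGrading (a : ℤ) : Submodule k F.Cochain :=
  Submodule.pi Set.univ fun I => (F.sec I).grading a

theorem mem_cochainGrading {a : ℤ} {c : F.Cochain} :
    c ∈ F.cochainGrading a ↔ ∀ I, c I ∈ (F.sec I).grading a := by
  simp [cochainGrading, Submodule.mem_pi]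

theorem cochainGrading_isInternal : DirectSum.IsInternal F.cochainGrading := by
  refine isInternal_of_coaction
    (∑ I, Finsupp.mapRange.linearMap (LinearMap.single k (fun I => (F.sec I).carrier) I) ∘ₗ
      coaction (F.sec I).isInternal ∘ₗ LinearMap.proj I) ?_ ?_
  · intro a c hc
    rw [mem_cochainGrading] at hc
    rw [LinearMap.sum_apply]
    have : ∀ I, (Finsupp.mapRange.linearMap (LinearMap.single k (fun I => (F.sec I).carrier) I) ∘ₗ
      coaction (F.sec I).isInternal ∘ₗ LinearMap.proj I) c
        = Finsupp.single a (Pi.single I (c I)) := by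
      intro I
      simp [coaction_of_mem _ (hc I)]
    simp only [this]
    rw [← Finsupp.single_finsetSum, Finset.univ_sum_single]
  · rw [eq_top_iff]
    intro c _
    rw [← Finset.univ_sum_single c]
    refine Submodule.sum_mem _ fun I _ => ?_
    refine internal_induction (F.sec I).isInternal
      (P := fun v => (Pi.single I v : F.Cochain) ∈ iSup F.cochainGrading) (c I) ?_ ?_ ?_
    · rw [Pi.single_zero]; exact zero_mem _
    · intro a v hv
      refine Submodule.mem_iSup_of_mem a (F.mem_cochainGrading.2 fun J => ?_)
      by_cases h : J = I
      · subst h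
        rwa [Pi.single_eq_same]
      · rw [Pi.single_eq_of_ne h]
        exact zero_mem _
    · intro v v' hv hv'
      rw [Pi.single_add]
      exact add_mem hv hv'

theorem component_cochain (a : ℤ) (c : F.Cochain) (I : Chart n) :
    component F.cochainGrading_isInternal a c I = component (F.sec I).isInternal a (c I) :=
  (component_map F.cochainGrading_isInternal (F.sec I).isInternal
    (LinearMap.proj (R := k) (φ := fun I => (F.sec I).carrier) I) id (fun _ _ h => h)
    (fun _ _ hv => F.mem_cochainGrading.1 hv I) a c).symm

theorem smul_mem_cochainGrading (a : ℤ) (b : ℕ) (p : Cox k n) (c : F.Cochain)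
    (hp : p ∈ weightedHomogeneousSubmodule k w b) (hc : c ∈ F.cochainGrading a) :
    p • c ∈ F.cochainGrading (a + b) :=
  F.mem_cochainGrading.2 fun I => (F.sec I).smul_mem a b p _ hp (F.mem_cochainGrading.1 hc I)

/-- The global sections of all twists, as compatible families of sections. -/
def globalSections : Submodule (Cox k n) F.Cochain where
  carrier := {c | ∀ I J (h : I ≤ J), F.res h (c I) = c J}
  add_mem' hc hc' I J h := by rw [Pi.add_apply, map_add, hc I J h, hc' I J h, Pi.add_apply]
  zero_mem' I J h := map_zero _
  smul_mem' p c hc I J h := by rw [Pi.smul_apply, map_smul, hc I J h, Pi.smul_apply]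

theorem component_mem_globalSections {c : F.Cochain} (hc : c ∈ F.globalSections) (a : ℤ) :
    component F.cochainGrading_isInternal a c ∈ F.globalSections := by
  intro I J h
  rw [component_cochain, component_cochain, ← hc I J h]
  exact (component_map (F.sec I).isInternal (F.sec J).isInternal ((F.res h).restrictScalars k) id
    (fun _ _ h => h) (fun a s hs => F.res_mem h a s hs) a (c I)).symm

/-- `D(x_{K ∪ I}) = D(x_K) ∩ D(x_I)`. -/
def chartSup (K I : Chart n) : Chart n := ⟨K.1 ∪ I.1, K.2.inl⟩

theorem le_chartSup_left (K I : Chart n) : K ≤ chartSup K I := Finset.subset_union_left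

theorem le_chartSup_right (K I : Chart n) : I ≤ chartSup K I := Finset.subset_union_right

theorem chartFn_dvd {K L : Chart n} (h : K ≤ L) : chartFn k K ∣ chartFn k L :=
  Finset.prod_dvd_prod_of_subset _ _ _ h

theorem chartFn_chartSup_dvd (K I : Chart n) :
    chartFn k (chartSup K I) ∣ chartFn k K * chartFn k I := by
  rw [chartFn, chartFn, chartFn, ← Finset.prod_union_inter]
  exact Dvd.intro _ rfl

theorem smul_injective_of_dvd {L : Chart n} {f : Cox k n} (h : f ∣ chartFn k L) (r : ℕ) :
    Function.Injective fun z : (F.sec L).carrier => f ^ r • z := by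
  obtain ⟨g, hg⟩ := h
  intro x y hxy
  refine (F.chartFn_pow_bijective L r).1 ?_
  change f ^ r • x = f ^ r • y at hxy
  change chartFn k L ^ r • x = chartFn k L ^ r • y
  rw [hg, mul_comm, mul_pow, mul_smul, mul_smul, hxy]

/-- Passing from D(x_K) to D(x_(K ∪ I)) is a localization at x_(K ∪ I), a divisor of x_K x_I. Since
x_K is already invertible, powers of x_I suffice as denominators. -/
theorem exists_res_eq (K I : Chart n) (y : (F.sec (chartSup K I)).carrier) :
    ∃ (r : ℕ) (z : (F.sec K).carrier),
      F.res (le_chartSup_left K I) z = chartFn k I ^ r • y := by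
  have := F.isLocalizedModule (le_chartSup_left K I)
  obtain ⟨⟨t, ⟨_, r, rfl⟩⟩, ht⟩ := IsLocalizedModule.surj
    (Submonoid.powers (chartFn k (chartSup K I))) (F.res (le_chartSup_left K I)) y
  have ht : chartFn k (chartSup K I) ^ r • y = F.res (le_chartSup_left K I) t := ht
  obtain ⟨v, hv⟩ := chartFn_chartSup_dvd (k := k) K I
  obtain ⟨z, hz⟩ := (F.chartFn_pow_bijective K r).2 (v ^ r • t)
  have hz : chartFn k K ^ r • z = v ^ r • t := hz
  refine ⟨r, z, F.smul_injective_of_dvd (chartFn_dvd (le_chartSup_left K I)) r ?_⟩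
  change chartFn k K ^ r • _ = chartFn k K ^ r • _
  rw [← map_smul, hz, map_smul, ← ht, smul_smul, smul_smul, ← mul_pow, ← mul_pow, hv, mul_comm]

/-- As for denominators: a power of x_(K ∪ I) kills z, hence so does a power of x_K x_I, and x_K can
be cancelled. -/
theorem exists_smul_eq_zero (K I : Chart n) (z : (F.sec K).carrier)
    (hz : F.res (le_chartSup_left K I) z = 0) : ∃ r : ℕ, chartFn k I ^ r • z = 0 := by
  have := F.isLocalizedModule (le_chartSup_left K I)
  obtain ⟨⟨_, r, rfl⟩, h⟩ := (IsLocalizedModule.eq_zero_iff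
    (Submonoid.powers (chartFn k (chartSup K I))) (F.res (le_chartSup_left K I))).1 hz
  have h : chartFn k (chartSup K I) ^ r • z = 0 := h
  obtain ⟨v, hv⟩ := chartFn_chartSup_dvd (k := k) K I
  refine ⟨r, F.smul_injective_of_dvd (dvd_refl _) r ?_⟩
  change chartFn k K ^ r • _ = chartFn k K ^ r • (0 : (F.sec K).carrier)
  rw [smul_smul, ← mul_pow, hv, mul_comm, mul_pow, mul_smul, h, smul_zero, smul_zero]

theorem pow_smul_eq_zero_of_le {V : Type*} [AddCommGroup V] [Module (Cox k n) V] {f : Cox k n}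
    {v : V} {r s : ℕ} (h : r ≤ s) (hv : f ^ r • v = 0) : f ^ s • v = 0 := by
  rw [← Nat.sub_add_cancel h, pow_add, mul_smul, hv, smul_zero]

/-- A section over `D(x_I)` extends to a global section after multiplication by a power of
`x_I`. -/
theorem exists_globalSections (I : Chart n) (y : (F.sec I).carrier) :
    ∃ N : ℕ, ∃ c ∈ F.globalSections, c I = chartFn k I ^ N • y := by
  choose r z hz using fun K => F.exists_res_eq K I (F.res (le_chartSup_right K I) y)
  let R := Finset.univ.sup r
  have hR : ∀ K, r K ≤ R := fun K => Finset.le_sup (Finset.mem_univ K)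
  let z' : F.Cochain := fun K => chartFn k I ^ (R - r K) • z K
  -- With a common exponent R, all the local extensions restrict to x_I^R y on the part of their
  -- chart inside D(x_I).
  have hz' : ∀ K, F.res (le_chartSup_left K I) (z' K)
      = chartFn k I ^ R • F.res (le_chartSup_right K I) y := by
    intro K
    rw [map_smul, hz, smul_smul, ← pow_add, Nat.sub_add_cancel (hR K)]
  -- The extensions may disagree outside D(x_I), but the differences vanish on D(x_I) and so are
  -- killed by powers of x_I.
  have h1 : ∀ p : Chart n × Chart n, ∃ t : ℕ, ∀ h : p.1 ≤ p.2,
      chartFn k I ^ t • (F.res h (z' p.1) - z' p.2) = 0 := by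
    rintro ⟨K, L⟩
    by_cases h : K ≤ L
    · obtain ⟨t, ht⟩ := F.exists_smul_eq_zero L I (F.res h (z' K) - z' L) (by
        have hle : chartSup K I ≤ chartSup L I := Finset.union_subset_union_left h
        rw [map_sub, hz', F.res_res, ← F.res_res (le_chartSup_left K I) hle, hz', map_smul,
          F.res_res, sub_self])
      exact ⟨t, fun _ => ht⟩
    · exact ⟨0, fun h' => (h h').elim⟩
  choose t ht using h1
  obtain ⟨t', ht'⟩ := F.exists_smul_eq_zero I I (z' I - chartFn k I ^ R • y) (by
    rw [map_sub, hz', map_smul, sub_self])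
  let T := max t' (Finset.univ.sup t)
  refine ⟨T + R, chartFn k I ^ T • z', fun K L h => ?_, ?_⟩
  · have := pow_smul_eq_zero_of_le ((Finset.le_sup (Finset.mem_univ (K, L))).trans
      (le_max_right t' (Finset.univ.sup t))) (ht (K, L) h)
    rw [smul_sub, sub_eq_zero, ← map_smul] at this
    exact this
  · have := pow_smul_eq_zero_of_le (le_max_left t' (Finset.univ.sup t)) ht'
    rw [smul_sub, sub_eq_zero] at this
    exact this.trans (by rw [smul_smul, ← pow_add])

/-- On the overlap with D(x_I) the section c_K agrees with c_I = 0, so a power of x_I kills it;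
finitely many charts K allow a common power. -/
theorem exists_smul_eq_zero_of_globalSections {c : F.Cochain} (hc : c ∈ F.globalSections)
    {I : Chart n} (hI : c I = 0) : ∃ r : ℕ, chartFn k I ^ r • c = 0 := by
  choose r hr using fun K => F.exists_smul_eq_zero K I (c K) (by
    rw [hc _ _ (le_chartSup_left K I), ← hc _ _ (le_chartSup_right K I), hI, map_zero])
  exact ⟨Finset.univ.sup r, funext fun K =>
    pow_smul_eq_zero_of_le (Finset.le_sup (Finset.mem_univ K)) (hr K)⟩

/-- Every coherent sheaf comes from a finitely generated graded module without torsion. -/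
theorem exists_grMod : ∃ M : GrMod k w, Nonempty (SheafIso M F) ∧
    Module.Finite (Cox k n) M.carrier ∧ M.NoTorsion := by
  classical
  choose t ht using F.finite
  choose N c hc hcN using F.exists_globalSections
  have hA := F.cochainGrading_isInternal
  -- M is generated by the homogeneous components of global extensions of the finitely many
  -- generators over the charts D(x_i).
  obtain ⟨T, hT, hTspan⟩ := exists_homogeneous_span (n := n) hA
    (Finset.univ.biUnion fun i => (t (pt i)).image (c (pt i)))
  have hTgs : Submodule.span (Cox k n) (T : Set F.Cochain) ≤ F.globalSections := by
    refine Submodule.span_le.2 fun v hv => ?_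
    obtain ⟨u, hu, a, rfl⟩ := hT v hv
    obtain ⟨i, -, hu⟩ := Finset.mem_biUnion.1 hu
    obtain ⟨y, -, rfl⟩ := Finset.mem_image.1 hu
    exact F.component_mem_globalSections (hc _ _) a
  have hX : IsStable w F.cochainGrading := fun i a m hm =>
    F.smul_mem_cochainGrading a (w i) _ m (isWeightedHomogeneous_X k w i) hm
  let M : GrMod k w := GrMod.ofSubmodule hA F.smul_mem_cochainGrading
    (Submodule.span (Cox k n) (T : Set F.Cochain)) fun v hv a =>
      component_mem_span hA hX (fun v hv => by
        obtain ⟨u, -, a, rfl⟩ := hT v hv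
        exact ⟨a, component_mem _ _ _⟩) hv a
  have hext : ∀ i, ∀ y ∈ Submodule.span (Cox k n) (t (pt i) : Set (F.sec (pt i)).carrier),
      ∃ (r : ℕ) (m : F.Cochain), m ∈ Submodule.span (Cox k n) (T : Set F.Cochain) ∧
        m (pt i) = chartFn k (pt i) ^ r • y := by
    intro i y hy
    refine Submodule.span_induction (p := fun y _ => ∃ (r : ℕ) (m : F.Cochain),
      m ∈ Submodule.span (Cox k n) (T : Set F.Cochain) ∧ m (pt i) = chartFn k (pt i) ^ r • y)
      ?_ ?_ ?_ ?_ hy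
    · intro y hy
      exact ⟨N (pt i) y, c (pt i) y, hTspan _ (Finset.mem_biUnion.2 ⟨i, Finset.mem_univ i,
        Finset.mem_image_of_mem _ hy⟩), hcN _ _⟩
    · exact ⟨0, 0, zero_mem _, by simp⟩
    · rintro y y' _ _ ⟨r, m, hm, h⟩ ⟨r', m', hm', h'⟩
      refine ⟨r + r', chartFn k (pt i) ^ r' • m + chartFn k (pt i) ^ r • m',
        add_mem (Submodule.smul_mem _ _ hm) (Submodule.smul_mem _ _ hm'), ?_⟩
      rw [Pi.add_apply, Pi.smul_apply, Pi.smul_apply, h, h', smul_smul, smul_smul, ← pow_add,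
        ← pow_add, smul_add, add_comm r' r]
    · rintro p y _ ⟨r, m, hm, h⟩
      exact ⟨r, p • m, Submodule.smul_mem _ _ hm, by rw [Pi.smul_apply, h, smul_comm]⟩
  let toSec : ∀ I : Chart n, Submodule.span (Cox k n) (T : Set F.Cochain) →ₗ[Cox k n]
      (F.sec I).carrier := fun I =>
    LinearMap.proj (R := Cox k n) (φ := fun I => (F.sec I).carrier) I ∘ₗ Submodule.subtype _
  have hloc : ∀ I, IsLocalizedModule (Submonoid.powers (chartFn k I)) (toSec I) := by
    intro I
    have hself := F.isLocalizedModule (le_refl I)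
    refine ⟨fun x => IsLocalizedModule.map_units (F.res (le_refl I)) x, fun y => ?_,
      fun {x y} hxy => ?_⟩
    -- A section over D(x_I) comes, up to a denominator, from D(x_i) for any i in I, where the
    -- chosen generators are available; x_i divides x_I, so powers of x_I absorb all denominators.
    · obtain ⟨i, hi⟩ := I.2
      have hle : pt i ≤ I := Finset.singleton_subset_iff.2 hi
      have := F.isLocalizedModule hle
      obtain ⟨⟨u, ⟨_, r, rfl⟩⟩, hu⟩ := IsLocalizedModule.surj
        (Submonoid.powers (chartFn k I)) (F.res hle) y
      have hu : chartFn k I ^ r • y = F.res hle u := hu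
      obtain ⟨r', hr'⟩ := ht (pt i) u
      obtain ⟨r'', m, hm, hmu⟩ := hext i _ hr'
      obtain ⟨g, hg⟩ := chartFn_dvd (k := k) hle
      refine ⟨⟨⟨g ^ (r'' + r') • m, Submodule.smul_mem _ _ hm⟩,
        ⟨chartFn k I ^ (r'' + r' + r), _, rfl⟩⟩, ?_⟩
      change chartFn k I ^ (r'' + r' + r) • y = g ^ (r'' + r') • m I
      rw [← hTgs hm _ _ hle, hmu, map_smul, map_smul, ← hu, smul_smul, smul_smul, smul_smul]
      congr 1
      rw [pow_add _ (r'' + r'), hg]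
      ring
    · have hxy' : toSec I (x - y) = 0 := by rw [map_sub, hxy, sub_self]
      obtain ⟨r, hr⟩ := F.exists_smul_eq_zero_of_globalSections (hTgs (x - y).2) (I := I) hxy'
      refine ⟨⟨_, r, rfl⟩, ?_⟩
      have : chartFn k I ^ r • (x - y) = 0 := Subtype.ext hr
      rw [smul_sub, sub_eq_zero] at this
      exact this
  refine ⟨M, ⟨⟨toSec, fun I a m hm => F.mem_cochainGrading.1 hm I,
    fun {I J} h m => hTgs m.2 I J h, hloc⟩⟩, ?_, ?_⟩
  · exact Module.Finite.span_of_finite _ T.finite_toSet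
  · rintro ⟨m, hm⟩ ⟨r, hr⟩
    -- x_I^r lies in B^r and is invertible on D(x_I), so an element killed by B^r restricts to 0 on
    -- every chart.
    refine Subtype.ext (funext fun I => (F.chartFn_pow_bijective I r).1 ?_)
    have hI : chartFn k I ∈ irrelevantIdeal k n := by
      obtain ⟨i, hi⟩ := I.2
      exact Ideal.mem_of_dvd _ (Finset.dvd_prod_of_mem _ hi) (Ideal.subset_span ⟨i, rfl⟩)
    have h0 := congrFun (congrArg Subtype.val (hr _ (Ideal.pow_mem_pow hI r))) I
    exact h0.trans (smul_zero _).symm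

end CoherentSheaf
end Generation

namespace DiffMod

variable {k : Type u} [Field k] {n : ℕ} {w : Fin (n + 1) → ℕ} {D T : DiffMod k w}

/-! ## Freeness -/

/-- The top monomial turns each coordinate into its constant term times itself. If the product is 0,
no coordinate has a constant term. -/
theorem IsFree.mem_mulVars (hT : T.IsFree) {t : T.carrier}
    (ht : MulOpposite.op (extTop k n) • t = 0) : t ∈ T.mulVars Finset.univ := by
  obtain ⟨ι, b, -⟩ := hT
  rw [← b.linearCombination_repr t, Finsupp.linearCombination_apply, Finsupp.sum]
  refine Submodule.sum_mem _ fun i _ => ?_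
  have h0 : (extBasis k n).repr (b.repr t i).unop ∅ = 0 := by
    have h := congrArg (fun t => MulOpposite.unop (b.repr t i)) ht
    simp only [map_smul, Finsupp.smul_apply, smul_eq_mul, map_zero, Finsupp.zero_apply,
      MulOpposite.unop_mul, MulOpposite.unop_op, MulOpposite.unop_zero] at h
    rw [mul_extTop] at h
    exact (smul_eq_zero.1 h).resolve_right extTop_ne_zero
  generalize b.repr t i = x at h0
  have hx : x = ∑ J, (extBasis k n).repr x.unop J • MulOpposite.op (extBasis k n J) := by
    apply MulOpposite.unop_injective
    rw [Finset.unop_sum]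
    simp only [MulOpposite.unop_smul, MulOpposite.unop_op]
    exact ((extBasis k n).sum_repr _).symm
  rw [hx, Finset.sum_smul]
  refine Submodule.sum_mem _ fun J _ => ?_
  by_cases hJ : J = ∅
  · rw [hJ, h0, zero_smul, zero_smul]
    exact zero_mem _
  · obtain ⟨j, hj⟩ := Finset.nonempty_iff_ne_empty.2 hJ
    obtain ⟨c, hc⟩ := exists_extBasis_eq (k := k) hj
    rw [hc, MulOpposite.op_mul, smul_assoc, mul_smul]
    refine Submodule.smul_of_tower_mem _ _ (Submodule.smul_mem _ _ ?_)
    exact Submodule.subset_span ⟨j, Finset.mem_univ j, _, rfl⟩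

/-- A submodule that generates `D` modulo `D · 𝔪` is `D`. -/
theorem eq_top_of_sup_mulVars (N : Submodule (Ext k n)ᵐᵒᵖ D.carrier)
    (h : ∀ t, ∃ s ∈ N, t - s ∈ D.mulVars Finset.univ) : N = ⊤ := by
  -- Descending induction along the 𝔪-filtration, from the step n + 2, which is zero, to the step 0,
  -- which is D.
  have key : ∀ l, l ≤ n + 2 → D.radFiltration (n + 2 - l) ≤ N.restrictScalars k := by
    intro l
    induction l with
    | zero =>
      intro _
      refine Submodule.span_le.2 ?_
      rintro _ ⟨y, hy, s, rfl⟩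
      rw [Nat.sub_zero, extFiltration_eq_bot, Submodule.mem_bot] at hy
      rw [hy, MulOpposite.op_zero, zero_smul]
      exact zero_mem _
    | succ l ih =>
      intro hl
      refine Submodule.span_le.2 ?_
      rintro _ ⟨y, hy, t, rfl⟩
      obtain ⟨s, hs, hts⟩ := h t
      have h1 := ih (by omega) (by
        have := smul_mem_radFiltration hy hts
        rwa [show n + 2 - (l + 1) + 1 = n + 2 - l by omega] at this)
      rw [← sub_add_cancel t s, smul_add]
      exact N.add_mem h1 (N.smul_mem _ hs)
  rw [eq_top_iff]
  intro t _
  have := key (n + 2) le_rfl (Submodule.subset_span ⟨1, by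
    rw [Nat.sub_self]; exact mem_extFiltration_zero _, t, rfl⟩)
  rwa [MulOpposite.op_one, one_smul] at this

/-- Given a relation among the c_i, multiplying by the monomial complementary to J isolates the
coefficients at e_J in front of the top monomial, once those at proper subsets of J are known to
vanish. -/
theorem linearIndependent_of_extTop {ι : Type*} (c : ι → D.carrier)
    (hc : LinearIndependent k fun i => MulOpposite.op (extTop k n) • c i) :
    LinearIndependent (Ext k n)ᵐᵒᵖ c := by
  rw [linearIndependent_iff'] at hc ⊢
  intro s g hg
  have key : ∀ J : Finset (Fin (n + 1)), ∀ i ∈ s, (extBasis k n).repr (g i).unop J = 0 := by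
    intro J
    induction J using Finset.strongInduction with
    | H J ih =>
      obtain ⟨c0, hc0⟩ := extBasis_mul_of_disjoint (k := k) (disjoint_compl_right (a := J))
      have hmul : ∀ i ∈ s, (g i).unop * extBasis k n Jᶜ
          = ((c0 : ℤ) * (extBasis k n).repr (g i).unop J : k) • extTop k n := by
        intro i hi
        conv_lhs => rw [← (extBasis k n).sum_repr (g i).unop, Finset.sum_mul]
        rw [Finset.sum_eq_single J]
        · rw [smul_mul_assoc, hc0, Finset.union_compl, mul_comm, mul_smul, Units.smul_def,
            ← Int.cast_smul_eq_zsmul k]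
          rfl
        · intro I _ hIJ
          -- Proper subsets of J are covered by induction; any other I meets the complement of J,
          -- and the product is 0.
          by_cases hI : I ⊆ J
          · rw [ih I (lt_of_le_of_ne hI hIJ) i hi, zero_smul, zero_mul]
          · rw [smul_mul_assoc, extBasis_mul_of_not_disjoint (fun h => hI
              (disjoint_compl_right_iff.1 h)), smul_zero]
        · simp
      have h1 : ∑ i ∈ s, ((c0 : ℤ) * (extBasis k n).repr (g i).unop J : k) •
          (MulOpposite.op (extTop k n) • c i) = 0 := by
        have hg' := congrArg (MulOpposite.op (extBasis k n Jᶜ) • ·) hg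
        simp only [smul_zero, Finset.smul_sum] at hg'
        rw [← hg']
        refine Finset.sum_congr rfl fun i hi => ?_
        rw [← mul_smul, ← MulOpposite.op_unop (g i), ← MulOpposite.op_mul, hmul i hi,
          MulOpposite.op_smul, smul_assoc, MulOpposite.op_unop]
      intro i hi
      have h2 := hc s _ h1 i hi
      refine (mul_eq_zero.1 h2).resolve_left ?_
      rcases Int.units_eq_one_or c0 with h | h <;> simp [h]
  intro i hi
  apply MulOpposite.unop_injective
  rw [MulOpposite.unop_zero]
  exact (extBasis k n).ext_elem fun J => by rw [key J i hi, map_zero, Finsupp.zero_apply]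

/-- A graded module on which the kernel of the socle generator of `E` is `D · 𝔪` is free. -/
theorem exists_homogeneous_basis
    (h : ∀ t : D.carrier, MulOpposite.op (extTop k n) • t = 0 → t ∈ D.mulVars Finset.univ) :
    ∃ (ι : Type u) (b : Module.Basis ι (Ext k n)ᵐᵒᵖ D.carrier) (deg : ι → ℤ × ℤ),
      ∀ i, b i ∈ D.grading (deg i) := by
  let top : D.carrier →ₗ[k] D.carrier := Algebra.lsmul k k D.carrier
    (MulOpposite.op (extTop k n))
  have htop : ∀ t, top t = MulOpposite.op (extTop k n) • t := fun _ => rfl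
  -- A k-basis of D · e_0 ⋯ e_n is chosen among the images of homogeneous elements; their preimages
  -- form the E-basis.
  let S : Set D.carrier := {x | ∃ d, ∃ t ∈ D.grading d, top t = x}
  obtain ⟨B, hBS, hspan, hind⟩ := exists_linearIndependent k S
  choose deg c hc hcB using fun x : B => hBS x.2
  have hli : LinearIndependent (Ext k n)ᵐᵒᵖ c := by
    refine linearIndependent_of_extTop c ?_
    have : (fun i => MulOpposite.op (extTop k n) • c i) = ((↑) : B → D.carrier) := funext hcB
    rw [this]
    exact hind
  have hsp : Submodule.span (Ext k n)ᵐᵒᵖ (Set.range c) = ⊤ := by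
    refine eq_top_of_sup_mulVars _ fun t => ?_
    have ht : top t ∈ Submodule.span k S := by
      refine internal_induction D.isInternal (P := fun t => top t ∈ Submodule.span k S) t ?_ ?_ ?_
      · rw [map_zero]; exact zero_mem _
      · exact fun d t ht => Submodule.subset_span ⟨d, t, ht, rfl⟩
      · intro t t' ht ht'
        rw [map_add]
        exact add_mem ht ht'
    rw [← hspan] at ht
    have : ∃ s ∈ Submodule.span (Ext k n)ᵐᵒᵖ (Set.range c), top s = top t := by
      refine Submodule.span_induction
        (p := fun x _ => ∃ s ∈ Submodule.span (Ext k n)ᵐᵒᵖ (Set.range c), top s = x) ?_ ?_ ?_ ?_ ht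
      · intro x hx
        exact ⟨c ⟨x, hx⟩, Submodule.subset_span ⟨_, rfl⟩, hcB ⟨x, hx⟩⟩
      · exact ⟨0, zero_mem _, map_zero _⟩
      · rintro x y _ _ ⟨s, hs, rfl⟩ ⟨s', hs', rfl⟩
        exact ⟨s + s', add_mem hs hs', map_add _ _ _⟩
      · rintro a x _ ⟨s, hs, rfl⟩
        exact ⟨a • s, Submodule.smul_of_tower_mem _ _ hs, map_smul _ _ _⟩
    obtain ⟨s, hs, hst⟩ := this
    exact ⟨s, hs, h _ (by rw [← htop, map_sub, hst, sub_self])⟩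
  refine ⟨B, Module.Basis.mk hli hsp.ge, deg, fun i => ?_⟩
  rw [Module.Basis.mk_apply]
  exact hc i

/-! ## Free flags -/

section Flag

variable {ι : Type*} {b : Module.Basis ι (Ext k n)ᵐᵒᵖ D.carrier} {deg : ι → ℤ × ℤ}

/-- Multiplication by monomials never raises the first degree, so a component of first degree d.1
involves only generators of at least that degree. -/
theorem component_mem_span_basis (hb : ∀ i, b i ∈ D.grading (deg i)) (d : ℤ × ℤ) (t : D.carrier) :
    component D.isInternal d t ∈
      Submodule.span (Ext k n)ᵐᵒᵖ (b '' {i | d.1 ≤ (deg i).1}) := by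
  have ht : t ∈ Submodule.span k (Set.range (monBasis b)) := by
    rw [(monBasis b).span_eq]; trivial
  refine Submodule.span_induction (p := fun t _ => component D.isInternal d t ∈
      Submodule.span (Ext k n)ᵐᵒᵖ (b '' {i | d.1 ≤ (deg i).1})) ?_ ?_ ?_ ?_ ht
  · rintro _ ⟨⟨J, i⟩, rfl⟩
    have h1 := monBasis_mem hb J i
    by_cases hd : d = deg i + monDeg w J
    · subst hd
      rw [component_of_mem _ h1, monBasis_apply]
      refine Submodule.smul_mem _ _ (Submodule.subset_span ⟨i, ?_, rfl⟩)
      have : 0 ≤ ∑ i ∈ J, (w i : ℤ) := Finset.sum_nonneg fun i _ => by positivity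
      simp [monDeg, this]
    · rw [component_of_mem_ne _ hd h1]
      exact zero_mem _
  · rw [map_zero]; exact zero_mem _
  · intro x y _ _ hx hy
    rw [map_add]
    exact add_mem hx hy
  · intro a x _ hx
    rw [map_smul]
    exact Submodule.smul_of_tower_mem _ _ hx

/-- An element of D · 𝔪 involves only nonempty monomials, which lower the first degree strictly
because the weights are positive. -/
theorem component_mem_span_basis_of_mem_mulVars (hw : ∀ i, 0 < w i)
    (hb : ∀ i, b i ∈ D.grading (deg i)) (d : ℤ × ℤ) {t : D.carrier}
    (ht : t ∈ D.mulVars Finset.univ) :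
    component D.isInternal d t ∈
      Submodule.span (Ext k n)ᵐᵒᵖ (b '' {i | d.1 < (deg i).1}) := by
  let S := (Submodule.span (Ext k n)ᵐᵒᵖ (b '' {i | d.1 < (deg i).1})).restrictScalars k
  suffices D.radFiltration 1 ≤ S.comap (component D.isInternal d) from
    this (mulVars_le_radFiltration ht)
  refine Submodule.span_le.2 ?_
  rintro _ ⟨y, hy, s, rfl⟩
  refine Submodule.span_induction
    (p := fun y _ => component D.isInternal d (MulOpposite.op y • s) ∈ S) ?_ ?_ ?_ ?_ hy
  · rintro _ ⟨J, hJ, rfl⟩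
    have h := component_map D.isInternal D.isInternal
      (Algebra.lsmul k k D.carrier (MulOpposite.op (extBasis k n J))) (fun d => d + monDeg w J)
      (add_left_injective _) (fun d t ht => D.smul_mem d _ _ t (extBasis_mem w J) ht)
      (d - monDeg w J) s
    simp only [sub_add_cancel, Algebra.lsmul_coe] at h
    rw [h]
    refine Submodule.smul_mem (Submodule.span (Ext k n)ᵐᵒᵖ (b '' {i | d.1 < (deg i).1})) _ ?_
    refine Submodule.span_mono (Set.image_mono ?_) (component_mem_span_basis hb _ s)
    intro i hi
    have : 0 < ∑ i ∈ J, (w i : ℤ) :=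
      Finset.sum_pos (fun i _ => by exact_mod_cast hw i) (Finset.card_pos.1 hJ)
    simp only [Set.mem_ofPred_eq, monDeg, Prod.fst_sub] at hi ⊢
    omega
  · rw [MulOpposite.op_zero, zero_smul, map_zero]; exact zero_mem _
  · intro x y _ _ hx hy
    rw [MulOpposite.op_add, add_smul, map_add]
    exact add_mem hx hy
  · intro a x _ hx
    rw [MulOpposite.op_smul, smul_assoc, map_smul]
    exact Submodule.smul_mem _ _ hx

/-- Minimal free differential modules whose generators have bounded degree are free flags. -/
theorem IsMinimal.isFreeFlag {ι : Type u} {b : Module.Basis ι (Ext k n)ᵐᵒᵖ D.carrier}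
    {deg : ι → ℤ × ℤ} (hw : ∀ i, 0 < w i) (hD : D.IsMinimal)
    (hb : ∀ i, b i ∈ D.grading (deg i)) (N : ℤ) (hN : ∀ i, (deg i).1 ≤ N) : D.IsFreeFlag := by
  -- The differential keeps the first degree and lands in D · 𝔪, so it leads to generators of
  -- strictly larger first degree. The bound N turns this into strictly smaller natural numbers.
  refine ⟨ι, b, fun i => (N - (deg i).1).toNat, fun i => ⟨_, hb i⟩, fun i => ?_⟩
  have h := component_mem_span_basis_of_mem_mulVars hw hb ((deg i).1, (deg i).2 - 1)
    (hD ⟨b i, rfl⟩)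
  rw [component_of_mem _ (D.diff_mem _ _ _ (hb i))] at h
  refine Submodule.span_mono (Set.image_mono ?_) h
  intro i' hi'
  have := hN i'
  simp only [Set.mem_ofPred_eq] at hi' ⊢
  omega

end Flag

/-! ## Complements of direct summands -/

section Complement

variable (f : Hom D T) (ρ : T.carrier →ₗ[(Ext k n)ᵐᵒᵖ] D.carrier)
  (hρ : ∀ d t, t ∈ T.grading d → ρ t ∈ D.grading d) (hf : ∀ z, ρ (f.toFun z) = z)

/-- The projection onto the kernel of a retraction. -/
def complementProj : T.carrier →ₗ[(Ext k n)ᵐᵒᵖ] LinearMap.ker ρ :=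
  LinearMap.codRestrict _ (LinearMap.id - f.toFun ∘ₗ ρ) fun t => by
    simp [hf]

theorem complementProj_coe (t : T.carrier) :
    (complementProj f ρ hf t : T.carrier) = t - f.toFun (ρ t) := rfl

theorem complementProj_of_mem (t : LinearMap.ker ρ) : complementProj f ρ hf t = t := by
  refine Subtype.ext ?_
  rw [complementProj_coe, LinearMap.mem_ker.1 t.2, map_zero, sub_zero]

/-- The differential module `C(0; 1)`, where `T = D ⊕ C` as graded modules. -/
def complement : DiffMod k w where
  carrier := LinearMap.ker ρ
  grading d := (T.grading (d.1, d.2 + 1)).comap ((LinearMap.ker ρ).subtype.restrictScalars k)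
  isInternal := isInternal_comap T.isInternal ((LinearMap.ker ρ).subtype.restrictScalars k)
    (LinearMap.ker ρ).injective_subtype ((Equiv.refl ℤ).prodCongr (Equiv.addRight 1)) fun v d => by
      refine ⟨⟨component T.isInternal d v, ?_⟩, rfl⟩
      have := component_map T.isInternal D.isInternal (ρ.restrictScalars k) id (fun _ _ h => h)
        hρ d v
      rw [LinearMap.mem_ker]
      refine this.symm.trans ?_
      have h0 : (ρ.restrictScalars k) (v : T.carrier) = 0 := v.2
      rw [h0, map_zero]
  smul_mem d d' x t hx ht := by
    have h : MulOpposite.op x • (t : T.carrier) ∈ T.grading _ := T.smul_mem _ d' x _ hx ht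
    have e : ((d.1, d.2 + 1) + d' : ℤ × ℤ) = ((d + d').1, (d + d').2 + 1) := by
      ext
      · rfl
      · simp only [Prod.snd_add]; ring
    rwa [e] at h
  -- The sign is the one that a cone puts on its second summand.
  diff := -(complementProj f ρ hf ∘ₗ T.diff ∘ₗ (LinearMap.ker ρ).subtype)
  diff_mem a j t ht := by
    have h1 : T.diff (t : T.carrier) ∈ T.grading (a, j - 1 + 1) := by
      have := T.diff_mem a (j + 1) t ht
      rwa [add_sub_right_comm] at this
    exact neg_mem (sub_mem h1 (f.map_mem _ _ (hρ _ _ h1)))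
  diff_diff t := by
    refine Subtype.ext ?_
    simp only [LinearMap.neg_apply, LinearMap.comp_apply, map_neg, neg_neg, Submodule.subtype_apply]
    rw [complementProj_coe, complementProj_coe, map_sub, T.diff_diff, ← f.map_diff]
    simp [hf]

/-- The inclusion of the complement. -/
def complementIncl : (complement f ρ hρ hf).carrier →ₗ[(Ext k n)ᵐᵒᵖ] T.carrier :=
  (LinearMap.ker ρ).subtype

theorem retraction_complementIncl (t : (complement f ρ hρ hf).carrier) :
    ρ (complementIncl f ρ hρ hf t) = 0 := 
  LinearMap.mem_ker.1 (Subtype.prop (p := (· ∈ LinearMap.ker ρ)) t)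

theorem complementIncl_injective : Function.Injective (complementIncl f ρ hρ hf) :=
  Subtype.val_injective

theorem complementIncl_mem {d : ℤ × ℤ} {t : (complement f ρ hρ hf).carrier}
    (ht : t ∈ (complement f ρ hρ hf).grading d) :
    complementIncl f ρ hρ hf t ∈ T.grading (d.1, d.2 + 1) := ht

theorem complementIncl_diff (t : (complement f ρ hρ hf).carrier) :
    complementIncl f ρ hρ hf ((complement f ρ hρ hf).diff t) =
      f.toFun (ρ (T.diff (complementIncl f ρ hρ hf t))) - T.diff (complementIncl f ρ hρ hf t) :=
  neg_sub _ _

/-- The component `C(0; 1) → D` of the differential of `T`. -/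
def complementHom : Hom (complement f ρ hρ hf) D where
  toFun := ρ ∘ₗ T.diff ∘ₗ complementIncl f ρ hρ hf
  map_mem d t ht := by
    have := hρ _ _ (T.diff_mem _ _ _ ht)
    rwa [add_sub_cancel_right] at this
  map_diff t := by
    simp only [LinearMap.comp_apply]
    rw [complementIncl_diff, map_sub, T.diff_diff, ← f.map_diff, sub_zero, hf]

/-- `T` is the cone of `C(0; 1) → D`. -/
def coneComplementHom : Hom (cone (complementHom f ρ hρ hf)) T where
  toFun := f.toFun ∘ₗ LinearMap.fst _ D.carrier (complement f ρ hρ hf).carrier +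
    complementIncl f ρ hρ hf ∘ₗ LinearMap.snd _ D.carrier (complement f ρ hρ hf).carrier
  map_mem d t ht := by
    have h2 := complementIncl_mem f ρ hρ hf ht.2
    rw [sub_add_cancel] at h2
    exact add_mem (f.map_mem _ _ ht.1) h2
  map_diff t := by
    obtain ⟨x, c⟩ := t
    change f.toFun (D.diff x + ρ (T.diff (complementIncl f ρ hρ hf c))) +
      complementIncl f ρ hρ hf (-(complement f ρ hρ hf).diff c)
      = T.diff (f.toFun x + complementIncl f ρ hρ hf c)
    rw [map_neg, complementIncl_diff, map_add, map_add, f.map_diff]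
    abel

theorem coneComplementHom_bijective : Function.Bijective (coneComplementHom f ρ hρ hf).toFun := by
  constructor
  · rintro ⟨x, c⟩ ⟨x', c'⟩ h
    have h' : f.toFun x + complementIncl f ρ hρ hf c
      = f.toFun x' + complementIncl f ρ hρ hf c' := h
    have hx := congrArg ρ h'
    rw [map_add, map_add, hf, hf, retraction_complementIncl, retraction_complementIncl, add_zero,
      add_zero] at hx
    subst hx
    exact Prod.ext rfl (complementIncl_injective f ρ hρ hf (add_left_cancel h'))
  · intro t
    exact ⟨(ρ t, complementProj f ρ hf t), add_sub_cancel _ _⟩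

theorem exact_of_bijective {A B : DiffMod k w} (g : Hom A B) (hg : Function.Bijective g.toFun)
    (hB : Function.Exact B.diff B.diff) : Function.Exact A.diff A.diff := by
  intro t
  constructor
  · intro ht
    obtain ⟨z, hz⟩ := (hB (g.toFun t)).1 (by rw [← g.map_diff, ht, map_zero])
    obtain ⟨y, rfl⟩ := hg.2 z
    exact ⟨y, hg.1 (by rw [g.map_diff, hz])⟩
  · rintro ⟨s, rfl⟩
    exact A.diff_diff s

theorem complementHom_isQuasiIso (hT : Function.Exact T.diff T.diff) :
    (complementHom f ρ hρ hf).IsQuasiIso :=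
  (Hom.isQuasiIso_iff_cone_exact _).2
    (exact_of_bijective _ (coneComplementHom_bijective f ρ hρ hf) hT)

theorem complementProj_mem_mulVars {t : T.carrier} (ht : t ∈ T.mulVars Finset.univ) :
    (complementProj f ρ hf t : (complement f ρ hρ hf).carrier) ∈
      (complement f ρ hρ hf).mulVars Finset.univ :=
  map_mulVars (B := complement f ρ hρ hf) (complementProj f ρ hf) _ ht

theorem complement_isMinimal (hT : T.IsMinimal) : (complement f ρ hρ hf).IsMinimal := by
  rintro _ ⟨t, rfl⟩
  exact neg_mem (complementProj_mem_mulVars f ρ hρ hf (hT ⟨_, rfl⟩))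

/-- The freeness criterion passes to graded summands: an element killed by the top monomial lies in
T · 𝔪, and the projection carries T · 𝔪 into the complement times 𝔪. -/
theorem complement_exists_basis (hT : T.IsFree) :
    ∃ (ι : Type u) (b : Module.Basis ι (Ext k n)ᵐᵒᵖ (complement f ρ hρ hf).carrier)
      (deg : ι → ℤ × ℤ), ∀ i, b i ∈ (complement f ρ hρ hf).grading (deg i) := by
  refine exists_homogeneous_basis fun t ht => ?_
  have h1 := complementProj_mem_mulVars f ρ hρ hf (t := complementIncl f ρ hρ hf t)
    (hT.mem_mulVars (by rw [← map_smul, ht, map_zero]))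
  have h2 : (complementProj f ρ hf (complementIncl f ρ hρ hf t) : (complement f ρ hρ hf).carrier)
      = t := complementProj_of_mem f ρ hf t
  rwa [h2] at h1

end Complement

end DiffMod

/-! ## Embeddings of `R(M)` split -/

section Retraction

variable {k : Type u} [Field k] {n : ℕ} {w : Fin (n + 1) → ℕ} {M : GrMod k w}

/-- The dual basis of `ω_E`. -/
def omegaDual (k : Type u) [Field k] (n : ℕ) (J : Finset (Fin (n + 1))) : Omega k n :=
  Omega.toDual.symm ((extBasis k n).coord J)

theorem omegaDual_mem (w : Fin (n + 1) → ℕ) (J : Finset (Fin (n + 1))) :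
    omegaDual k n J ∈ omegaGrading k w (-monDeg w J) := by
  intro d hd x hx
  refine Submodule.span_induction ?_ ?_ ?_ ?_ hx
  · rintro _ ⟨I, rfl, rfl⟩
    have : I ≠ J := by rintro rfl; simp at hd
    simp [omegaDual, this]
  · simp
  · intro x y _ _ h1 h2
    rw [map_add, h1, h2, add_zero]
  · intro c x _ h
    rw [map_smul, h, smul_zero]

theorem sum_omegaDual (f : Omega k n) :
    ∑ J, f.toDual (extBasis k n J) • omegaDual k n J = f := by
  apply Omega.toDual.injective
  rw [map_sum]
  refine (extBasis k n).ext fun I => ?_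
  simp [omegaDual]

theorem rrTmul_sum {ι : Type*} (s : Finset ι) (m : M.carrier) (f : ι → Omega k n) :
    rrTmul m (∑ i ∈ s, f i) = ∑ i ∈ s, rrTmul m (f i) := TensorProduct.tmul_sum _ _ _

theorem sum_rrTmul {ι : Type*} (s : Finset ι) (m : ι → M.carrier) (f : Omega k n) :
    rrTmul (∑ i ∈ s, m i) f = ∑ i ∈ s, rrTmul (m i) f := TensorProduct.sum_tmul _ _ _

theorem rrTmul_smul (c : k) (m : M.carrier) (f : Omega k n) :
    rrTmul (c • m) f = rrTmul m (c • f) := TensorProduct.smul_tmul _ _ _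

theorem rrTmul_add_left (m m' : M.carrier) (f : Omega k n) :
    rrTmul (m + m') f = rrTmul m f + rrTmul m' f := TensorProduct.add_tmul _ _ _

/-- Evaluation at `1 ∈ E`. -/
def rrEval (M : GrMod k w) : RRCarrier M →ₗ[k] M.carrier :=
  (TensorProduct.rid k M.carrier).toLinearMap ∘ₗ LinearMap.lTensor M.carrier
    ((LinearMap.applyₗ (1 : Ext k n) : Module.Dual k (Ext k n) →ₗ[k] k) ∘ₗ Omega.toDual.toLinearMap)

theorem rrEval_rrTmul (m : M.carrier) (f : Omega k n) :
    rrEval M (rrTmul m f) = f.toDual 1 • m := TensorProduct.rid_tmul _ _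

/-- A homogeneous functional is nonzero at 1 only if it has degree 0. The conditional expresses in
one equation that evaluation kills nonzero auxiliary degrees and preserves the first degree. -/
theorem rrEval_mem {d : ℤ × ℤ} {z : RRCarrier M} (hz : z ∈ rrGrading M d) :
    (if d.2 = 0 then component M.isInternal d.1 (rrEval M z) else 0) = rrEval M z := by
  refine Submodule.span_induction (p := fun z _ =>
    (if d.2 = 0 then component M.isInternal d.1 (rrEval M z) else 0) = rrEval M z) ?_ ?_ ?_ ?_ hz
  · rintro _ ⟨b, m, f, hm, hf, rfl⟩
    rw [rrEval_rrTmul]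
    by_cases h : (d.1 - b, d.2) = 0
    · rw [Prod.mk_eq_zero, sub_eq_zero] at h
      rw [if_pos h.2, h.1, map_smul, component_of_mem _ hm]
    · have h1 : (1 : Ext k n) ∈ extGrading k w 0 :=
        Submodule.subset_span ⟨∅, by simp [monDeg], extBasis_empty.symm⟩
      rw [hf 0 (fun e => h (neg_eq_zero.1 e.symm)) 1 h1, zero_smul, map_zero, ite_self]
  · simp
  · intro x y _ _ hx hy
    rw [map_add]
    nth_rewrite 2 [← hx, ← hy]
    split_ifs <;> simp
  · intro c x _ hx
    rw [map_smul]
    nth_rewrite 2 [← hx]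
    split_ifs <;> simp

/-- Graded `k`-linear maps to `M` are the same as graded `E`-linear maps to `R(M)`. -/
def rrLift (T : DiffMod k w) (l : T.carrier →ₗ[k] M.carrier) :
    T.carrier →ₗ[(Ext k n)ᵐᵒᵖ] RRCarrier M where
  toFun t := ∑ J, rrTmul (l (MulOpposite.op (extBasis k n J) • t)) (omegaDual k n J)
  map_add' s t := by
    rw [← Finset.sum_add_distrib]
    refine Finset.sum_congr rfl fun J _ => ?_
    rw [smul_add, map_add, rrTmul_add_left]
  map_smul' x t := by
    have h1 : ∀ J, l (MulOpposite.op (extBasis k n J) • x • t) =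
        ∑ I, (extBasis k n).repr (x.unop * extBasis k n J) I •
          l (MulOpposite.op (extBasis k n I) • t) := by
      intro J
      have h : MulOpposite.op (extBasis k n J) * x =
          ∑ I, (extBasis k n).repr (x.unop * extBasis k n J) I •
            MulOpposite.op (extBasis k n I) := by
        apply MulOpposite.unop_injective
        rw [Finset.unop_sum]
        simp only [MulOpposite.unop_smul, MulOpposite.unop_op, MulOpposite.unop_mul]
        exact ((extBasis k n).sum_repr _).symm
      rw [← mul_smul, h, Finset.sum_smul, map_sum]
      refine Finset.sum_congr rfl fun I _ => ?_
      rw [smul_assoc, map_smul]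
    have h2 : ∀ I, Omega.mulRight x.unop (omegaDual k n I) =
        ∑ J, (extBasis k n).repr (x.unop * extBasis k n J) I • omegaDual k n J := fun I =>
      (sum_omegaDual _).symm
    simp only [h1, sum_rrTmul, RingHom.id_apply, Finset.smul_sum, op_smul_rrTmul, h2, rrTmul_sum,
      rrTmul_smul]
    exact Finset.sum_comm

theorem rrLift_apply (T : DiffMod k w) (l : T.carrier →ₗ[k] M.carrier) (t : T.carrier) :
    rrLift T l t
      = ∑ J, rrTmul (l (MulOpposite.op (extBasis k n J) • t)) (omegaDual k n J) := rfl

theorem rrLift_mem (T : DiffMod k w) (l : T.carrier →ₗ[k] M.carrier)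
    (hl : ∀ d t, t ∈ T.grading d → (d.2 = 0 → l t ∈ M.grading d.1) ∧ (d.2 ≠ 0 → l t = 0))
    (d : ℤ × ℤ) (t : T.carrier) (ht : t ∈ T.grading d) : rrLift T l t ∈ rrGrading M d := by
  rw [rrLift_apply]
  refine Submodule.sum_mem _ fun J _ => ?_
  have h := hl _ _ (T.smul_mem d _ _ t (extBasis_mem w J) ht)
  by_cases hd : (d + monDeg w J).2 = 0
  · refine Submodule.subset_span ⟨_, _, _, h.1 hd, ?_, rfl⟩
    have e : (d.1 - (d + monDeg w J).1, d.2) = -monDeg w J := by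
      rw [Prod.snd_add] at hd
      ext
      · simp
      · simp only [Prod.snd_neg]
        omega
    rw [e]
    exact omegaDual_mem w J
  · rw [h.2 hd]
    exact (show rrTmul (0 : M.carrier) (omegaDual k n J) = 0 from TensorProduct.zero_tmul _ _) ▸
      zero_mem _

/-- Since R(M) is coinduced, it is enough to extend evaluation at 1 from R(M) to a graded k-linear
map T → M, which is possible over a field. The retraction need not commute with the differentials.
-/
theorem DiffMod.Hom.exists_retraction {T : DiffMod k w} (i : DiffMod.Hom (RR M) T)
    (hi : Function.Injective i.toFun) :
    ∃ ρ : T.carrier →ₗ[(Ext k n)ᵐᵒᵖ] (RR M).carrier,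
      (∀ d t, t ∈ T.grading d → ρ t ∈ (RR M).grading d) ∧ ∀ z, ρ (i.toFun z) = z := by
  obtain ⟨g, hg⟩ := LinearMap.exists_leftInverse_of_injective (i.toFun.restrictScalars k)
    (LinearMap.ker_eq_bot.2 hi)
  have hg' : ∀ z, g (i.toFun z) = z := fun z => LinearMap.congr_fun hg z
  let ev : (RR M).carrier →ₗ[k] M.carrier := rrEval M
  -- g need not respect degrees; l keeps only the part of its evaluation that does.
  obtain ⟨l, hl⟩ := exists_linearMap_of_internal T.isInternal fun d =>
    if d.2 = 0 then component M.isInternal d.1 ∘ₗ ev ∘ₗ g else 0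
  have hli : ∀ z, l (i.toFun z) = ev z := by
    intro z
    refine internal_induction (RR M).isInternal (P := fun z => l (i.toFun z) = ev z) z ?_ ?_ ?_
    · rw [map_zero, map_zero, map_zero]
    · intro d z hz
      rw [hl d _ (i.map_mem d z hz)]
      refine Eq.trans ?_ (rrEval_mem hz)
      split_ifs
      · exact congrArg (fun z => component M.isInternal d.1 (ev z)) (hg' z)
      · rfl
    · intro z z' hz hz'
      rw [map_add, map_add, map_add, hz, hz']
  refine ⟨rrLift T l, rrLift_mem T l fun d t ht => ⟨fun h => ?_, fun h => ?_⟩, fun z => ?_⟩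
  · rw [hl d t ht, if_pos h]
    exact component_mem _ _ _
  · rw [hl d t ht, if_neg h]
    rfl
  -- On R(M), l is evaluation at 1, and the E-linear map attached to it is the identity by expansion
  -- in the dual basis.
  · refine (rrLift_apply T l (i.toFun z)).trans ?_
    refine rr_induction (P := fun z => ∑ J,
      rrTmul (l (MulOpposite.op (extBasis k n J) • i.toFun z)) (omegaDual k n J) = z) z ?_ ?_ ?_
    · have h0 : i.toFun (0 : RRCarrier M) = 0 := map_zero i.toFun
      simp only [h0, smul_zero, map_zero]
      exact Finset.sum_eq_zero fun J _ => TensorProduct.zero_tmul _ _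
    · intro m f
      have h : ∀ J, l (MulOpposite.op (extBasis k n J) • i.toFun (rrTmul m f))
          = f.toDual (extBasis k n J) • m := by
        intro J
        have h2 : MulOpposite.op (extBasis k n J) • i.toFun (rrTmul m f)
            = i.toFun (MulOpposite.op (extBasis k n J) • rrTmul m f : RRCarrier M) :=
          (i.toFun.map_smul _ _).symm
        refine ((congrArg l h2).trans (hli _)).trans ?_
        refine (rrEval_rrTmul m (Omega.mulRight (extBasis k n J) f)).trans ?_
        change f.toDual (extBasis k n J * 1) • m = _
        rw [mul_one]
      simp only [h, rrTmul_smul]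
      rw [← rrTmul_sum, sum_omegaDual]
    · intro s t hs ht
      have hadd : i.toFun (s + t : RRCarrier M) = i.toFun s + i.toFun t := map_add i.toFun s t
      simp only [hadd, smul_add, map_add, rrTmul_add_left, Finset.sum_add_distrib, hs, ht]

end Retraction

/-! ## Tate resolutions as cones -/

section Main

variable {k : Type u} [Field k] {n : ℕ} {w : Fin (n + 1) → ℕ} {F : CoherentSheaf k w}
  {T : DiffMod k w}

/-- For the full index set nothing is divided out, so this case of the exactness property is
exactness of T. -/
theorem IsTateResolution.exact (hT : IsTateResolution F T) : Function.Exact T.diff T.diff := by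
  have hI : IsIrrelevant k (Finset.univ : Finset (Fin (n + 1))) := by
    refine Ideal.span_mono ?_
    rintro _ ⟨i, rfl⟩
    exact ⟨i, by simp, rfl⟩
  have h := hT.exactOn _ hI
  have h0 : T.mulVars (Finset.univ : Finset (Fin (n + 1)))ᶜ = ⊥ := by
    refine Submodule.span_eq_bot.2 ?_
    rintro _ ⟨i, hi, -⟩
    simp at hi
  intro t
  constructor
  · intro ht
    obtain ⟨q, hq⟩ := (h (Submodule.Quotient.mk t)).1 (by rw [Submodule.mapQ_apply, ht]; rfl)
    induction q using Submodule.Quotient.induction_on with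
    | H s =>
      have := (Submodule.Quotient.eq _).1 hq
      rw [h0, Submodule.mem_bot, sub_eq_zero] at this
      exact ⟨s, this⟩
  · rintro ⟨s, rfl⟩
    exact T.diff_diff s

/-- A Tate resolution of `F` is the cone of a minimal free flag resolution of `R(M)`. -/
theorem IsTateResolution.exists_cone (hw : ∀ i, 0 < w i) (hT : IsTateResolution F T)
    {M : GrMod k w} (s : SheafIso M F) (hfin : Module.Finite (Cox k n) M.carrier)
    (hM : M.NoTorsion) :
    ∃ (G : DiffMod k w) (ε : DiffMod.Hom G (RR M)), G.IsFreeFlag ∧ G.IsMinimal ∧ ε.IsQuasiIso ∧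
      DiffMod.IsIsomorphic T (DiffMod.cone ε) := by
  obtain ⟨θ, hθ⟩ := hT.cohomology
  obtain ⟨i, hi, hiθ⟩ := hθ M s hM
  obtain ⟨ρ, hρ, hf⟩ := i.exists_retraction hi
  have hmin := DiffMod.complement_isMinimal i ρ hρ hf hT.minimal
  obtain ⟨ι, b, deg, hb⟩ := DiffMod.complement_exists_basis i ρ hρ hf hT.free
  obtain ⟨N, hN⟩ := s.exists_bound hfin
  refine ⟨DiffMod.complement i ρ hρ hf, DiffMod.complementHom i ρ hρ hf,
    hmin.isFreeFlag hw hb (N + weight w Finset.univ) fun l => ?_, hmin,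
    DiffMod.complementHom_isQuasiIso i ρ hρ hf hT.exact,
    (DiffMod.isIsomorphic_of_bijective _
      (DiffMod.coneComplementHom_bijective i ρ hρ hf)).symm⟩
  by_contra! hl
  -- The top monomial lowers the first degree by w_0 + ⋯ + w_n. A generator above the bound would
  -- thus give a nonzero socle element t of T in first degree a > N, that is, a class in H^j(F(a)).
  set t := MulOpposite.op (extTop k n) • DiffMod.complementIncl i ρ hρ hf (b l) with ht
  have htρ : ρ t = 0 := by
    rw [ht, map_smul, DiffMod.retraction_complementIncl, smul_zero]
  have ht0 : t ≠ 0 := by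
    intro h0
    rw [ht, ← map_smul, ← map_zero (DiffMod.complementIncl i ρ hρ hf)] at h0
    have h1 := congrArg (fun t => b.repr t l)
      (DiffMod.complementIncl_injective i ρ hρ hf h0)
    simp only [map_smul, Module.Basis.repr_self, Finsupp.smul_apply, Finsupp.single_eq_same,
      smul_eq_mul, mul_one, map_zero, Finsupp.zero_apply] at h1
    exact extTop_ne_zero (MulOpposite.op_injective h1)
  have htdeg := T.smul_mem _ _ _ _ (extBasis_mem w Finset.univ)
    (DiffMod.complementIncl_mem i ρ hρ hf (hb l))
  obtain ⟨a, j, haj⟩ : ∃ a j : ℤ,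
      ((deg l).1, (deg l).2 + 1) + monDeg w Finset.univ = (a, -j) :=
    ⟨_, -_, by rw [neg_neg]⟩
  rw [haj] at htdeg
  have ha : N < a := by
    have h1 : (deg l).1 + -weight w Finset.univ = a := congrArg Prod.fst haj
    omega
  have hsoc : t ∈ T.socle (a, -j) := by
    refine ⟨htdeg, fun m => ?_⟩
    rw [ht, ← mul_smul, ← MulOpposite.op_mul, extTop_mul_extGen, MulOpposite.op_zero, zero_smul]
  obtain ⟨h, hh⟩ := (θ a j).surjective ⟨t, hsoc⟩
  by_cases hj : j = 0
  · subst hj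
    -- For j = 0 the class comes from M_a, so t lies in the image of R(M). It also lies in the
    -- kernel of the retraction, so it is 0.
    obtain ⟨m, rfl⟩ := (hN a ha).2 h
    have h1 := hiθ a m
    rw [hh] at h1
    have h1 : i.toFun (rrTmul (m : M.carrier) (omegaOne k n)) = t := h1
    have h2 := hf (rrTmul (m : M.carrier) (omegaOne k n))
    rw [h1, htρ] at h2
    apply ht0
    rw [← h1]
    exact (congrArg i.toFun h2.symm).trans (map_zero i.toFun)
  · apply ht0
    rw [(hN a ha).1 j hj h, map_zero] at hh
    exact (congrArg Subtype.val hh).symm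

theorem DiffMod.Hom.isMinimalFreeResolution {G D : DiffMod k w} {ε : DiffMod.Hom G D}
    (hG : G.IsFreeFlag) (hmin : G.IsMinimal) (hε : ε.IsQuasiIso) : ε.IsMinimalFreeResolution :=
  ⟨⟨hε, G, DiffMod.Hom.id G, DiffMod.Hom.id G, ε, hG, hε, fun _ => rfl, fun _ => rfl⟩, hmin⟩

end Main

end WeightedTate

end

open WeightedTate in
theorem theorem3p4 {k : Type u} [Field k] {n : ℕ} (w : Fin (n + 1) → ℕ) (hw : ∀ i, 0 < w i)
    (F : CoherentSheaf k w) :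
    (∃ M : GrMod k w, Nonempty (SheafIso M F) ∧ Module.Finite (Cox k n) M.carrier ∧
      M.NoTorsion) ∧
    (∀ T : DiffMod k w, IsTateResolution F T →
      ∀ M : GrMod k w, Nonempty (SheafIso M F) → Module.Finite (Cox k n) M.carrier →
        M.NoTorsion →
        (∃ (G : DiffMod k w) (ε : DiffMod.Hom G (RR M)), ε.IsMinimalFreeResolution) ∧
        ∀ (G : DiffMod k w) (ε : DiffMod.Hom G (RR M)), ε.IsMinimalFreeResolution →
          DiffMod.IsIsomorphic T (DiffMod.cone ε)) ∧
    (∀ T T' : DiffMod k w, IsTateResolution F T → IsTateResolution F T' →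
      DiffMod.IsIsomorphic T T') := by
  have key : ∀ T : DiffMod k w, IsTateResolution F T →
      ∀ M : GrMod k w, Nonempty (SheafIso M F) → Module.Finite (Cox k n) M.carrier →
        M.NoTorsion →
        (∃ (G : DiffMod k w) (ε : DiffMod.Hom G (RR M)), ε.IsMinimalFreeResolution) ∧
        ∀ (G : DiffMod k w) (ε : DiffMod.Hom G (RR M)), ε.IsMinimalFreeResolution →
          DiffMod.IsIsomorphic T (DiffMod.cone ε) := by
    rintro T hT M ⟨s⟩ hfin hM
    obtain ⟨G, ε, hG, hmin, hε, hiso⟩ := hT.exists_cone hw s hfin hM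
    exact ⟨⟨G, ε, DiffMod.Hom.isMinimalFreeResolution hG hmin hε⟩, fun G' ε' hε' =>
      hiso.trans (DiffMod.isIsomorphic_cone hG hmin hε hε').symm⟩
  refine ⟨F.exists_grMod, key, fun T T' hT hT' => ?_⟩
  -- One module M serves for T and T', which are then both the cone of the same minimal free
  -- resolution of R(M).
  obtain ⟨M, hs, hfin, hM⟩ := F.exists_grMod
  obtain ⟨⟨G, ε, hε⟩, h⟩ := key T hT M hs hfin hM
  exact (h G ε hε).trans ((key T' hT' M hs hfin hM).2 G ε hε).symm
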